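/- Let $\mathbb T^2=\mathbb R^2/(2\pi\mathbb Z)^2$, $\nu>0$, $2\le p<\infty$, and let $\nu\Delta$ be the operator on the complex space $L^p(\mathbb T^2)$ with domain $W^{2,p}(\mathbb T^2)$. Put $$C_p=\Bigl(1+\frac{p^2}{4}\Bigr)^{1/2},\qquad \delta=\frac12\,\frac1{1+C_p}.$$ An operator generates a uniformly bounded analytic semigroup if it is, with its domain, the infinitesimal generator of a family $T(z)$ of uniformly bounded operators, analytic in a sector $\{|\arg z|<\theta\}$ with $0<\theta<\pi/2$, such that $T(0)=I$, $T(z_1+z_2)=T(z_1)T(z_2)$, and $T(z)x\to x$ as $z\to0$ in the sector, for every $x$. Then: 1. For all $\lambda\in\mathbb C$ with $\operatorname{Re}\lambda\ge0$ and all $u\in W^{2,p}(\mathbb T^2)$: $|\lambda|\,\|u\|_{L^p}\le C_p\,\|\lambda u-\Delta u\|_{L^p}$. 2. If $B$ is a linear operator in $L^p(\mathbb T^2)$ with $W^{2,p}(\mathbb T^2)\subset D(B)$ and $\|Bf\|_{L^p}\le a\|\nu\Delta f\|_{L^p}$ for all $f\in W^{2,p}(\mathbb T^2)$, where $0\le a\le\delta$,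 then $\nu\Delta+B$, with domain $W^{2,p}(\mathbb T^2)$, generates a uniformly bounded analytic semigroup on $L^p(\mathbb T^2)$. 3. There is a constant $K>0$, depending only on $\nu$ and $p$, such that $$\|\partial_i\partial_j f\|_{L^p}\le \frac K4\,\|\nu\Delta f\|_{L^p}\qquad\text{for all } f\in W^{2,p}(\mathbb T^2),\ i,j\in\{1,2\}. \tag{$*$}$$ 4. Let $K>0$ satisfy $(*)$, and let $(\sigma^k)_{k\in\mathbb N}$ be smooth divergence-free vector fields $\mathbb T^2\to\mathbb R^2$ with $\sum_k\|\sigma^k\|_\infty^2<\infty$ and $\sum_k\|\nabla\sigma^k\|_\infty^2<\infty$. Write $\sigma\sigma^T=\sum_k\sigma^k(\sigma^k)^T$, and for $f\in W^{2,p}(\mathbb T^2)$ with Hessian $Hf$ write $Bf=\frac12\sum_k(\sigma^k)^T(Hf)\,\sigma^k=\frac12\sum_{i,j}(\sigma\sigma^T)_{ij}\,\partial_i\partial_jf$. If $$s:=\sup_{i,j=1,2}\|(\sigma\sigma^T)_{ij}\|_{L^\infty(\mathbb T^2)}<\frac{\delta}{K},$$ then $\|Bf\|_{L^p}\le a\,\|\nu\Delta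 f\|_{L^p}$ for all $f\in W^{2,p}(\mathbb T^2)$, with $a=Ks<\delta$, and the operator $A=\nu\Delta+B$ with domain $W^{2,p}(\mathbb T^2)$ generates a uniformly bounded analytic semigroup on $L^p(\mathbb T^2)$. -/

import Mathlib

open scoped ENNReal ContDiff Topology

namespace TorusSemigroup

noncomputable section

instance fact_two_pi_pos : Fact (0 < 2 * Real.pi) := ⟨Real.two_pi_pos⟩

/-- The two-dimensional torus `ℝ² / (2πℤ)²`, with the Lebesgue measure `volume` of total mass
`4π²`. -/
abbrev Torus : Type := Fin 2 → AddCircle (2 * Real.pi)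

/-- The complex Lebesgue space `L^p` of the torus. -/
abbrev LpT (p : ℝ≥0∞) : Type :=
  MeasureTheory.Lp ℂ p (MeasureTheory.volume : MeasureTheory.Measure Torus)

/-- The covering map `ℝ² → 𝕋²`. -/
def cover (v : Fin 2 → ℝ) : Torus := fun i => (v i : AddCircle (2 * Real.pi))

/-- A function on the torus is smooth when its periodic lift to the plane is smooth. -/
def IsSmooth {E : Type*} [NormedAddCommGroup E] [NormedSpace ℝ E] (φ : Torus → E) : Prop :=
  ContDiff ℝ ∞ (fun v : Fin 2 → ℝ => φ (cover v))

/-- The classical partial derivative `∂ᵢ φ` of a function on the torus. -/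
def partialDeriv {E : Type*} [NormedAddCommGroup E] [NormedSpace ℝ E] (i : Fin 2)
    (φ : Torus → E) (x : Torus) : E :=
  deriv (fun t : ℝ => φ (x + Pi.single i (t : AddCircle (2 * Real.pi)))) 0

/-- `g` is the weak partial derivative `∂ᵢ f`. -/
def IsWeakPartial {p : ℝ≥0∞} (i : Fin 2) (f g : LpT p) : Prop :=
  ∀ φ : Torus → ℂ, IsSmooth φ → ∫ x, f x * partialDeriv i φ x = -∫ x, g x * φ x

/-! ### Uniqueness of weak derivatives -/

theorem continuous_cover : Continuous cover :=
  continuous_pi fun i => (AddCircle.continuous_mk' _).comp (continuous_apply i)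

theorem isOpenQuotientMap_cover : IsOpenQuotientMap cover := by
  have h : ∀ _ : Fin 2, IsOpenQuotientMap (fun t : ℝ => (t : AddCircle (2 * Real.pi))) :=
    fun _ => QuotientAddGroup.isOpenQuotientMap_mk
  exact IsOpenQuotientMap.piMap h

theorem IsSmooth.continuous {E : Type*} [NormedAddCommGroup E] [NormedSpace ℝ E]
    {φ : Torus → E} (h : IsSmooth φ) : Continuous φ :=
  isOpenQuotientMap_cover.isQuotientMap.continuous_iff.2 (ContDiff.continuous h)

theorem partialDeriv_cover {E : Type*} [NormedAddCommGroup E] [NormedSpace ℝ E] {φ : Torus → E}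
    (h : IsSmooth φ) (i : Fin 2) (v : Fin 2 → ℝ) :
    partialDeriv i φ (cover v) =
      fderiv ℝ (fun w : Fin 2 → ℝ => φ (cover w)) v (Pi.single i 1) := by
  have h1 : ∀ t : ℝ, cover v + Pi.single i (t : AddCircle (2 * Real.pi)) =
      cover (v + t • Pi.single i 1) := by
    intro t
    ext j
    by_cases hj : j = i
    · subst hj; simp [cover]
    · simp [cover, hj]
  have h2 : HasFDerivAt (fun w : Fin 2 → ℝ => φ (cover w))
      (fderiv ℝ (fun w : Fin 2 → ℝ => φ (cover w)) v) v :=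
    (ContDiff.differentiable h (by simp)).differentiableAt.hasFDerivAt
  unfold partialDeriv
  simp only [h1]
  exact (h2.hasLineDerivAt (Pi.single i 1)).deriv

theorem IsSmooth.continuous_partialDeriv {E : Type*} [NormedAddCommGroup E] [NormedSpace ℝ E]
    {φ : Torus → E} (h : IsSmooth φ) (i : Fin 2) : Continuous (partialDeriv i φ) := by
  refine isOpenQuotientMap_cover.isQuotientMap.continuous_iff.2 ?_
  have : (partialDeriv i φ ∘ cover) = fun v =>
      fderiv ℝ (fun w : Fin 2 → ℝ => φ (cover w)) v (Pi.single i 1) :=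
    funext fun v => partialDeriv_cover h i v
  rw [this]
  exact (ContDiff.continuous_fderiv h (by simp)).clm_apply continuous_const

theorem integrable_mul {f : Torus → ℂ} (hf : MeasureTheory.Integrable f) {c : Torus → ℂ}
    (hc : Continuous c) : MeasureTheory.Integrable (fun x => f x * c x) := by
  obtain ⟨C, hC⟩ := isCompact_univ.exists_bound_of_continuousOn hc.continuousOn
  exact hf.mul_bdd (c := C) hc.aestronglyMeasurable
    (Filter.Eventually.of_forall fun x => hC x (Set.mem_univ x))

theorem integrable_LpT {p : ℝ≥0∞} [Fact (1 ≤ p)] (f : LpT p) :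
    MeasureTheory.Integrable (fun x => f x) :=
  (MeasureTheory.Lp.memLp f).integrable Fact.out

/-- The star algebra of smooth functions. -/
def smoothAlgebra : StarSubalgebra ℂ C(Torus, ℂ) where
  carrier := {c | IsSmooth (E := ℂ) c}
  mul_mem' {a b} ha hb := by
    have ha' : ContDiff ℝ ∞ (fun v : Fin 2 → ℝ => a (cover v)) := ha
    have hb' : ContDiff ℝ ∞ (fun v : Fin 2 → ℝ => b (cover v)) := hb
    exact ha'.mul hb'
  add_mem' {a b} ha hb := by
    have ha' : ContDiff ℝ ∞ (fun v : Fin 2 → ℝ => a (cover v)) := ha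
    have hb' : ContDiff ℝ ∞ (fun v : Fin 2 → ℝ => b (cover v)) := hb
    exact ha'.add hb'
  algebraMap_mem' r := by
    change ContDiff ℝ ∞ (fun _ : Fin 2 → ℝ => r)
    exact contDiff_const
  star_mem' {a} ha := by
    have ha' : ContDiff ℝ ∞ (fun v : Fin 2 → ℝ => a (cover v)) := ha
    exact Complex.conjCLE.contDiff.comp ha'

theorem isSmooth_fourier (i : Fin 2) :
    IsSmooth (fun x : Torus => fourier (T := 2 * Real.pi) 1 (x i)) := by
  have : (fun v : Fin 2 → ℝ => fourier (T := 2 * Real.pi) 1 (cover v i)) =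
      fun v => Complex.exp (Complex.I * (v i : ℂ)) := by
    funext v
    have hpi : (Real.pi : ℂ) ≠ 0 := by exact_mod_cast Real.pi_ne_zero
    rw [cover, fourier_coe_apply]
    congr 1
    push_cast
    field_simp
  change ContDiff ℝ ∞ (fun v : Fin 2 → ℝ => fourier (T := 2 * Real.pi) 1 (cover v i))
  rw [this]
  exact (contDiff_const.mul (Complex.ofRealCLM.contDiff.comp (contDiff_apply ℝ ℝ i))).cexp

theorem smoothAlgebra_closure : smoothAlgebra.topologicalClosure = ⊤ := by
  refine ContinuousMap.starSubalgebra_topologicalClosure_eq_top_of_separatesPoints _ ?_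
  intro x y hxy
  obtain ⟨i, hi⟩ := Function.ne_iff.1 hxy
  refine ⟨_, ⟨⟨_, (isSmooth_fourier i).continuous⟩, isSmooth_fourier i, rfl⟩, ?_⟩
  simp only [ContinuousMap.coe_mk, fourier_one, ne_eq]
  intro h
  exact hi (AddCircle.injective_toCircle Real.two_pi_pos.ne' (Subtype.ext h))

theorem ae_zero_of_forall_smooth {u : Torus → ℂ} (hu : MeasureTheory.Integrable u)
    (h : ∀ φ : Torus → ℂ, IsSmooth φ → ∫ x, u x * φ x = 0) :
    u =ᵐ[MeasureTheory.volume] 0 := by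
  have hcont : ∀ c : C(Torus, ℂ), ∫ x, u x * c x = 0 := by
    intro c
    have hc : c ∈ smoothAlgebra.topologicalClosure := by rw [smoothAlgebra_closure]; trivial
    have hc' : c ∈ closure (smoothAlgebra : Set C(Torus, ℂ)) := hc
    rw [mem_closure_iff_seq_limit] at hc'
    obtain ⟨s, hs, hlim⟩ := hc'
    have hb : ∃ M, ∀ n, ‖s n‖ ≤ M := by
      obtain ⟨M, hM⟩ := (Metric.isBounded_range_of_tendsto s hlim).exists_norm_le
      exact ⟨M, fun n => hM _ ⟨n, rfl⟩⟩
    obtain ⟨M, hM⟩ := hb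
    have ht : Filter.Tendsto (fun n => ∫ x, u x * s n x) Filter.atTop (𝓝 (∫ x, u x * c x)) := by
      refine MeasureTheory.tendsto_integral_of_dominated_convergence (fun x => ‖u x‖ * M)
        (fun n => (integrable_mul hu (s n).continuous).aestronglyMeasurable)
        (hu.norm.mul_const M) (fun n => Filter.Eventually.of_forall fun x => ?_)
        (Filter.Eventually.of_forall fun x => ?_)
      · rw [norm_mul]
        exact mul_le_mul_of_nonneg_left (((s n).norm_coe_le_norm x).trans (hM n)) (norm_nonneg _)
      · exact ((ContinuousEvalConst.continuous_eval_const x).tendsto c |>.comp hlim).const_mul (u x)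
    have h0 : (fun n => ∫ x, u x * s n x) = fun _ => (0 : ℂ) := funext fun n => h _ (hs n)
    rw [h0] at ht
    exact tendsto_nhds_unique ht tendsto_const_nhds
  refine MeasureTheory.ae_eq_zero_of_forall_setIntegral_isClosed_eq_zero hu fun F hF => ?_
  have ht : Filter.Tendsto (fun n => ∫ x, u x * ((hF.apprSeq n x : ℝ) : ℂ)) Filter.atTop
      (𝓝 (∫ x, F.indicator u x)) := by
    refine MeasureTheory.tendsto_integral_of_dominated_convergence (fun x => ‖u x‖)
      (fun n => (integrable_mul hu ?_).aestronglyMeasurable)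
      hu.norm (fun n => Filter.Eventually.of_forall fun x => ?_)
      (Filter.Eventually.of_forall fun x => ?_)
    · exact Complex.continuous_ofReal.comp (NNReal.continuous_coe.comp (hF.apprSeq n).continuous)
    · rw [norm_mul]
      refine mul_le_of_le_one_right (norm_nonneg _) ?_
      have := HasOuterApproxClosed.apprSeq_apply_le_one hF n x
      simpa using this
    · have h1 := (tendsto_pi_nhds.1 (HasOuterApproxClosed.tendsto_apprSeq hF)) x
      have h2 := ((Complex.continuous_ofReal.comp NNReal.continuous_coe).tendsto _).comp h1
      have h3 := h2.const_mul (u x)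
      have h4 : F.indicator u x =
          u x * (Complex.ofReal ∘ NNReal.toReal) (F.indicator (fun _ => 1) x) := by
        by_cases hx : x ∈ F
        · rw [Set.indicator_of_mem hx, Set.indicator_of_mem hx]; simp
        · rw [Set.indicator_of_notMem hx, Set.indicator_of_notMem hx]; simp
      rw [h4]
      exact h3
  have h0 : (fun n => ∫ x, u x * ((hF.apprSeq n x : ℝ) : ℂ)) = fun _ => (0 : ℂ) :=
    funext fun n => hcont ⟨fun x => ((hF.apprSeq n x : ℝ) : ℂ),
      Complex.continuous_ofReal.comp (NNReal.continuous_coe.comp (hF.apprSeq n).continuous)⟩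
  rw [h0] at ht
  rw [← MeasureTheory.integral_indicator hF.measurableSet]
  exact tendsto_nhds_unique ht tendsto_const_nhds

section Sobolev

variable {p : ℝ≥0∞} [Fact (1 ≤ p)]

theorem IsWeakPartial.unique {i : Fin 2} {f g g' : LpT p} (h : IsWeakPartial i f g)
    (h' : IsWeakPartial i f g') : g = g' := by
  have key := ae_zero_of_forall_smooth (u := fun x => g x - g' x)
    ((integrable_LpT g).sub (integrable_LpT g')) (fun φ hφ => by
      simp only [sub_mul]
      rw [MeasureTheory.integral_sub (integrable_mul (integrable_LpT g) hφ.continuous)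
        (integrable_mul (integrable_LpT g') hφ.continuous)]
      have := (h φ hφ).symm.trans (h' φ hφ)
      rw [neg_inj] at this
      rw [this, sub_self])
  refine MeasureTheory.Lp.ext ?_
  filter_upwards [key] with x hx
  exact sub_eq_zero.1 hx

theorem IsWeakPartial.add {i : Fin 2} {f g f' g' : LpT p} (h : IsWeakPartial i f g)
    (h' : IsWeakPartial i f' g') : IsWeakPartial i (f + f') (g + g') := by
  intro φ hφ
  have hd := hφ.continuous_partialDeriv i
  have e1 : ∫ x, (f + f' : LpT p) x * partialDeriv i φ x =
      ∫ x, (f x * partialDeriv i φ x + f' x * partialDeriv i φ x) := by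
    refine MeasureTheory.integral_congr_ae ?_
    filter_upwards [MeasureTheory.Lp.coeFn_add f f'] with x hx
    rw [hx, Pi.add_apply, add_mul]
  have e2 : ∫ x, (g + g' : LpT p) x * φ x = ∫ x, (g x * φ x + g' x * φ x) := by
    refine MeasureTheory.integral_congr_ae ?_
    filter_upwards [MeasureTheory.Lp.coeFn_add g g'] with x hx
    rw [hx, Pi.add_apply, add_mul]
  rw [e1, e2, MeasureTheory.integral_add (integrable_mul (integrable_LpT f) hd)
      (integrable_mul (integrable_LpT f') hd),
    MeasureTheory.integral_add (integrable_mul (integrable_LpT g) hφ.continuous)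
      (integrable_mul (integrable_LpT g') hφ.continuous), h φ hφ, h' φ hφ, neg_add]

theorem IsWeakPartial.smul {p : ℝ≥0∞} {i : Fin 2} {f g : LpT p} (c : ℂ) (h : IsWeakPartial i f g) :
    IsWeakPartial i (c • f) (c • g) := by
  intro φ hφ
  have e1 : ∫ x, (c • f : LpT p) x * partialDeriv i φ x =
      ∫ x, c * (f x * partialDeriv i φ x) := by
    refine MeasureTheory.integral_congr_ae ?_
    filter_upwards [MeasureTheory.Lp.coeFn_smul c f] with x hx
    rw [hx, Pi.smul_apply, smul_eq_mul, mul_assoc]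
  have e2 : ∫ x, (c • g : LpT p) x * φ x = ∫ x, c * (g x * φ x) := by
    refine MeasureTheory.integral_congr_ae ?_
    filter_upwards [MeasureTheory.Lp.coeFn_smul c g] with x hx
    rw [hx, Pi.smul_apply, smul_eq_mul, mul_assoc]
  rw [e1, e2, MeasureTheory.integral_const_mul, MeasureTheory.integral_const_mul, h φ hφ, mul_neg]

/-- `G i` and `H i j` are the weak derivatives `∂ᵢ f` and `∂ⱼ ∂ᵢ f`, all of them in `L^p`. -/
def HasWeakDerivs {p : ℝ≥0∞} (f : LpT p) (G : Fin 2 → LpT p) (H : Fin 2 → Fin 2 → LpT p) : Prop :=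
  (∀ i, IsWeakPartial i f (G i)) ∧ ∀ i j, IsWeakPartial j (G i) (H i j)

theorem HasWeakDerivs.add {f f' : LpT p} {G G' : Fin 2 → LpT p} {H H' : Fin 2 → Fin 2 → LpT p}
    (h : HasWeakDerivs f G H) (h' : HasWeakDerivs f' G' H') :
    HasWeakDerivs (f + f') (G + G') (H + H') :=
  ⟨fun i => (h.1 i).add (h'.1 i), fun i j => (h.2 i j).add (h'.2 i j)⟩

theorem HasWeakDerivs.smul {p : ℝ≥0∞} {f : LpT p} {G : Fin 2 → LpT p} {H : Fin 2 → Fin 2 → LpT p} (c : ℂ)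
    (h : HasWeakDerivs f G H) : HasWeakDerivs (c • f) (c • G) (c • H) :=
  ⟨fun i => (h.1 i).smul c, fun i j => (h.2 i j).smul c⟩

theorem HasWeakDerivs.unique {f : LpT p} {G G' : Fin 2 → LpT p} {H H' : Fin 2 → Fin 2 → LpT p}
    (h : HasWeakDerivs f G H) (h' : HasWeakDerivs f G' H') : H = H' := by
  have hG : G = G' := funext fun i => (h.1 i).unique (h'.1 i)
  subst hG
  exact funext fun i => funext fun j => (h.2 i j).unique (h'.2 i j)

variable (p)

/-- The Sobolev space `W^{2,p}` of the torus. -/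
def W2 : Submodule ℂ (LpT p) where
  carrier := {f | ∃ G H, HasWeakDerivs f G H}
  zero_mem' := ⟨0, 0, fun i φ _ => by simp, fun i j φ _ => by simp⟩
  add_mem' := fun ⟨G, H, h⟩ ⟨G', H', h'⟩ => ⟨G + G', H + H', h.add h'⟩
  smul_mem' := fun c _ ⟨G, H, h⟩ => ⟨c • G, c • H, h.smul c⟩

variable {p}

/-- The weak Hessian of a function of class `W^{2,p}`. -/
def hessian (f : W2 p) : Fin 2 → Fin 2 → LpT p := f.2.choose_spec.choose

theorem hessian_spec (f : W2 p) : ∃ G, HasWeakDerivs (f : LpT p) G (hessian f) :=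
  ⟨f.2.choose, f.2.choose_spec.choose_spec⟩

theorem hessian_eq {f : W2 p} {G : Fin 2 → LpT p} {H : Fin 2 → Fin 2 → LpT p}
    (h : HasWeakDerivs (f : LpT p) G H) : hessian f = H :=
  let ⟨_, h'⟩ := hessian_spec f
  h'.unique h

/-- The weak second derivative `∂ⱼ ∂ᵢ : W^{2,p} → L^p`. -/
def secondDeriv (p : ℝ≥0∞) [Fact (1 ≤ p)] (i j : Fin 2) : W2 p →ₗ[ℂ] LpT p where
  toFun f := hessian f i j
  map_add' f g := by
    obtain ⟨G, hG⟩ := hessian_spec f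
    obtain ⟨G', hG'⟩ := hessian_spec g
    rw [hessian_eq (f := f + g) (hG.add hG')]; rfl
  map_smul' c f := by
    obtain ⟨G, hG⟩ := hessian_spec f
    rw [hessian_eq (f := c • f) (hG.smul c)]; rfl

end Sobolev

/-- Multiplication by a continuous real function on `L^p`. -/
def mulOp (p : ℝ≥0∞) (a : C(Torus, ℝ)) : LpT p →ₗ[ℂ] LpT p where
  toFun f := MeasureTheory.MemLp.toLp (fun x => (a x : ℂ) * f x)
    (MeasureTheory.MemLp.of_le_mul (c := ‖a‖) (MeasureTheory.Lp.memLp f)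
      ((Complex.continuous_ofReal.comp a.continuous).aestronglyMeasurable.mul
        (MeasureTheory.Lp.aestronglyMeasurable f))
      (Filter.Eventually.of_forall fun x => by
        rw [norm_mul, Complex.norm_real]
        exact mul_le_mul_of_nonneg_right (a.norm_coe_le_norm x) (norm_nonneg _)))
  map_add' f g := by
    rw [← MeasureTheory.MemLp.toLp_add, MeasureTheory.MemLp.toLp_eq_toLp_iff]
    filter_upwards [MeasureTheory.Lp.coeFn_add f g] with x hx
    simp only [hx, Pi.add_apply, mul_add]
  map_smul' c f := by
    rw [RingHom.id_apply, ← MeasureTheory.MemLp.toLp_const_smul,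
      MeasureTheory.MemLp.toLp_eq_toLp_iff]
    filter_upwards [MeasureTheory.Lp.coeFn_smul c f] with x hx
    simp only [hx, Pi.smul_apply, smul_eq_mul]
    ring

/-- The noise coefficients: a sequence of smooth divergence-free vector fields `σ_k` on the torus
with `∑ ‖σ_k‖_∞² < ∞` and `∑ ‖∇σ_k‖_∞² < ∞`. -/
structure NoiseFamily where
  field : ℕ → Torus → EuclideanSpace ℝ (Fin 2)
  smooth : ∀ k, IsSmooth (field k)
  divFree : ∀ k x, ∑ i, partialDeriv i (fun y => field k y i) x = 0
  summable_sq : Summable fun k => (⨆ x, ‖field k x‖) ^ 2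
  summable_grad_sq : ∀ i j,
    Summable fun k => (⨆ x, |partialDeriv j (fun y => field k y i) x|) ^ 2

theorem NoiseFamily.abs_mul_le (S : NoiseFamily) (i j : Fin 2) (k : ℕ) (x : Torus) :
    ‖S.field k x i * S.field k x j‖ ≤ (⨆ y, ‖S.field k y‖) ^ 2 := by
  have hb : BddAbove (Set.range fun y => ‖S.field k y‖) :=
    (isCompact_range (S.smooth k).continuous.norm).bddAbove
  have h : ‖S.field k x‖ ≤ ⨆ y, ‖S.field k y‖ := le_ciSup hb x
  rw [norm_mul, sq]
  exact mul_le_mul ((PiLp.norm_apply_le _ i).trans h) ((PiLp.norm_apply_le _ j).trans h)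
    (norm_nonneg _) ((norm_nonneg _).trans h)

/-- The entry `(σ σᵀ)_{i j} = ∑_k σ_k^i σ_k^j`. -/
def NoiseFamily.covariance (S : NoiseFamily) (i j : Fin 2) : C(Torus, ℝ) where
  toFun x := ∑' k, S.field k x i * S.field k x j
  continuous_toFun := by
    refine continuous_tsum (fun k => ?_) S.summable_sq (S.abs_mul_le i j)
    have := (S.smooth k).continuous
    fun_prop

/-- `sup_{i,j} ‖(σ σᵀ)_{i j}‖_{L^∞}`. -/
def NoiseFamily.size (S : NoiseFamily) : ℝ := ⨆ i, ⨆ j, ‖S.covariance i j‖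

/-- The operator `νΔ` on `L^p` with domain `W^{2,p}`. -/
def laplaceOp (ν : ℝ) (p : ℝ≥0∞) [Fact (1 ≤ p)] : LpT p →ₗ.[ℂ] LpT p where
  domain := W2 p
  toFun := (ν : ℂ) • ∑ i, secondDeriv p i i

/-- The operator `f ↦ ½ ∑_k (σ_k)ᵀ (H f) σ_k = ½ ∑_{i,j} (σ σᵀ)_{i j} ∂ᵢ ∂ⱼ f` on `L^p` with
domain `W^{2,p}`. -/
def NoiseFamily.noiseOp (S : NoiseFamily) (p : ℝ≥0∞) [Fact (1 ≤ p)] : LpT p →ₗ.[ℂ] LpT p where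
  domain := W2 p
  toFun := (1 / 2 : ℂ) • ∑ i, ∑ j, mulOp p (S.covariance i j) ∘ₗ secondDeriv p i j

/-- The bound `‖∂ᵢ∂ⱼ f‖_p ≤ (K/4) ‖νΔ f‖_p` on all second derivatives in `W^{2,p}`. -/
def HessianBound (ν : ℝ) (p : ℝ≥0∞) [Fact (1 ≤ p)] (K : ℝ) : Prop :=
  ∀ (f : W2 p) (i j : Fin 2), ‖secondDeriv p i j f‖ ≤ K / 4 * ‖laplaceOp ν p f‖

/-- The constant `C_p = (1 + p²/4)^{1/2}`. -/
def resolventConst (p : ℝ≥0∞) : ℝ := Real.sqrt (1 + p.toReal ^ 2 / 4)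

/-- The threshold `δ = ½ · 1 / (1 + C_p)`. -/
def threshold (p : ℝ≥0∞) : ℝ := 1 / 2 * (1 / (1 + resolventConst p))

section Semigroup

variable {X : Type*} [NormedAddCommGroup X] [NormedSpace ℂ X]

/-- The open sector `{z : φ₁ < arg z < φ₂}`; the vertex is excluded. -/
def sector (φ₁ φ₂ : ℝ) : Set ℂ := {z | z ≠ 0 ∧ φ₁ < z.arg ∧ z.arg < φ₂}

/-- `T` is an analytic semigroup of bounded operators in the sector `{φ₁ < arg z < φ₂}`. The values
of `T` outside the sector and the origin play no role. -/
structure IsAnalyticSemigroup (φ₁ φ₂ : ℝ) (T : ℂ → X →L[ℂ] X) : Prop where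
  neg : φ₁ < 0
  pos : 0 < φ₂
  analytic : DifferentiableOn ℂ T (sector φ₁ φ₂)
  zero : T 0 = 1
  tendsto : ∀ x, Filter.Tendsto (fun z => T z x) (𝓝[sector φ₁ φ₂] 0) (𝓝 x)
  add : ∀ z₁ ∈ sector φ₁ φ₂, ∀ z₂ ∈ sector φ₁ φ₂, T (z₁ + z₂) = T z₁ * T z₂

/-- `A`, with its domain, is the infinitesimal generator of `T`: the pairs `(x, A x)`, `x ∈ D(A)`,
are exactly the pairs `(x, lim_{t ↓ 0} (T t x - x) / t)` for which the limit exists. -/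
def IsGenerator (A : X →ₗ.[ℂ] X) (T : ℂ → X →L[ℂ] X) : Prop :=
  ∀ x y : X, (x, y) ∈ A.graph ↔
    Filter.Tendsto (fun t : ℝ => (t : ℂ)⁻¹ • (T t x - x)) (𝓝[>] 0) (𝓝 y)

/-- `A` is the infinitesimal generator of a uniformly bounded analytic semigroup in a sector
`{|arg z| < θ}`, `0 < θ < π/2`. -/
def GeneratesBoundedAnalyticSemigroup (A : X →ₗ.[ℂ] X) : Prop :=
  ∃ (θ : ℝ) (T : ℂ → X →L[ℂ] X), θ < Real.pi / 2 ∧ IsAnalyticSemigroup (-θ) θ T ∧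
    (∃ M : ℝ, ∀ z ∈ sector (-θ) θ, ‖T z‖ ≤ M) ∧ IsGenerator A T

end Semigroup

end

end TorusSemigroup

open TorusSemigroup

namespace TorusSemigroup

/-! ### Power-bounded elements of a Banach algebra -/

section PowerBounded

variable {𝔸 : Type*} [NormedRing 𝔸] [NormedAlgebra ℂ 𝔸] [CompleteSpace 𝔸]

/-! Three independent mechanisms carry the theorem.

Resolvent bound. Pair `λu - Δu` with `|u|^{p-2} ū` and integrate by parts. The gradient term `Q` has
`Re Q ≥ 0` and `|Im Q| ≤ (p/2 - 1) Re Q`, so `λ ‖u‖_p^p + Q = F` forces `|λ| ‖u‖_p^p ≤ C_p |F|`, and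
Hölder bounds `F`. This is done for trigonometric polynomials, with `|u|² + ε` in place of `|u|²`
(`regularized_resolvent_estimate`, `resolvent_estimate_trig`).

Second derivatives. The bound of `∂ᵢ∂ⱼ` by `Δ` is proved by duality and a Bellman function, without
singular integrals. Let `f = Δc` and `g` both evolve by the heat flow. Then `∫ ∂ᵢ∂ⱼc ḡ` is the time
integral of `2 ∫ ∂ⱼf · conj (∂ᵢg)`. A function of `|f|²` and `|g|²` comparable to `|f|^p + |g|^q`,
whose `-(∂ₜ - Δ)` dominates `|∇f||∇g|` pointwise, bounds that time integral by its initial mass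
(`heat_bellman_le`, `norm_integral_le_regularized`). The choice `g ∼ |h|^{p-2} h` with `h = ∂ᵢ∂ⱼc`
then gives the `L^p` bound (`norm_second_derivative_trig_le`).

With these bounds `z - Δ` is solved for trigonometric data by a Fourier multiplier and for all of
`L^p` by density. Uniqueness through Fourier coefficients shows that every element of `W^{2,p}` is a
limit of trigonometric polynomials together with its second derivatives, so both estimates pass to
`W^{2,p}` (`exists_isTrigLimit`).

Generation. A bound `‖z R(z)‖ ≤ M` on the right half-plane survives a perturbation `B` with `a (1 +
M) ≤ 1/2`, by a Neumann series; the threshold `δ` is exactly this condition for `M = C_p`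
(`ResolventBound.add`). The semigroup is the strong limit of the exponentials of the Yosida
approximations. These inherit the half-plane bound, which by `norm_pow_le_of_resolvent_bound` gives
uniformly bounded exponentials on the positive half-line. The bound also survives a small rotation
of the operator, so the exponentials are uniformly bounded in a sector, where holomorphy, the
semigroup law and strong continuity pass to the limit (`ResolventBound.generates`). -/

theorem circleAverage_inv_norm_one_sub_sq {ρ : ℝ} (h0 : 0 < ρ) (h1 : ρ < 1) :
    Real.circleAverage (fun w : ℂ => (‖1 - w‖ ^ 2)⁻¹) 0 ρ = (1 - ρ ^ 2)⁻¹ := by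
  have hlt : ρ ^ 2 < ρ := by nlinarith
  have hpos : 0 < 1 - ρ ^ 2 := by nlinarith
  -- The Poisson kernel of the disc of radius ρ with pole ρ² has average 1. On `|z| = ρ` one has `z
  -- - ρ² = z · conj (1 - z)`, so this kernel equals `(1 - ρ²) / |1 - z|²`.
  have h := DiffContOnCl.circleAverage_poissonKernel_smul' (f := fun _ : ℂ => (1 : ℂ)) (c := 0)
    (R := ρ) (w := ((ρ ^ 2 : ℝ) : ℂ)) diffContOnCl_const (by simpa [abs_of_pos h0] using hlt)
  have h2 : Set.EqOn (fun z : ℂ => ((‖z - 0‖ ^ 2 - ‖((ρ ^ 2 : ℝ) : ℂ) - 0‖ ^ 2) /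
      ‖(z - 0) - (((ρ ^ 2 : ℝ) : ℂ) - 0)‖ ^ 2) • (1 : ℂ))
      (fun z => (1 - ρ ^ 2) • Complex.ofRealCLM ((‖1 - z‖ ^ 2)⁻¹)) (Metric.sphere 0 |ρ|) := by
    intro z hz
    have hz' : ‖z‖ = ρ := by simpa [abs_of_pos h0] using hz
    have e1 : z - ((ρ ^ 2 : ℝ) : ℂ) = z * (starRingEnd ℂ) (1 - z) := by
      rw [map_sub, map_one, mul_sub, mul_one, Complex.mul_conj, Complex.normSq_eq_norm_sq, hz']
    have e2 : ‖z - ((ρ ^ 2 : ℝ) : ℂ)‖ = ρ * ‖1 - z‖ := by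
      rw [e1, norm_mul, hz', RCLike.norm_conj]
    have e3 : ‖((ρ ^ 2 : ℝ) : ℂ)‖ = ρ ^ 2 := by
      rw [Complex.norm_real, Real.norm_of_nonneg (by positivity)]
    have e4 : (ρ ^ 2 - (ρ ^ 2) ^ 2) / (ρ * ‖1 - z‖) ^ 2 = (1 - ρ ^ 2) * (‖1 - z‖ ^ 2)⁻¹ := by
      rw [mul_pow, show ρ ^ 2 - (ρ ^ 2) ^ 2 = ρ ^ 2 * (1 - ρ ^ 2) by ring,
        mul_div_mul_left _ _ (by positivity), div_eq_mul_inv]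
    simp only [sub_zero, hz', e2, e3, e4]
    simp
  rw [Real.circleAverage_congr_sphere h2, Real.circleAverage_fun_smul] at h
  have hintg : CircleIntegrable (fun w : ℂ => (‖1 - w‖ ^ 2)⁻¹) 0 ρ := by
    refine ContinuousOn.circleIntegrable h0.le ?_
    refine ContinuousOn.inv₀ (by fun_prop) ?_
    intro z hz h
    have hz' : ‖z‖ = ρ := by simpa using hz
    have : 1 = z := by simpa [sub_eq_zero] using h
    rw [← this, norm_one] at hz'
    linarith
  have h3 := Complex.ofRealCLM.circleAverage_comp_comm hintg
  have h4 : (Real.circleAverage (fun z => Complex.ofRealCLM ((‖1 - z‖ ^ 2)⁻¹)) 0 ρ : ℂ)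
    = Complex.ofRealCLM (Real.circleAverage (fun w : ℂ => (‖1 - w‖ ^ 2)⁻¹) 0 ρ) := h3
  rw [h4] at h
  have h5 : (1 - ρ ^ 2) * (Real.circleAverage (fun w : ℂ => (‖1 - w‖ ^ 2)⁻¹) 0 ρ) = 1 := by
    rw [Complex.ofRealCLM_apply, Complex.real_smul] at h
    exact_mod_cast h
  exact eq_inv_of_mul_eq_one_right h5

theorem hasDerivAt_inverse_one_sub_smul {r : 𝔸} {w : ℂ} (hw : IsUnit (1 - w • r)) :
    HasDerivAt (fun z : ℂ => Ring.inverse (1 - z • r))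
      (Ring.inverse (1 - w • r) * r * Ring.inverse (1 - w • r)) w := by
  have H₁ : HasFDerivAt Ring.inverse _ (1 - w • r) := hasFDerivAt_ringInverse (𝕜 := ℂ) hw.unit
  have H₂ : HasDerivAt (fun z : ℂ => 1 - z • r) (-r) w := by
    simpa using ((hasDerivAt_id w).smul_const r).const_sub 1
  have := H₁.comp_hasDerivAt w H₂
  simpa [← Ring.inverse_unit hw.unit] using! this

/-- Taylor coefficients at the origin of `w ↦ (r (1 - w r)⁻¹)²`. -/
theorem iteratedDeriv_sq_resolvent (r : 𝔸) (n : ℕ) :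
    iteratedDeriv n (fun w : ℂ => r * (Ring.inverse (1 - w • r) * r * Ring.inverse (1 - w • r))) 0 =
      ((n + 1).factorial : ℂ) • r ^ (n + 2) := by
  have h1 := (spectrum.hasFPowerSeriesOnBall_inverse_one_sub_smul ℂ r).factorial_smul 1 (n + 1)
  rw [← iteratedDeriv_eq_iteratedFDeriv] at h1
  have hev : (fun w : ℂ => Ring.inverse (1 - w • r) * r * Ring.inverse (1 - w • r)) =ᶠ[𝓝 0]
      deriv (fun z : ℂ => Ring.inverse (1 - z • r)) := by
    have : ∀ᶠ w : ℂ in 𝓝 0, IsUnit (1 - w • r) := by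
      have hc : Continuous fun w : ℂ => 1 - w • r := by fun_prop
      exact hc.continuousAt.eventually (Units.isOpen.mem_nhds (by simp))
    filter_upwards [this] with w hw
    exact (hasDerivAt_inverse_one_sub_smul hw).deriv.symm
  have hs : ContDiffAt ℂ n (fun w : ℂ => Ring.inverse (1 - w • r)) 0 := by
    have h2 : ContDiffAt ℂ n (fun w : ℂ => 1 - w • r) 0 := by fun_prop
    refine ContDiffAt.comp (g := Ring.inverse) (0 : ℂ) ?_ h2
    simpa using contDiffAt_ringInverse ℂ (1 : 𝔸ˣ)
  rw [iteratedDeriv_const_mul r ((hs.mul contDiffAt_const).mul hs), hev.iteratedDeriv_eq,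
    ← iteratedDeriv_succ', ← h1, pow_succ' r (n + 1)]
  simp [← Nat.cast_smul_eq_nsmul ℂ]

/-- The hypothesis is Ritt's condition. Cauchy's formula is applied to the square of `r (1 - w
r)⁻¹`, whose Taylor coefficients are `(n + 1) r ^ (n + 2)`. The square is at most `M² |1 - w|⁻²`,
whose average over the circle of radius ρ is only `(1 - ρ²)⁻¹`, of order n, and the factor `n + 1`
absorbs it. -/
theorem norm_pow_le_of_resolvent_bound {r : 𝔸} {M : ℝ}
    (hu : ∀ w : ℂ, ‖w‖ < 1 → IsUnit (1 - w • r))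
    (hM : ∀ w : ℂ, ‖w‖ < 1 → ‖1 - w‖ * ‖r * Ring.inverse (1 - w • r)‖ ≤ M) (n : ℕ) :
    ‖r ^ n‖ ≤ ‖(1 : 𝔸)‖ + M + 6 * M ^ 2 := by
  have hM0 : 0 ≤ M := (norm_nonneg _).trans (by simpa using hM 0 (by simp))
  rcases n with _ | _ | n
  · have : 0 ≤ M + 6 * M ^ 2 := by positivity
    simp; linarith
  · have h := hM 0 (by simp)
    simp at h
    have : 0 ≤ ‖(1 : 𝔸)‖ + 6 * M ^ 2 := by positivity
    simp; linarith
  -- With `ρ = 1 - 1 / (n + 2)`, both `ρ⁻ⁿ ≤ e ≤ 3` and `(1 - ρ²)⁻¹ ≤ n + 2` hold; the constant 6 is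
  -- 3 times the bound 2 for `(n + 2) / (n + 1)`.
  set ρ : ℝ := (n + 1) / (n + 2) with hρ
  have hn : (0 : ℝ) ≤ n := n.cast_nonneg
  have h0 : 0 < ρ := by positivity
  have h1 : ρ < 1 := by rw [hρ, div_lt_one (by positivity)]; linarith
  set F : ℂ → 𝔸 := fun w => r * (Ring.inverse (1 - w • r) * r * Ring.inverse (1 - w • r)) with hF
  have hdiff : DifferentiableOn ℂ F (Metric.closedBall 0 ρ) := by
    intro w hw
    have hw' : ‖w‖ < 1 := (by simpa using hw : ‖w‖ ≤ ρ).trans_lt h1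
    have := (hasDerivAt_inverse_one_sub_smul (hu w hw')).differentiableAt
    exact (((this.mul_const r).mul this).const_mul r).differentiableWithinAt
  have hC := hdiff.circleIntegral_one_div_sub_center_pow_smul h0 n
  rw [iteratedDeriv_sq_resolvent] at hC
  have hFb : ∀ w : ℂ, ‖w‖ < 1 → ‖F w‖ ≤ M ^ 2 * (‖1 - w‖ ^ 2)⁻¹ := by
    intro w hw
    have e : F w = (r * Ring.inverse (1 - w • r)) * (r * Ring.inverse (1 - w • r)) := by
      simp only [hF, mul_assoc]
    have hne : 0 < ‖1 - w‖ := by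
      rw [norm_pos_iff, sub_ne_zero]
      rintro rfl
      simp at hw
    have hb : ‖r * Ring.inverse (1 - w • r)‖ ≤ M * ‖1 - w‖⁻¹ := by
      rw [← div_eq_mul_inv, le_div_iff₀ hne, mul_comm]
      exact hM w hw
    rw [e]
    calc _ ≤ _ := norm_mul_le _ _
      _ ≤ (M * ‖1 - w‖⁻¹) * (M * ‖1 - w‖⁻¹) := by gcongr
      _ = _ := by rw [← inv_pow]; ring
  have hintg : ‖∮ z in C(0, ρ), (1 / (z - 0) ^ (n + 1)) • F z‖ ≤
      2 * Real.pi * ((ρ ^ n)⁻¹ * (M ^ 2 * (1 - ρ ^ 2)⁻¹)) := by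
    rw [← circleAverage_inv_norm_one_sub_sq h0 h1, Real.circleAverage_def, circleIntegral]
    have hi : IntervalIntegrable (fun θ => (‖1 - circleMap 0 ρ θ‖ ^ 2)⁻¹) MeasureTheory.volume 0
        (2 * Real.pi) := by
      refine Continuous.intervalIntegrable ?_ _ _
      refine Continuous.inv₀ (by fun_prop) fun θ h => ?_
      have h' : 1 = circleMap 0 ρ θ := by simpa [sub_eq_zero] using h
      have h'' := congrArg norm h'
      rw [norm_circleMap_zero, norm_one, abs_of_pos h0] at h''
      linarith
    have hb := intervalIntegral.norm_integral_le_of_norm_le (μ := MeasureTheory.volume)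
      (f := fun θ => deriv (circleMap 0 ρ) θ •
        (1 / (circleMap 0 ρ θ - 0) ^ (n + 1)) • F (circleMap 0 ρ θ)) (a := 0) (b := 2 * Real.pi)
      Real.two_pi_pos.le (Filter.Eventually.of_forall fun θ _ => ?_)
      (hi.const_mul ((ρ ^ n)⁻¹ * M ^ 2))
    · refine hb.trans (le_of_eq ?_)
      rw [intervalIntegral.integral_const_mul, smul_eq_mul]
      field_simp
    · have hw : ‖circleMap 0 ρ θ‖ = ρ := by rw [norm_circleMap_zero, abs_of_pos h0]
      have hFw := hFb _ (hw.trans_lt h1)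
      rw [norm_smul, norm_smul, deriv_circleMap, norm_mul, Complex.norm_I, sub_zero, norm_div,
        norm_pow, hw, norm_one, mul_one, ← mul_assoc, mul_assoc _ (M ^ 2)]
      refine mul_le_mul (le_of_eq ?_) hFw (norm_nonneg _) (by positivity)
      rw [pow_succ]
      field_simp
  rw [hC, smul_smul, norm_smul, norm_mul, norm_div] at hintg
  have hfac : ((n + 1).factorial : ℝ) = (n + 1) * n.factorial := by
    rw [Nat.factorial_succ]; push_cast; ring
  have e1 : ‖(2 * Real.pi * Complex.I : ℂ)‖ = 2 * Real.pi := by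
    simp [abs_of_pos Real.pi_pos]
  rw [e1, Complex.norm_natCast, Complex.norm_natCast, hfac] at hintg
  have hnf : (0 : ℝ) < n.factorial := by positivity
  have e2 : 2 * Real.pi / n.factorial * ((n + 1) * n.factorial) * ‖r ^ (n + 2)‖ =
      2 * Real.pi * ((n + 1) * ‖r ^ (n + 2)‖) := by field_simp
  rw [e2] at hintg
  have h3 := le_of_mul_le_mul_left hintg Real.two_pi_pos
  have h4 : (ρ ^ n)⁻¹ ≤ 3 := by
    have : ρ⁻¹ = 1 + 1 / (n + 1) := by rw [hρ]; field_simp; ring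
    rw [← inv_pow, this]
    calc (1 + 1 / ((n : ℝ) + 1)) ^ n ≤ (Real.exp (1 / (n + 1))) ^ n := by
          gcongr
          linarith [Real.add_one_le_exp (1 / ((n : ℝ) + 1))]
      _ = Real.exp (n * (1 / (n + 1))) := by rw [← Real.exp_nat_mul]
      _ ≤ Real.exp 1 := by
          refine Real.exp_le_exp.2 ?_
          rw [mul_one_div, div_le_one (by positivity)]
          linarith
      _ ≤ 3 := Real.exp_one_lt_d9.le.trans (by norm_num)
  have h5 : (1 - ρ ^ 2)⁻¹ ≤ (n : ℝ) + 2 := by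
    rw [inv_le_comm₀ (by nlinarith) (by positivity)]
    have : 1 - ρ = ((n : ℝ) + 2)⁻¹ := by rw [hρ]; field_simp; ring
    nlinarith
  have h6 : (n + 1) * ‖r ^ (n + 2)‖ ≤ (n + 1) * (6 * M ^ 2) := by
    calc _ ≤ _ := h3
      _ ≤ 3 * (M ^ 2 * (n + 2)) := by
          have : 0 ≤ (1 - ρ ^ 2)⁻¹ := inv_nonneg.2 (by nlinarith)
          gcongr
      _ ≤ _ := by nlinarith [sq_nonneg M]
  have h7 := le_of_mul_le_mul_left h6 (by positivity)
  have : 0 ≤ ‖(1 : 𝔸)‖ := norm_nonneg _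
  linarith

end PowerBounded

/-! ### Exponentials of elements with a resolvent bound in the right half-plane -/

section HalfPlane

variable {𝔸 : Type*} [NormedRing 𝔸] [NormedAlgebra ℂ 𝔸]

/-- The resolvent of `a` exists in the open right half-plane and `‖z (z - a)⁻¹‖ ≤ M` there. -/
def HalfPlaneBound (a : 𝔸) (M : ℝ) : Prop :=
  ∀ z : ℂ, 0 < z.re → ∃ s : 𝔸, (z • 1 - a) * s = 1 ∧ s * (z • 1 - a) = 1 ∧ ‖z‖ * ‖s‖ ≤ M

variable [CompleteSpace 𝔸]

/-- `exp (t (r - 1)) = e^{-t} ∑ tⁿ rⁿ / n!` is an average of the powers of `r` with Poisson weights.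
-/
theorem norm_exp_smul_le_of_norm_pow_le {r : 𝔸} {C : ℝ} (h : ∀ n, ‖r ^ n‖ ≤ C) {t : ℝ}
    (ht : 0 ≤ t) : ‖NormedSpace.exp ((t : ℂ) • (r - 1))‖ ≤ C := by
  let _ : NormedAlgebra ℚ 𝔸 := NormedAlgebra.restrictScalars ℚ ℂ 𝔸
  have h1 : (t : ℂ) • (r - 1) = (t : ℂ) • r + algebraMap ℂ 𝔸 (-t) := by
    rw [smul_sub, Algebra.algebraMap_eq_smul_one, neg_smul, sub_eq_add_neg]
  have h2 : ‖NormedSpace.exp ((t : ℂ) • r)‖ ≤ Real.exp t * C := by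
    have hs := NormedSpace.exp_series_hasSum_exp' (𝕂 := ℂ) ((t : ℂ) • r)
    have hs' : HasSum (fun n : ℕ => t ^ n / n.factorial * C) (Real.exp t * C) := by
      have := NormedSpace.expSeries_div_hasSum_exp (t : ℝ)
      rw [← Real.exp_eq_exp_ℝ] at this
      exact this.mul_right C
    rw [← hs.tsum_eq]
    refine tsum_of_norm_bounded hs' fun n => ?_
    rw [smul_pow, smul_smul, norm_smul]
    refine mul_le_mul (le_of_eq ?_) (h n) (norm_nonneg _) (by positivity)
    rw [norm_mul, norm_inv, norm_pow, Complex.norm_natCast, Complex.norm_real,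
      Real.norm_of_nonneg ht, div_eq_inv_mul]
  rw [h1, NormedSpace.exp_add_of_commute (Algebra.commutes _ _).symm,
    ← NormedSpace.algebraMap_exp_comm, ← Algebra.commutes, ← Algebra.smul_def, norm_smul,
    ← Complex.exp_eq_exp_ℂ, Complex.norm_exp]
  calc _ ≤ Real.exp (-t) * (Real.exp t * C) := by
        gcongr
        simp
    _ = C := by rw [← mul_assoc, ← Real.exp_add]; simp

/-- For `m > 0` and `s = (m - a)⁻¹`, the element `r = m s` satisfies Ritt's condition with constant
`M`: `1 - w r = (m (1 - w) - a) s`, and `m (1 - w)` stays in the right half-plane for `|w| < 1`.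
Hence `exp (t m (r - 1))` is bounded independently of `m`. Since `m (r - 1) = a (m s)` and `m s →
1`, this converges to `exp (t a)`. The bound involves `M` but not `‖a‖`, as the Yosida
approximations require. -/
theorem HalfPlaneBound.norm_exp_le {a : 𝔸} {M : ℝ} (h : HalfPlaneBound a M) {t : ℝ} (ht : 0 ≤ t) :
    ‖NormedSpace.exp ((t : ℂ) • a)‖ ≤ ‖(1 : 𝔸)‖ + M + 6 * M ^ 2 := by
  let _ : NormedAlgebra ℚ 𝔸 := NormedAlgebra.restrictScalars ℚ ℂ 𝔸
  have hm : ∀ n : ℕ, 0 < (((n : ℝ) + 1 : ℝ) : ℂ).re := fun n => by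
    rw [Complex.ofReal_re]; positivity
  choose s hs1 hs2 hs3 using fun n => h _ (hm n)
  set m : ℕ → ℝ := fun n => (n : ℝ) + 1 with hmdef
  have hmpos : ∀ n, 0 < m n := fun n => by simp only [hmdef]; positivity
  have hpow : ∀ n k, ‖((m n : ℂ) • s n) ^ k‖ ≤ ‖(1 : 𝔸)‖ + M + 6 * M ^ 2 := by
    intro n k
    have key : ∀ w : ℂ, ‖w‖ < 1 → IsUnit (1 - w • ((m n : ℂ) • s n)) ∧
        ‖1 - w‖ * ‖((m n : ℂ) • s n) * Ring.inverse (1 - w • ((m n : ℂ) • s n))‖ ≤ M := by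
      intro w hw
      have hre : 0 < ((m n : ℂ) * (1 - w)).re := by
        rw [Complex.re_ofReal_mul, Complex.sub_re, Complex.one_re]
        have := (Complex.re_le_norm w).trans_lt hw
        exact mul_pos (hmpos n) (by linarith)
      obtain ⟨s', h1, h2, h3⟩ := h _ hre
      have e1 : 1 - w • ((m n : ℂ) • s n) = (((m n : ℂ) * (1 - w)) • 1 - a) * s n := by
        have : (((m n : ℂ) * (1 - w)) • 1 - a : 𝔸) =
            ((m n : ℂ) • 1 - a) - (w * m n) • (1 : 𝔸) := by
          rw [mul_sub, mul_one, sub_smul, mul_comm w]; abel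
        rw [this, sub_mul, hs1, smul_mul_assoc, one_mul, smul_smul]
      let U : 𝔸ˣ := ⟨(((m n : ℂ) * (1 - w)) • 1 - a) * s n, ((m n : ℂ) • 1 - a) * s',
        by rw [mul_assoc, ← mul_assoc (s n), hs2, one_mul, h1],
        by rw [mul_assoc, ← mul_assoc s', h2, one_mul, hs1]⟩
      refine ⟨e1 ▸ U.isUnit, ?_⟩
      have e2 : Ring.inverse (1 - w • ((m n : ℂ) • s n)) = ((m n : ℂ) • 1 - a) * s' := by
        rw [e1]; exact Ring.inverse_unit U
      rw [e2, smul_mul_assoc, ← mul_assoc, hs2, one_mul, norm_smul]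
      calc _ = ‖(m n : ℂ) * (1 - w)‖ * ‖s'‖ := by rw [norm_mul]; ring
        _ ≤ M := h3
    exact norm_pow_le_of_resolvent_bound (fun w hw => (key w hw).1) (fun w hw => (key w hw).2) k
  have hid : ∀ n, (m n : ℂ) • s n - 1 = a * s n := fun n => by
    have := hs1 n
    rw [sub_mul, smul_mul_assoc, one_mul, sub_eq_iff_eq_add] at this
    rw [this]; abel
  have hlim : Filter.Tendsto (fun n => (m n : ℂ) • s n) Filter.atTop (𝓝 1) := by
    rw [tendsto_iff_norm_sub_tendsto_zero]
    have hb : Filter.Tendsto (fun n : ℕ => ‖a‖ * M * (1 / ((n : ℝ) + 1))) Filter.atTop (𝓝 0) := by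
      simpa using tendsto_one_div_add_atTop_nhds_zero_nat.const_mul (‖a‖ * M)
    refine squeeze_zero (fun _ => norm_nonneg _) (fun n => ?_) hb
    rw [hid]
    have h3 := hs3 n
    rw [Complex.norm_real, Real.norm_of_nonneg (hmpos n).le] at h3
    calc _ ≤ ‖a‖ * ‖s n‖ := norm_mul_le _ _
      _ ≤ ‖a‖ * (M / m n) := by
          gcongr
          rw [le_div_iff₀ (hmpos n), mul_comm]
          exact h3
      _ = _ := by simp only [hmdef]; ring
  have hlim2 : Filter.Tendsto (fun n => NormedSpace.exp (((t * m n : ℝ) : ℂ) •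
      ((m n : ℂ) • s n - 1))) Filter.atTop (𝓝 (NormedSpace.exp ((t : ℂ) • a))) := by
    have e : ∀ n, ((t * m n : ℝ) : ℂ) • ((m n : ℂ) • s n - 1) =
        (t : ℂ) • (a * ((m n : ℂ) • s n)) := fun n => by
      rw [hid, mul_smul_comm, smul_smul]; push_cast; rfl
    simp only [e]
    refine (NormedSpace.exp_continuous.tendsto _).comp ?_
    simpa using (hlim.const_mul a).const_smul (t : ℂ)
  refine le_of_tendsto hlim2.norm (Filter.Eventually.of_forall fun n => ?_)
  exact norm_exp_smul_le_of_norm_pow_le (hpow n) (mul_nonneg ht (hmpos n).le)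

/-- A resolvent bound in the half-plane survives a small rotation. -/
theorem HalfPlaneBound.rotate {a : 𝔸} {M : ℝ} (h : HalfPlaneBound a M) {c : ℂ}
    (hc : ‖c - 1‖ * (‖(1 : 𝔸)‖ + M) ≤ 1 / 2) :
    HalfPlaneBound (c • a) (2 * ‖(1 : 𝔸)‖ * M) := by
  intro z hz
  obtain ⟨s, h1, h2, h3⟩ := h z hz
  have has : a * s = z • s - 1 := by
    rw [sub_mul, smul_mul_assoc, one_mul] at h1
    rw [← h1]; abel
  -- The resolvent of `c a` comes from the factorization `z - c a = (1 - y) (z - a)`; the identity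
  -- `a s = z s - 1` bounds `‖a s‖` by `‖1‖ + M`.
  set y : 𝔸 := (c - 1) • (a * s) with hy
  have hyn : ‖y‖ ≤ 1 / 2 := by
    refine le_trans ?_ hc
    rw [hy, norm_smul, has]
    gcongr
    refine (norm_sub_le _ _).trans ?_
    rw [norm_smul]; linarith
  let u : 𝔸ˣ := Units.oneSub y (hyn.trans_lt (by norm_num))
  have hu : (u : 𝔸) = 1 - y := rfl
  have hfac : z • 1 - c • a = u * (z • 1 - a) := by
    rw [hu, sub_mul, one_mul, hy, smul_mul_assoc, mul_assoc, h2, mul_one, sub_smul, one_smul]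
    abel
  -- The norm of 1 is kept because it need not be 1: it vanishes in the operators on a trivial
  -- space.
  have hun : ‖(↑u⁻¹ : 𝔸)‖ ≤ 2 * ‖(1 : 𝔸)‖ := by
    have e : (↑u⁻¹ : 𝔸) = 1 + y * ↑u⁻¹ := by
      have := u.mul_inv
      rw [hu, sub_mul, one_mul, sub_eq_iff_eq_add] at this
      exact this
    have h4 : ‖(↑u⁻¹ : 𝔸)‖ ≤ ‖(1 : 𝔸)‖ + 1 / 2 * ‖(↑u⁻¹ : 𝔸)‖ := by
      nth_rw 1 [e]
      refine (norm_add_le _ _).trans ?_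
      gcongr
      exact (norm_mul_le _ _).trans (by gcongr)
    linarith
  refine ⟨s * ↑u⁻¹, ?_, ?_, ?_⟩
  · rw [hfac, mul_assoc, ← mul_assoc _ s, h1, one_mul, u.mul_inv]
  · rw [hfac, mul_assoc, ← mul_assoc (↑u⁻¹ : 𝔸), u.inv_mul, one_mul, h2]
  · calc ‖z‖ * ‖s * ↑u⁻¹‖ ≤ ‖z‖ * (‖s‖ * (2 * ‖(1 : 𝔸)‖)) := by
          gcongr
          exact (norm_mul_le _ _).trans (by gcongr)
      _ = 2 * ‖(1 : 𝔸)‖ * (‖z‖ * ‖s‖) := by ring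
      _ ≤ _ := by gcongr

end HalfPlane

/-! ### Limits of uniformly bounded exponentials -/

section Limit

variable {X : Type*} [NormedAddCommGroup X] [NormedSpace ℂ X]

theorem isOpen_sector {θ : ℝ} (hθ : θ < Real.pi) : IsOpen (sector (-θ) θ) := by
  rw [isOpen_iff_mem_nhds]
  rintro z ⟨h0, h1, h2⟩
  have hs : z ∈ Complex.slitPlane := by
    rw [Complex.mem_slitPlane_iff_arg]
    exact ⟨(h2.trans hθ).ne, h0⟩
  filter_upwards [(Complex.continuousAt_arg hs).eventually (Ioo_mem_nhds h1 h2),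
    isOpen_ne.mem_nhds h0] with w hw hw0 using ⟨hw0, hw⟩

theorem real_smul_mem_sector {φ₁ φ₂ : ℝ} {z : ℂ} (hz : z ∈ sector φ₁ φ₂) {s : ℝ} (hs : 0 < s) :
    (s : ℂ) * z ∈ sector φ₁ φ₂ := by
  obtain ⟨h0, h1, h2⟩ := hz
  refine ⟨mul_ne_zero (by exact_mod_cast hs.ne') h0, ?_, ?_⟩ <;> rwa [Complex.arg_real_mul z hs]

theorem ofReal_mem_sector {θ : ℝ} (hθ : 0 < θ) {s : ℝ} (hs : 0 < s) :
    (s : ℂ) ∈ sector (-θ) θ := by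
  refine ⟨by exact_mod_cast hs.ne', ?_, ?_⟩ <;> rw [Complex.arg_ofReal_of_nonneg hs.le] <;> linarith

/-- The bounded operators `a n` commute, their exponentials are bounded by `C` in the sector, and
they converge strongly on the dense set `D`. -/
structure SectorialApprox (a : ℕ → X →L[ℂ] X) (θ C : ℝ) (D : Set X) : Prop where
  pos : 0 < θ
  lt : θ < Real.pi
  commute : ∀ m n, Commute (a m) (a n)
  bound : ∀ n, ∀ z ∈ insert 0 (sector (-θ) θ), ‖NormedSpace.exp (z • a n)‖ ≤ C
  dense : Dense D
  tendsto : ∀ x ∈ D, ∃ y, Filter.Tendsto (fun n => a n x) Filter.atTop (𝓝 y)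

namespace SectorialApprox

variable {a : ℕ → X →L[ℂ] X} {θ C : ℝ} {D : Set X}

theorem nonneg (h : SectorialApprox a θ C D) : 0 ≤ C :=
  (norm_nonneg _).trans (h.bound 0 0 (Set.mem_insert _ _))

theorem bound_segment (h : SectorialApprox a θ C D) (n : ℕ) {z : ℂ}
    (hz : z ∈ insert 0 (sector (-θ) θ)) {s : ℝ} (hs : 0 ≤ s) :
    ‖NormedSpace.exp (((s : ℂ) * z) • a n)‖ ≤ C := by
  refine h.bound n _ ?_
  rcases hs.eq_or_lt with rfl | hs
  · simp
  · rcases hz with rfl | hz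
    · simp
    · exact Or.inr (real_smul_mem_sector hz hs)

/-- The strong limit of the exponentials, extended by zero where it does not exist. -/
noncomputable def limit (a : ℕ → X →L[ℂ] X) (z : ℂ) : X →L[ℂ] X :=
  open Classical in
  if h : ∃ L : X →L[ℂ] X, ∀ x, Filter.Tendsto (fun n => NormedSpace.exp (z • a n) x) Filter.atTop
    (𝓝 (L x)) then h.choose else 0

theorem limit_eq {z : ℂ} {L : X →L[ℂ] X}
    (h : ∀ x, Filter.Tendsto (fun n => NormedSpace.exp (z • a n) x) Filter.atTop (𝓝 (L x))) :
    limit a z = L := by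
  have hex : ∃ L : X →L[ℂ] X, ∀ x,
      Filter.Tendsto (fun n => NormedSpace.exp (z • a n) x) Filter.atTop (𝓝 (L x)) := ⟨L, h⟩
  rw [limit, dif_pos hex]
  ext x
  exact tendsto_nhds_unique (hex.choose_spec x) (h x)

theorem limit_zero (a : ℕ → X →L[ℂ] X) : limit a 0 = 1 := by
  refine limit_eq fun x => ?_
  simp

end SectorialApprox

variable [CompleteSpace X]

/-- A strongly holomorphic, locally bounded family of operators is holomorphic in norm. -/
theorem differentiableOn_clm_of_apply {T : ℂ → X →L[ℂ] X} {U : Set ℂ} (hU : IsOpen U) {C : ℝ}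
    (hC : ∀ z ∈ U, ‖T z‖ ≤ C) (h : ∀ x, DifferentiableOn ℂ (fun z => T z x) U) :
    DifferentiableOn ℂ T U := by
  intro z₀ hz₀
  have hC0 : 0 ≤ C := (norm_nonneg _).trans (hC z₀ hz₀)
  -- Room for two Cauchy estimates on circles of radius `r`: second derivatives on the ball of
  -- radius `r`, first derivatives on that of radius `2 r`, values inside that of radius `4 r`.
  obtain ⟨r, hr, hball⟩ : ∃ r > 0, Metric.ball z₀ (4 * r) ⊆ U := by
    obtain ⟨ε, hε, hb⟩ := Metric.isOpen_iff.1 hU z₀ hz₀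
    exact ⟨ε / 4, by positivity, by convert hb using 2; ring⟩
  have hd1 : ∀ x, ∀ w ∈ Metric.ball z₀ (2 * r), ‖deriv (fun z => T z x) w‖ ≤ C * ‖x‖ / r := by
    intro x w hw
    refine Complex.norm_deriv_le_of_forall_mem_sphere_norm_le hr ?_ ?_
    · refine ((h x).mono ?_).diffContOnCl
      rw [closure_ball _ hr.ne']
      intro y hy
      refine hball ?_
      rw [Metric.mem_ball] at hw ⊢
      have := Metric.mem_closedBall.1 hy
      linarith [dist_triangle y w z₀]
    · intro y hy
      have hyU : y ∈ U := hball (by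
        rw [Metric.mem_ball] at hw ⊢
        have := (Metric.mem_sphere.1 hy).le
        linarith [dist_triangle y w z₀])
      exact (T y).le_of_opNorm_le (hC y hyU) x
  have hsub : Metric.ball z₀ (2 * r) ⊆ U :=
    (Metric.ball_subset_ball (by linarith)).trans hball
  have hder : ∀ x, ∀ w ∈ U, HasDerivAt (fun z => T z x) (deriv (fun z => T z x) w) w :=
    fun x w hw => ((h x).differentiableAt (hU.mem_nhds hw)).hasDerivAt
  have hd2 : ∀ x, ∀ w ∈ Metric.ball z₀ r,
      ‖deriv (deriv (fun z => T z x)) w‖ ≤ C * ‖x‖ / r / r := by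
    intro x w hw
    have hin : ∀ y ∈ Metric.closedBall w r, y ∈ Metric.ball z₀ (2 * r) := by
      intro y hy
      rw [Metric.mem_ball] at hw ⊢
      have := Metric.mem_closedBall.1 hy
      linarith [dist_triangle y w z₀]
    refine Complex.norm_deriv_le_of_forall_mem_sphere_norm_le hr ?_ ?_
    · refine (((h x).deriv hU).mono ?_).diffContOnCl
      rw [closure_ball _ hr.ne']
      exact fun y hy => hsub (hin y hy)
    · exact fun y hy => hd1 x y (hin y (Metric.sphere_subset_closedBall hy))
  let D : X →L[ℂ] X := LinearMap.mkContinuous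
    { toFun := fun x => deriv (fun z => T z x) z₀
      map_add' := fun x y => by
        have := ((hder x z₀ hz₀).add (hder y z₀ hz₀)).deriv
        rw [← this]
        congr 1
        ext z
        simp
      map_smul' := fun c x => by
        have := ((hder x z₀ hz₀).const_smul c).deriv
        rw [RingHom.id_apply, ← this]
        congr 1
        ext z
        simp } (C / r) (fun x => by
          rw [div_mul_eq_mul_div]
          exact hd1 x z₀ (Metric.mem_ball_self (by positivity)))
  have hD : ∀ x, D x = deriv (fun z => T z x) z₀ := fun x => rfl
  -- The second-derivative bound is linear in `‖x‖`, so the quadratic Taylor remainder is uniform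
  -- over the unit ball of `X`. This turns strong differentiability into differentiability in norm.
  have key : ∀ w ∈ Metric.ball z₀ r, ‖T w - T z₀ - (w - z₀) • D‖ ≤ C / r / r * ‖w - z₀‖ ^ 2 := by
    intro w hw
    refine ContinuousLinearMap.opNorm_le_bound _ (by positivity) fun x => ?_
    have hseg : ∀ y ∈ Metric.ball z₀ r, ‖deriv (fun z => T z x) y - D x‖ ≤
        C * ‖x‖ / r / r * ‖y - z₀‖ := by
      intro y hy
      rw [hD]
      refine (convex_ball z₀ r).norm_image_sub_le_of_norm_deriv_le (f := deriv fun z => T z x)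
        (fun v hv => ?_) (fun v hv => hd2 x v hv) (Metric.mem_ball_self hr) hy
      exact ((h x).deriv hU).differentiableAt
        (hU.mem_nhds (hsub (Metric.ball_subset_ball (by linarith) hv)))
    have hmv := (convex_closedBall z₀ ‖w - z₀‖).norm_image_sub_le_of_norm_hasDerivWithin_le
      (f := fun z => T z x - (z - z₀) • D x) (f' := fun z => deriv (fun z => T z x) z - D x)
      (C := C * ‖x‖ / r / r * ‖w - z₀‖) (x := z₀) (y := w) (fun y hy => ?_) (fun y hy => ?_)
      (Metric.mem_closedBall_self (norm_nonneg _)) (by simp [dist_eq_norm])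
    · simp only [sub_self, zero_smul, sub_zero] at hmv
      calc _ = ‖T w x - (w - z₀) • D x - T z₀ x‖ := by
            simp only [sub_apply, smul_apply]
            congr 1; abel
        _ ≤ _ := hmv
        _ = _ := by ring
    · have hyb : y ∈ Metric.ball z₀ r := by
        rw [Metric.mem_ball]
        exact (Metric.mem_closedBall.1 hy).trans_lt (by simpa [dist_eq_norm] using hw)
      have h1 := hder x y (hsub (Metric.ball_subset_ball (by linarith) hyb))
      have h2 : HasDerivAt (fun z : ℂ => (z - z₀) • D x) (D x) y := by
        simpa using ((hasDerivAt_id y).sub_const z₀).smul_const (D x)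
      exact (h1.sub h2).hasDerivWithinAt
    · have hyn : ‖y - z₀‖ ≤ ‖w - z₀‖ := by simpa [dist_eq_norm] using hy
      have hyb : y ∈ Metric.ball z₀ r := by
        rw [Metric.mem_ball]
        exact (Metric.mem_closedBall.1 hy).trans_lt (by simpa [dist_eq_norm] using hw)
      exact (hseg y hyb).trans (by gcongr)
  have hasD : HasDerivAt T D z₀ := by
    rw [hasDerivAt_iff_isLittleO]
    refine Asymptotics.IsBigO.trans_isLittleO (g := fun w => ‖w - z₀‖ ^ 2) ?_ ?_
    · refine Asymptotics.IsBigO.of_bound (C / r / r) ?_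
      filter_upwards [Metric.ball_mem_nhds z₀ hr] with w hw
      simpa using key w hw
    · have := Asymptotics.isLittleO_norm_pow_id (E' := ℂ) (n := 2) one_lt_two
      exact this.comp_tendsto (k := fun w => w - z₀) (by
        have : Filter.Tendsto (fun w => w - z₀) (𝓝 z₀) (𝓝 (z₀ - z₀)) :=
          (continuous_sub_right z₀).tendsto z₀
        simpa using this)
  exact hasD.differentiableAt.differentiableWithinAt

/-- Two commuting bounded semigroups differ by at most the difference of their generators. -/
theorem norm_exp_sub_exp_le {a b : X →L[ℂ] X} (hab : Commute a b) {z : ℂ} {C : ℝ}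
    (ha : ∀ s ∈ Set.Icc (0 : ℝ) 1, ‖NormedSpace.exp (((s : ℂ) * z) • a)‖ ≤ C)
    (hb : ∀ s ∈ Set.Icc (0 : ℝ) 1, ‖NormedSpace.exp (((s : ℂ) * z) • b)‖ ≤ C) (x : X) :
    ‖NormedSpace.exp (z • a) x - NormedSpace.exp (z • b) x‖ ≤ ‖z‖ * C ^ 2 * ‖a x - b x‖ := by
  let _ : NormedAlgebra ℚ (X →L[ℂ] X) := NormedAlgebra.restrictScalars ℚ ℂ (X →L[ℂ] X)
  have hC0 : 0 ≤ C := (norm_nonneg _).trans (ha 0 (by simp))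
  have hexp : ∀ (c : X →L[ℂ] X) (s : ℝ), HasDerivAt
      (fun s : ℝ => NormedSpace.exp (((s : ℂ) * z) • c))
      (z • (NormedSpace.exp (((s : ℂ) * z) • c) * c)) s := by
    intro c s
    have h1 := hasDerivAt_exp_smul_const (𝕂 := ℂ) c ((s : ℂ) * z)
    have h2 : HasDerivAt (fun s : ℝ => (s : ℂ) * z) z s := by
      simpa using (Complex.ofRealCLM.hasDerivAt (x := s)).mul_const z
    exact h1.scomp s h2
  -- The path `exp (s z a) exp ((1 - s) z b)` joins the two exponentials; by commutation its
  -- derivative contains only the difference `a - b`.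
  have hderiv : ∀ s : ℝ, HasDerivAt
      (fun s : ℝ => (NormedSpace.exp (((s : ℂ) * z) • a) *
        NormedSpace.exp ((((1 - s : ℝ) : ℂ) * z) • b)) x)
      ((NormedSpace.exp (((s : ℂ) * z) • a) * NormedSpace.exp ((((1 - s : ℝ) : ℂ) * z) • b))
        (z • (a x - b x))) s := by
    intro s
    have h1 := hexp a s
    have h2 := (hexp b (1 - s)).scomp s ((hasDerivAt_id s).const_sub 1)
    have h3 := ((ContinuousLinearMap.apply ℂ X x).restrictScalars ℝ).hasFDerivAt.comp_hasDerivAt s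
      (h1.mul h2)
    refine h3.congr_deriv ?_
    have hc : a * NormedSpace.exp ((((1 - s : ℝ) : ℂ) * z) • b) =
        NormedSpace.exp ((((1 - s : ℝ) : ℂ) * z) • b) * a :=
      ((hab.smul_right (((1 - s : ℝ) : ℂ) * z)).exp_right).eq
    have e : z • (NormedSpace.exp (((s : ℂ) * z) • a) * a) *
        NormedSpace.exp ((((1 - s : ℝ) : ℂ) * z) • b) +
        NormedSpace.exp (((s : ℂ) * z) • a) *
          ((-1 : ℝ) • z • (NormedSpace.exp ((((1 - s : ℝ) : ℂ) * z) • b) * b)) =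
        NormedSpace.exp (((s : ℂ) * z) • a) * NormedSpace.exp ((((1 - s : ℝ) : ℂ) * z) • b) *
          (z • (a - b)) := by
      rw [smul_mul_assoc, mul_assoc, hc, neg_one_smul, mul_neg, mul_smul_comm, mul_smul_comm,
        ← sub_eq_add_neg, ← smul_sub, mul_assoc, mul_sub, mul_sub]
    exact congrArg (fun L : X →L[ℂ] X => L x) e
  have h := norm_image_sub_le_of_norm_deriv_le_segment_01'
    (C := C * C * (‖z‖ * ‖a x - b x‖)) (fun s _ => (hderiv s).hasDerivWithinAt) (fun s hs => ?_)
  · simp only [Complex.ofReal_one, one_mul, sub_self, Complex.ofReal_zero, zero_mul, zero_smul,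
      NormedSpace.exp_zero, mul_one, sub_zero] at h
    calc _ ≤ _ := h
      _ = _ := by ring
  · refine (ContinuousLinearMap.le_of_opNorm_le _ (c := C * C) ?_ _).trans_eq ?_
    · refine (norm_mul_le _ _).trans ?_
      gcongr
      · exact ha s ⟨hs.1, hs.2.le⟩
      · exact hb _ ⟨by linarith [hs.2], by linarith [hs.1]⟩
    · rw [norm_smul]

namespace SectorialApprox

variable {a : ℕ → X →L[ℂ] X} {θ C : ℝ} {D : Set X}

/-- On vectors of `D`, `norm_exp_sub_exp_le` turns convergence of `a n x'` into uniform closeness of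
the exponentials for bounded `z`. The uniform bound `C` extends this to the closure of `D`, which is
the whole space. -/
theorem uniformCauchySeqOn (h : SectorialApprox a θ C D) (x : X) (ρ : ℝ) :
    UniformCauchySeqOn (fun n z => NormedSpace.exp (z • a n) x) Filter.atTop
      (insert 0 (sector (-θ) θ) ∩ Metric.closedBall 0 ρ) := by
  have hC := h.nonneg
  rw [Metric.uniformCauchySeqOn_iff]
  intro ε hε
  obtain ⟨x', hx', hxx'⟩ := h.dense.exists_dist_lt x (ε := ε / (4 * (C + 1))) (by positivity)
  obtain ⟨y, hy⟩ := h.tendsto x' hx'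
  obtain ⟨N, hN⟩ := Metric.cauchySeq_iff.1 hy.cauchySeq (ε / (2 * ((|ρ| + 1) * (C + 1) ^ 2)))
    (by positivity)
  refine ⟨N, fun m hm n hn z hz => ?_⟩
  have hzn : ‖z‖ ≤ |ρ| + 1 := by
    have : ‖z‖ ≤ ρ := by simpa using hz.2
    linarith [le_abs_self ρ]
  have h1 : ‖NormedSpace.exp (z • a m) x' - NormedSpace.exp (z • a n) x'‖ < ε / 2 := by
    calc _ ≤ ‖z‖ * C ^ 2 * ‖a m x' - a n x'‖ :=
          norm_exp_sub_exp_le (h.commute m n) (fun s hs => h.bound_segment m hz.1 hs.1)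
            (fun s hs => h.bound_segment n hz.1 hs.1) x'
      _ ≤ (|ρ| + 1) * (C + 1) ^ 2 * ‖a m x' - a n x'‖ := by gcongr; linarith
      _ < (|ρ| + 1) * (C + 1) ^ 2 * (ε / (2 * ((|ρ| + 1) * (C + 1) ^ 2))) := by
          have := hN m hm n hn
          rw [dist_eq_norm] at this
          gcongr
      _ = ε / 2 := by field_simp
  have h2 : ∀ k, ‖NormedSpace.exp (z • a k) (x - x')‖ ≤ ε / 4 := by
    intro k
    calc _ ≤ C * ‖x - x'‖ := ContinuousLinearMap.le_of_opNorm_le _ (h.bound k z hz.1) _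
      _ ≤ (C + 1) * (ε / (4 * (C + 1))) := by
          rw [dist_eq_norm] at hxx'
          gcongr
          linarith
      _ = ε / 4 := by field_simp
  rw [dist_eq_norm]
  have e : NormedSpace.exp (z • a m) x - NormedSpace.exp (z • a n) x =
      (NormedSpace.exp (z • a m) x' - NormedSpace.exp (z • a n) x') +
      (NormedSpace.exp (z • a m) (x - x') - NormedSpace.exp (z • a n) (x - x')) := by
    simp only [map_sub]; abel
  rw [e]
  refine (norm_add_le _ _).trans_lt ?_
  have h3 := norm_sub_le (NormedSpace.exp (z • a m) (x - x')) (NormedSpace.exp (z • a n) (x - x'))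
  linarith [h2 m, h2 n]

theorem tendsto_limit (h : SectorialApprox a θ C D) {z : ℂ} (hz : z ∈ insert 0 (sector (-θ) θ))
    (x : X) :
    Filter.Tendsto (fun n => NormedSpace.exp (z • a n) x) Filter.atTop (𝓝 (limit a z x)) := by
  have hex : ∀ x, ∃ y, Filter.Tendsto (fun n => NormedSpace.exp (z • a n) x) Filter.atTop (𝓝 y) :=
    fun x => cauchySeq_tendsto_of_complete
      ((h.uniformCauchySeqOn x ‖z‖).cauchySeq ⟨hz, by simp⟩)
  choose L hL using hex
  let L' : X →L[ℂ] X := continuousLinearMapOfTendsto (fun n => NormedSpace.exp (z • a n))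
    (tendsto_pi_nhds.2 hL)
  have : limit a z = L' := limit_eq fun x => hL x
  rw [this]
  exact hL x

theorem norm_limit_le (h : SectorialApprox a θ C D) {z : ℂ} (hz : z ∈ insert 0 (sector (-θ) θ)) :
    ‖limit a z‖ ≤ C := by
  refine ContinuousLinearMap.opNorm_le_bound _ h.nonneg fun x => ?_
  refine le_of_tendsto (h.tendsto_limit hz x).norm (Filter.Eventually.of_forall fun n => ?_)
  exact ContinuousLinearMap.le_of_opNorm_le _ (h.bound n z hz) _

theorem differentiableOn_limit (h : SectorialApprox a θ C D) :
    DifferentiableOn ℂ (limit a) (sector (-θ) θ) := by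
  have hopen := isOpen_sector h.lt
  refine differentiableOn_clm_of_apply hopen
    (fun z hz => h.norm_limit_le (Set.mem_insert_of_mem _ hz)) fun x => ?_
  have hloc : TendstoLocallyUniformlyOn (fun n z => NormedSpace.exp (z • a n) x)
      (fun z => limit a z x) Filter.atTop (sector (-θ) θ) := by
    intro u hu z hz
    have hunif := (h.uniformCauchySeqOn x (‖z‖ + 1)).tendstoUniformlyOn_of_tendsto
      (fun w hw => h.tendsto_limit hw.1 x)
    refine ⟨sector (-θ) θ ∩ Metric.closedBall 0 (‖z‖ + 1), ?_, ?_⟩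
    · refine Filter.inter_mem self_mem_nhdsWithin (mem_nhdsWithin_of_mem_nhds ?_)
      exact Metric.closedBall_mem_nhds_of_mem (by simp)
    · filter_upwards [hunif u hu] with n hn w hw
      exact hn w ⟨Set.mem_insert_of_mem _ hw.1, hw.2⟩
  refine hloc.differentiableOn (Filter.Eventually.of_forall fun n => ?_) hopen
  have := differentiable_exp_smul_const ℂ (a n)
  exact (this.clm_apply (differentiable_const x)).differentiableOn

theorem limit_add (h : SectorialApprox a θ C D) {z w : ℂ} (hz : z ∈ sector (-θ) θ)
    (hw : w ∈ sector (-θ) θ) : limit a (z + w) = limit a z * limit a w := by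
  let _ : NormedAlgebra ℚ (X →L[ℂ] X) := NormedAlgebra.restrictScalars ℚ ℂ (X →L[ℂ] X)
  refine limit_eq fun x => ?_
  have e : ∀ n, NormedSpace.exp ((z + w) • a n) x =
      NormedSpace.exp (z • a n) (NormedSpace.exp (w • a n) x - limit a w x) +
        NormedSpace.exp (z • a n) (limit a w x) := by
    intro n
    rw [add_smul, NormedSpace.exp_add_of_commute
      (((Commute.refl (a n)).smul_left z).smul_right w), map_sub]
    simp
  simp only [e]
  rw [mul_apply_eq_comp, ← zero_add (limit a z (limit a w x))]
  refine Filter.Tendsto.add ?_ (h.tendsto_limit (Set.mem_insert_of_mem _ hz) _)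
  have h1 := tendsto_iff_norm_sub_tendsto_zero.1 (h.tendsto_limit (Set.mem_insert_of_mem _ hw) x)
  refine squeeze_zero_norm (fun n => ?_) (by simpa using h1.const_mul C)
  exact ContinuousLinearMap.le_of_opNorm_le _ (h.bound n z (Set.mem_insert_of_mem _ hz)) _

theorem tendsto_limit_zero (h : SectorialApprox a θ C D) (x : X) :
    Filter.Tendsto (fun z => limit a z x) (𝓝[sector (-θ) θ] 0) (𝓝 x) := by
  have hC := h.nonneg
  rw [Metric.tendsto_nhds]
  intro ε hε
  obtain ⟨x', hx', hxx'⟩ := h.dense.exists_dist_lt x (ε := ε / (2 * (C + 2))) (by positivity)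
  obtain ⟨y, hy⟩ := h.tendsto x' hx'
  have hlim : ∀ z ∈ sector (-θ) θ, ‖limit a z x' - x'‖ ≤ ‖z‖ * (C + 1) ^ 2 * ‖y‖ := by
    intro z hz
    have h1 := (h.tendsto_limit (Set.mem_insert_of_mem _ hz) x').sub_const x'
    refine le_of_tendsto_of_tendsto h1.norm (hy.norm.const_mul _)
      (Filter.Eventually.of_forall fun n => ?_)
    -- The comparison operator is 0, whose exponential is the identity; `C + 1` dominates both `C`
    -- and the norm of the identity.
    have := norm_exp_sub_exp_le (Commute.zero_right (a n)) (z := z) (C := C + 1)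
      (fun s hs => (h.bound_segment n (Set.mem_insert_of_mem _ hz) hs.1).trans (by linarith))
      (fun s hs => by
        rw [smul_zero, NormedSpace.exp_zero]
        exact ContinuousLinearMap.norm_id_le.trans (by linarith)) x'
    simpa using this
  have hz : ∀ᶠ z in 𝓝[sector (-θ) θ] (0 : ℂ), ‖z‖ * (C + 1) ^ 2 * ‖y‖ < ε / 2 := by
    have hc : Filter.Tendsto (fun z : ℂ => ‖z‖ * (C + 1) ^ 2 * ‖y‖) (𝓝 0) (𝓝 0) := by
      have : Continuous fun z : ℂ => ‖z‖ * (C + 1) ^ 2 * ‖y‖ := by fun_prop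
      simpa using this.tendsto 0
    exact (hc.mono_left nhdsWithin_le_nhds).eventually (gt_mem_nhds (by positivity))
  filter_upwards [hz, self_mem_nhdsWithin] with z hz hzS
  rw [dist_eq_norm] at hxx' ⊢
  have e : limit a z x - x = limit a z (x - x') + (limit a z x' - x') - (x - x') := by
    rw [map_sub]; abel
  have h1 : ‖limit a z (x - x')‖ ≤ C * ‖x - x'‖ :=
    ContinuousLinearMap.le_of_opNorm_le _ (h.norm_limit_le (Set.mem_insert_of_mem _ hzS)) _
  have h2 : (C + 2) * ‖x - x'‖ < ε / 2 := by
    calc _ < (C + 2) * (ε / (2 * (C + 2))) := by gcongr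
      _ = ε / 2 := by field_simp
  rw [e]
  calc _ ≤ ‖limit a z (x - x')‖ + ‖limit a z x' - x'‖ + ‖x - x'‖ :=
        (norm_sub_le _ _).trans (by gcongr; exact norm_add_le _ _)
    _ < ε := by linarith [hlim z hzS, norm_nonneg (x - x')]

/-- Integrating `d/ds exp (s a n) x = exp (s a n) (a n x)` and letting n tend to infinity gives
`T(t) x - x = ∫₀ᵗ T(s) y ds`. Strong continuity of `T` at 0 then yields the derivative. -/
theorem tendsto_limit_slope (h : SectorialApprox a θ C D) {x y : X}
    (hxy : Filter.Tendsto (fun n => a n x) Filter.atTop (𝓝 y)) :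
    Filter.Tendsto (fun t : ℝ => (t : ℂ)⁻¹ • (limit a t x - x)) (𝓝[>] 0) (𝓝 y) := by
  let _ : NormedAlgebra ℚ (X →L[ℂ] X) := NormedAlgebra.restrictScalars ℚ ℂ (X →L[ℂ] X)
  have hC := h.nonneg
  have hmem : ∀ s : ℝ, 0 ≤ s → (s : ℂ) ∈ insert 0 (sector (-θ) θ) := by
    intro s hs
    rcases hs.eq_or_lt with rfl | hs
    · simp
    · exact Or.inr (ofReal_mem_sector h.pos hs)
  have hderiv : ∀ (n : ℕ) (s : ℝ), HasDerivAt
      (fun s : ℝ => NormedSpace.exp ((s : ℂ) • a n) x - (s : ℂ) • y)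
      (NormedSpace.exp ((s : ℂ) • a n) (a n x) - y) s := by
    intro n s
    have h1 := (hasDerivAt_exp_smul_const (𝕂 := ℂ) (a n) (s : ℂ)).scomp s
      (Complex.ofRealCLM.hasDerivAt (x := s))
    have h2 := ((ContinuousLinearMap.apply ℂ X x).restrictScalars ℝ).hasFDerivAt.comp_hasDerivAt s
      h1
    have h3 : HasDerivAt (fun s : ℝ => (s : ℂ) • y) y s := by
      simpa using (Complex.ofRealCLM.hasDerivAt (x := s)).smul_const y
    refine (h2.sub h3).congr_deriv ?_
    simp
  have hcont : ∀ n, Continuous fun s : ℝ => NormedSpace.exp ((s : ℂ) • a n) (a n x) - y := by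
    intro n
    have : Continuous fun s : ℝ => NormedSpace.exp ((s : ℂ) • a n) :=
      NormedSpace.exp_continuous.comp (by fun_prop)
    fun_prop
  obtain ⟨K, hK⟩ : ∃ K, ∀ n, ‖a n x‖ ≤ K := by
    obtain ⟨K, hK⟩ := (Metric.isBounded_range_of_tendsto _ hxy).exists_norm_le
    exact ⟨K, fun n => hK _ ⟨n, rfl⟩⟩
  have hintg : ∀ t : ℝ, 0 ≤ t → limit a t x - (t : ℂ) • y - x = ∫ s in (0 : ℝ)..t,
      (limit a s y - y) := by
    intro t ht
    have h1 : ∀ n, NormedSpace.exp ((t : ℂ) • a n) x - (t : ℂ) • y - x =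
        ∫ s in (0 : ℝ)..t, (NormedSpace.exp ((s : ℂ) • a n) (a n x) - y) := by
      intro n
      rw [intervalIntegral.integral_eq_sub_of_hasDerivAt (fun s _ => hderiv n s)
        ((hcont n).intervalIntegrable _ _)]
      simp
    refine tendsto_nhds_unique (((h.tendsto_limit (hmem t ht) x).sub_const _).sub_const x) ?_
    simp only [h1]
    refine intervalIntegral.tendsto_integral_filter_of_dominated_convergence (fun _ => C * K + ‖y‖)
      (Filter.Eventually.of_forall fun n => (hcont n).aestronglyMeasurable)
      (Filter.Eventually.of_forall fun n => Filter.Eventually.of_forall fun s hs => ?_)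
      intervalIntegrable_const (Filter.Eventually.of_forall fun s hs => ?_)
    · rw [Set.uIoc_of_le ht] at hs
      refine (norm_sub_le _ _).trans ?_
      gcongr
      refine (ContinuousLinearMap.le_of_opNorm_le _ (h.bound n _ (hmem s hs.1.le)) _).trans ?_
      gcongr
      exact hK n
    · rw [Set.uIoc_of_le ht] at hs
      refine Filter.Tendsto.sub_const ?_ y
      have e : ∀ n, NormedSpace.exp ((s : ℂ) • a n) (a n x) =
          NormedSpace.exp ((s : ℂ) • a n) (a n x - y) + NormedSpace.exp ((s : ℂ) • a n) y := by
        intro n; rw [map_sub]; abel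
      simp only [e]
      rw [← zero_add (limit a s y)]
      refine Filter.Tendsto.add ?_ (h.tendsto_limit (hmem s hs.1.le) y)
      have h1 := tendsto_iff_norm_sub_tendsto_zero.1 hxy
      refine squeeze_zero_norm (fun n => ?_) (by simpa using h1.const_mul C)
      exact ContinuousLinearMap.le_of_opNorm_le _ (h.bound n _ (hmem s hs.1.le)) _
  rw [Metric.tendsto_nhdsWithin_nhds]
  intro ε hε
  obtain ⟨δ, hδ, hδ'⟩ := Metric.tendsto_nhdsWithin_nhds.1 (h.tendsto_limit_zero y) (ε / 2)
    (by positivity)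
  refine ⟨δ, hδ, fun {t} ht htd => ?_⟩
  have ht0 : (0 : ℝ) < t := ht
  have htδ : t < δ := by simpa [abs_of_pos ht0] using htd
  have hb : ‖limit a t x - (t : ℂ) • y - x‖ ≤ ε / 2 * t := by
    rw [hintg t ht0.le]
    have := intervalIntegral.norm_integral_le_of_norm_le_const (a := 0) (b := t)
      (f := fun s : ℝ => limit a s y - y) (C := ε / 2) (fun s hs => ?_)
    · simpa [abs_of_pos ht0] using this
    · rw [Set.uIoc_of_le ht0.le] at hs
      have := hδ' (ofReal_mem_sector h.pos hs.1)
        (by simpa [abs_of_pos hs.1] using hs.2.trans_lt htδ)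
      rw [dist_eq_norm] at this
      exact this.le
  rw [dist_eq_norm]
  have htc : (t : ℂ) ≠ 0 := by exact_mod_cast ht0.ne'
  have e : (t : ℂ)⁻¹ • (limit a t x - x) - y = (t : ℂ)⁻¹ • (limit a t x - (t : ℂ) • y - x) := by
    rw [sub_right_comm, smul_sub _ _ ((t : ℂ) • y), smul_smul, inv_mul_cancel₀ htc, one_smul]
  rw [e, norm_smul, norm_inv, Complex.norm_real, Real.norm_of_nonneg ht0.le]
  calc _ ≤ t⁻¹ * (ε / 2 * t) := by gcongr
    _ = ε / 2 := by field_simp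
    _ < ε := by linarith

theorem isAnalyticSemigroup_limit (h : SectorialApprox a θ C D) :
    IsAnalyticSemigroup (-θ) θ (limit a) where
  neg := by linarith [h.pos]
  pos := h.pos
  analytic := h.differentiableOn_limit
  zero := limit_zero a
  tendsto := h.tendsto_limit_zero
  add _ hz _ hw := h.limit_add hz hw

end SectorialApprox

end Limit

/-! ### Generation of bounded analytic semigroups -/

section Generation

variable {X : Type*} [NormedAddCommGroup X] [NormedSpace ℂ X]

/-- For `Re z > 0` the operator `z - A` is onto and `|z| ‖x‖ ≤ M ‖z x - A x‖`. -/
def ResolventBound (A : X →ₗ.[ℂ] X) (M : ℝ) : Prop :=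
  ∀ z : ℂ, 0 < z.re → (∀ x : A.domain, ‖z‖ * ‖(x : X)‖ ≤ M * ‖z • (x : X) - A x‖) ∧
    ∀ y, ∃ x : A.domain, z • (x : X) - A x = y

/-- `R z` is the inverse of `z - A` for `Re z > 0`, with `‖z R z‖ ≤ M`. -/
structure IsResolvent (A : X →ₗ.[ℂ] X) (R : ℂ → X →L[ℂ] X) (M : ℝ) : Prop where
  mem : ∀ z : ℂ, 0 < z.re → ∀ y, R z y ∈ A.domain
  right : ∀ (z : ℂ) (hz : 0 < z.re) (y : X), z • R z y - A ⟨R z y, mem z hz y⟩ = y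
  left : ∀ z : ℂ, 0 < z.re → ∀ x : A.domain, R z (z • (x : X) - A x) = x
  bound : ∀ z : ℂ, 0 < z.re → ‖z‖ * ‖R z‖ ≤ M

theorem ResolventBound.exists_isResolvent {A : X →ₗ.[ℂ] X} {M : ℝ} (h : ResolventBound A M)
    (hM : 0 ≤ M) : ∃ R, IsResolvent A R M := by
  have key : ∀ z : ℂ, ∃ R : X →L[ℂ] X, 0 < z.re →
      (∀ y, ∃ x : A.domain, R y = x ∧ z • (x : X) - A x = y) ∧
      (∀ x : A.domain, R (z • (x : X) - A x) = x) ∧ ‖z‖ * ‖R‖ ≤ M := by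
    intro z
    by_cases hz : 0 < z.re
    swap
    · exact ⟨0, fun h => absurd h hz⟩
    have hz0 : 0 < ‖z‖ := norm_pos_iff.2 fun h => by simp [h] at hz
    obtain ⟨h1, h2⟩ := h z hz
    let L : A.domain →ₗ[ℂ] X := z • A.domain.subtype - A.toFun
    have hL : ∀ x : A.domain, L x = z • (x : X) - A x := fun x => rfl
    have hinj : Function.Injective L := by
      rw [← LinearMap.ker_eq_bot, LinearMap.ker_eq_bot']
      intro x hx
      have := h1 x
      rw [← hL, hx, norm_zero, mul_zero] at this
      have h3 : ‖(x : X)‖ = 0 := by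
        by_contra hne
        have : 0 < ‖z‖ * ‖(x : X)‖ := mul_pos hz0 (lt_of_le_of_ne (norm_nonneg _) (Ne.symm hne))
        linarith
      exact Subtype.ext (norm_eq_zero.1 h3)
    have hsurj : Function.Surjective L := fun y => h2 y
    let e : A.domain ≃ₗ[ℂ] X := LinearEquiv.ofBijective L ⟨hinj, hsurj⟩
    have he : ∀ y, z • (e.symm y : X) - A (e.symm y) = y := fun y => e.apply_symm_apply y
    have hbd : ∀ y, ‖(A.domain.subtype ∘ₗ e.symm.toLinearMap) y‖ ≤ M / ‖z‖ * ‖y‖ := by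
      intro y
      have := h1 (e.symm y)
      rw [he] at this
      rw [div_mul_eq_mul_div, le_div_iff₀ hz0, mul_comm]
      exact this
    refine ⟨(A.domain.subtype ∘ₗ e.symm.toLinearMap).mkContinuous (M / ‖z‖) hbd, fun _ =>
      ⟨fun y => ⟨e.symm y, rfl, he y⟩, fun x => ?_, ?_⟩⟩
    · exact congrArg Subtype.val (e.symm_apply_apply x)
    · have := LinearMap.mkContinuous_norm_le _ (by positivity : 0 ≤ M / ‖z‖) hbd
      calc _ ≤ ‖z‖ * (M / ‖z‖) := by gcongr
        _ = M := by field_simp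
  choose R hR using key
  refine ⟨R, ⟨fun z hz y => ?_, fun z hz y => ?_, fun z hz => (hR z hz).2.1,
    fun z hz => (hR z hz).2.2⟩⟩
  · obtain ⟨x, hx, -⟩ := (hR z hz).1 y
    rw [hx]; exact x.2
  · obtain ⟨x, hx, hsolve⟩ := (hR z hz).1 y
    simp only [hx]; exact hsolve

/-- A relatively small perturbation keeps a resolvent bound in the half-plane. -/
theorem ResolventBound.add [CompleteSpace X] {A B : X →ₗ.[ℂ] X} {M a : ℝ} (h : ResolventBound A M)
    (hM : 0 ≤ M) (hB : A.domain ≤ B.domain) (ha : 0 ≤ a) (haM : a * (1 + M) ≤ 1 / 2)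
    (hBA : ∀ x : A.domain, ‖B ⟨x, hB x.2⟩‖ ≤ a * ‖A x‖) : ResolventBound (A + B) (2 * M) := by
  have hAx : ∀ z : ℂ, 0 < z.re → ∀ x : A.domain, ‖A x‖ ≤ (1 + M) * ‖z • (x : X) - A x‖ := by
    intro z hz x
    have h1 := (h z hz).1 x
    have e : A x = z • (x : X) - (z • (x : X) - A x) := by abel
    rw [e]
    refine (norm_sub_le _ _).trans ?_
    rw [norm_smul, ← e]
    linarith
  -- Since `A = z - (z - A)`, one has `‖A x‖ ≤ (1 + M) ‖(z - A) x‖`, so `B` is at most half of `z -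
  -- A`. Absorbing that half doubles the constant `M`.
  have hBx : ∀ z : ℂ, 0 < z.re → ∀ x : A.domain,
      ‖B ⟨x, hB x.2⟩‖ ≤ 1 / 2 * ‖z • (x : X) - A x‖ := by
    intro z hz x
    calc _ ≤ a * ((1 + M) * ‖z • (x : X) - A x‖) := (hBA x).trans (by gcongr; exact hAx z hz x)
      _ = a * (1 + M) * ‖z • (x : X) - A x‖ := by ring
      _ ≤ _ := by gcongr
  have hadd : ∀ x : (A + B).domain, (A + B) x = A ⟨x, x.2.1⟩ + B ⟨x, x.2.2⟩ := fun x => rfl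
  intro z hz
  constructor
  · intro x
    have hxA : (x : X) ∈ A.domain := x.2.1
    have h1 := (h z hz).1 ⟨x, hxA⟩
    have h2 := hBx z hz ⟨x, hxA⟩
    rw [hadd]
    have e : z • (x : X) - A ⟨x, hxA⟩ =
        (z • (x : X) - (A ⟨x, hxA⟩ + B ⟨x, hB hxA⟩)) + B ⟨x, hB hxA⟩ := by abel
    have h3 : ‖z • (x : X) - A ⟨x, hxA⟩‖ ≤
        ‖z • (x : X) - (A ⟨x, hxA⟩ + B ⟨x, hB hxA⟩)‖ + ‖B ⟨x, hB hxA⟩‖ := by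
      nth_rw 1 [e]; exact norm_add_le _ _
    simp only at h1 h2
    nlinarith
  · intro y
    obtain ⟨R, hR⟩ := h.exists_isResolvent hM
    let P : X →ₗ[ℂ] X :=
      { toFun := fun y => B ⟨R z y, hB (hR.mem z hz y)⟩
        map_add' := fun u v => by
          rw [← B.map_add]; congr 1; exact Subtype.ext (map_add _ _ _)
        map_smul' := fun c u => by
          rw [RingHom.id_apply, ← B.map_smul]; congr 1; exact Subtype.ext (map_smul _ _ _) }
    have hP : ∀ u, ‖P u‖ ≤ 1 / 2 * ‖u‖ := by
      intro u
      have := hBx z hz ⟨R z u, hR.mem z hz u⟩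
      rw [hR.right z hz u] at this
      exact this
    -- `Q = B R(z)`, and `z - (A + B) = (1 - Q) (z - A)` on `D(A)`, so the solution is `R(z) (1 -
    -- Q)⁻¹ y`.
    let Q : X →L[ℂ] X := P.mkContinuous (1 / 2) hP
    have hQ : ‖Q‖ < 1 := (P.mkContinuous_norm_le (by norm_num) hP).trans_lt (by norm_num)
    let U := Units.oneSub Q hQ
    set v : X := (↑U⁻¹ : X →L[ℂ] X) y with hv
    have hv' : v - Q v = y := by
      have : ((U : X →L[ℂ] X) * ↑U⁻¹) y = y := by rw [U.mul_inv]; rfl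
      exact this
    refine ⟨⟨R z v, hR.mem z hz v, hB (hR.mem z hz v)⟩, ?_⟩
    rw [hadd, ← sub_sub]
    change z • R z v - A ⟨R z v, _⟩ - B ⟨R z v, _⟩ = y
    rw [hR.right z hz v]
    exact hv'

/-! ### Resolvent identity and Yosida approximation. -/

namespace IsResolvent

variable {A : X →ₗ.[ℂ] X} {R : ℂ → X →L[ℂ] X} {M : ℝ}

theorem nonneg (h : IsResolvent A R M) : 0 ≤ M :=
  (by positivity : (0 : ℝ) ≤ ‖(1 : ℂ)‖ * ‖R 1‖).trans (h.bound 1 (by simp))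

theorem identity (h : IsResolvent A R M) {z w : ℂ} (hz : 0 < z.re) (hw : 0 < w.re) :
    R w = R z + (z - w) • (R z * R w) := by
  ext y
  have h1 := h.right w hw y
  have h2 := h.left z hz ⟨R w y, h.mem w hw y⟩
  have e : z • R w y - A ⟨R w y, h.mem w hw y⟩ = y + (z - w) • R w y := by
    nth_rw 4 [← h1]
    rw [sub_smul]; abel
  simp only [e, map_add, map_smul] at h2
  simpa using h2.symm

theorem commute (h : IsResolvent A R M) {z w : ℂ} (hz : 0 < z.re) (hw : 0 < w.re) :
    Commute (R z) (R w) := by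
  rcases eq_or_ne z w with rfl | hne
  · exact Commute.refl _
  have h1 := h.identity hz hw
  have h2 := h.identity hw hz
  have h3 : (z - w) • (R z * R w) = (z - w) • (R w * R z) := by
    have e1 : (z - w) • (R z * R w) = R w - R z := by rw [eq_sub_iff_add_eq']; exact h1.symm
    have e2 : (w - z) • (R w * R z) = R z - R w := by rw [eq_sub_iff_add_eq']; exact h2.symm
    rw [e1, ← neg_sub w z, neg_smul, e2, neg_sub]
  exact smul_right_injective _ (sub_ne_zero.2 hne) h3

/-- The Yosida approximation `n (n R(n) - 1)`. -/
noncomputable def yosida (R : ℂ → X →L[ℂ] X) (n : ℕ) : X →L[ℂ] X :=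
  ((n + 1 : ℝ) : ℂ) • (((n + 1 : ℝ) : ℂ) • R ((n + 1 : ℝ) : ℂ) - 1)

theorem re_pos (n : ℕ) : 0 < (((n + 1 : ℝ) : ℂ)).re := by
  rw [Complex.ofReal_re]; positivity

theorem commute_yosida (h : IsResolvent A R M) (m n : ℕ) : Commute (yosida R m) (yosida R n) := by
  have h1 := h.commute (re_pos m) (re_pos n)
  refine Commute.smul_left (Commute.smul_right ?_ _) _
  exact Commute.sub_left (Commute.sub_right ((h1.smul_left _).smul_right _) (Commute.one_right _))
    (Commute.one_left _)

/-- With `m = n + 1`, `μ = m l / (m + l)` and `κ = m - μ = m² / (m + l)`, the resolvent of the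
Yosida approximation at `l` is `(m + l)⁻¹ (1 + κ R(μ))`, by the resolvent identity. The point `μ`
stays in the half-plane because `1/μ = 1/m + 1/l`. Since `|l| |κ| = m |μ|` and both `|l|` and `m`
are at most `|m + l|`, the bound is `1 + M`, independent of n. -/
theorem halfPlaneBound_yosida (h : IsResolvent A R M) (n : ℕ) :
    HalfPlaneBound (yosida R n) (1 + M) := by
  intro l hl
  set m : ℝ := (n : ℝ) + 1 with hm
  have hmpos : 0 < m := by positivity
  have hl0 : l ≠ 0 := fun h => by simp [h] at hl
  have hm0 : (m : ℂ) ≠ 0 := by exact_mod_cast hmpos.ne'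
  have hml : (m : ℂ) + l ≠ 0 := fun h => by
    have := congrArg Complex.re h
    simp at this
    linarith
  set μ : ℂ := m * l / (m + l) with hμ
  have hμinv : μ = ((m : ℂ)⁻¹ + l⁻¹)⁻¹ := by
    rw [hμ, inv_add_inv hm0 hl0, inv_div]
  have hμre : 0 < μ.re := by
    rw [hμinv, Complex.inv_re]
    have h1 : 0 < ((m : ℂ)⁻¹ + l⁻¹).re := by
      rw [Complex.add_re, ← Complex.ofReal_inv, Complex.ofReal_re, Complex.inv_re]
      have : 0 < l.re / Complex.normSq l := div_pos hl (Complex.normSq_pos.2 hl0)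
      positivity
    exact div_pos h1 (Complex.normSq_pos.2 fun h => by simp [h] at h1)
  have hmre : 0 < (m : ℂ).re := by simpa using hmpos
  set κ : ℂ := m ^ 2 / (m + l) with hκ
  have hκ' : (m : ℂ) - μ = κ := by rw [hμ, hκ]; field_simp; ring
  have hid : κ • (R m * R μ) = R μ - R m := by
    rw [eq_sub_iff_add_eq', ← hκ']
    exact (h.identity hmre hμre).symm
  have hid' : κ • (R μ * R m) = R μ - R m := by
    rw [← (h.commute hmre hμre).eq]; exact hid
  have hY : l • 1 - yosida R n = (l + m) • (1 : X →L[ℂ] X) - (m ^ 2 : ℂ) • R m := by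
    rw [yosida, smul_sub, smul_smul, add_smul, ← sq]; abel
  have hκm : (l + m) * κ = m ^ 2 := by rw [hκ]; field_simp; ring
  refine ⟨(m + l)⁻¹ • (1 + κ • R μ), ?_, ?_, ?_⟩
  · rw [hY, mul_smul_comm, mul_add, mul_one, sub_mul, smul_mul_assoc, one_mul, smul_smul,
      hκm, smul_mul_assoc, mul_smul_comm, hid, smul_sub]
    have e : (l + m) • (1 : X →L[ℂ] X) - (m ^ 2 : ℂ) • R m +
        ((m ^ 2 : ℂ) • R μ - ((m ^ 2 : ℂ) • R μ - (m ^ 2 : ℂ) • R m)) = (l + m) • 1 := by abel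
    rw [e, smul_smul, add_comm l, inv_mul_cancel₀ hml, one_smul]
  · rw [hY, smul_mul_assoc, add_mul, one_mul, mul_sub, mul_smul_comm, mul_one, smul_smul,
      hκm, smul_mul_assoc, mul_smul_comm, smul_comm κ, hid', smul_sub]
    have e : (l + m) • (1 : X →L[ℂ] X) - (m ^ 2 : ℂ) • R m +
        ((m ^ 2 : ℂ) • R μ - ((m ^ 2 : ℂ) • R μ - (m ^ 2 : ℂ) • R m)) = (l + m) • 1 := by abel
    rw [e, smul_smul, add_comm l, inv_mul_cancel₀ hml, one_smul]
  · have hn1 : ‖l‖ ≤ ‖(m : ℂ) + l‖ := by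
      rw [← sq_le_sq₀ (norm_nonneg _) (norm_nonneg _), ← Complex.normSq_eq_norm_sq,
        ← Complex.normSq_eq_norm_sq, Complex.normSq_apply, Complex.normSq_apply]
      simp
      nlinarith
    have hn2 : m ≤ ‖(m : ℂ) + l‖ := by
      refine le_trans ?_ (Complex.re_le_norm _)
      simp; linarith
    have hb := h.bound μ hμre
    have hpos : 0 < ‖(m : ℂ) + l‖ := norm_pos_iff.2 hml
    have hμκ : ‖l‖ * ‖κ‖ = m * ‖μ‖ := by
      have : l * κ = m * μ := by rw [hκ, hμ]; ring
      have := congrArg norm this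
      rwa [norm_mul, norm_mul, Complex.norm_real, Real.norm_of_nonneg hmpos.le] at this
    rw [norm_smul, norm_inv]
    calc ‖l‖ * (‖(m : ℂ) + l‖⁻¹ * ‖1 + κ • R μ‖)
        ≤ ‖l‖ * (‖(m : ℂ) + l‖⁻¹ * (1 + ‖κ‖ * ‖R μ‖)) := by
          gcongr
          refine (norm_add_le _ _).trans ?_
          rw [norm_smul]
          gcongr
          exact ContinuousLinearMap.norm_id_le
      _ = ‖(m : ℂ) + l‖⁻¹ * (‖l‖ + m * (‖μ‖ * ‖R μ‖)) := by
          rw [← mul_assoc m, ← hμκ]; ring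
      _ ≤ ‖(m : ℂ) + l‖⁻¹ * (‖(m : ℂ) + l‖ + ‖(m : ℂ) + l‖ * M) := by
          gcongr
      _ = 1 + M := by field_simp

/-- On the domain `m R(m) y' - y' = R(m) A y'` has norm `O(1/m)`; density and the bound `‖m R(m)‖ ≤
M` give the rest. -/
theorem tendsto_smul_resolvent (h : IsResolvent A R M) (hd : Dense (A.domain : Set X)) (y : X) :
    Filter.Tendsto (fun n : ℕ => ((n + 1 : ℝ) : ℂ) • R ((n + 1 : ℝ) : ℂ) y) Filter.atTop
      (𝓝 y) := by
  have hM := h.nonneg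
  have hb : ∀ n : ℕ, ∀ v, ‖((n + 1 : ℝ) : ℂ) • R ((n + 1 : ℝ) : ℂ) v‖ ≤ M * ‖v‖ := by
    intro n v
    have h1 := h.bound _ (re_pos n)
    rw [norm_smul]
    calc _ ≤ ‖((n + 1 : ℝ) : ℂ)‖ * (‖R ((n + 1 : ℝ) : ℂ)‖ * ‖v‖) := by
          gcongr; exact ContinuousLinearMap.le_opNorm _ _
      _ ≤ M * ‖v‖ := by rw [← mul_assoc]; gcongr
  rw [Metric.tendsto_atTop]
  intro ε hε
  obtain ⟨y', hy', hyy'⟩ := hd.exists_dist_lt y (ε := ε / (2 * (M + 2))) (by positivity)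
  obtain ⟨N, hN⟩ := exists_nat_gt (2 * (M * ‖A ⟨y', hy'⟩‖) / ε)
  refine ⟨N, fun n hn => ?_⟩
  have h1 : ‖((n + 1 : ℝ) : ℂ) • R ((n + 1 : ℝ) : ℂ) y' - y'‖ < ε / 2 := by
    have e : ((n + 1 : ℝ) : ℂ) • R ((n + 1 : ℝ) : ℂ) y' - y' =
        R ((n + 1 : ℝ) : ℂ) (A ⟨y', hy'⟩) := by
      have := h.left _ (re_pos n) ⟨y', hy'⟩
      rw [map_sub, map_smul] at this
      simp only at this
      nth_rw 2 [← this]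
      abel
    have hn' : (0 : ℝ) < n + 1 := by positivity
    have h2 := hb n (A ⟨y', hy'⟩)
    rw [norm_smul, Complex.norm_real, Real.norm_of_nonneg hn'.le] at h2
    rw [e]
    have h3 : 2 * (M * ‖A ⟨y', hy'⟩‖) / ε < n + 1 := by
      have : (N : ℝ) ≤ n := by exact_mod_cast hn
      linarith
    rw [div_lt_iff₀ hε] at h3
    by_contra hcon
    push Not at hcon
    nlinarith
  have e : ((n + 1 : ℝ) : ℂ) • R ((n + 1 : ℝ) : ℂ) y - y =
      ((n + 1 : ℝ) : ℂ) • R ((n + 1 : ℝ) : ℂ) (y - y') +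
      (((n + 1 : ℝ) : ℂ) • R ((n + 1 : ℝ) : ℂ) y' - y') - (y - y') := by
    rw [map_sub, smul_sub]; abel
  rw [dist_eq_norm] at hyy' ⊢
  have h2 : (M + 2) * ‖y - y'‖ < ε / 2 := by
    calc _ < (M + 2) * (ε / (2 * (M + 2))) := by gcongr
      _ = ε / 2 := by field_simp
  rw [e]
  calc _ ≤ ‖((n + 1 : ℝ) : ℂ) • R ((n + 1 : ℝ) : ℂ) (y - y')‖ +
        ‖((n + 1 : ℝ) : ℂ) • R ((n + 1 : ℝ) : ℂ) y' - y'‖ + ‖y - y'‖ :=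
        (norm_sub_le _ _).trans (by gcongr; exact norm_add_le _ _)
    _ < ε := by linarith [hb n (y - y'), norm_nonneg (y - y')]

theorem tendsto_yosida (h : IsResolvent A R M) (hd : Dense (A.domain : Set X)) (x : A.domain) :
    Filter.Tendsto (fun n => yosida R n x) Filter.atTop (𝓝 (A x)) := by
  convert h.tendsto_smul_resolvent hd (A x) using 2 with n
  have := h.left _ (re_pos n) x
  rw [map_sub, map_smul, sub_eq_iff_eq_add] at this
  rw [yosida]
  simp only [smul_apply, sub_apply, one_apply_eq_self]
  rw [this, add_sub_cancel_left]

theorem exists_sectorialApprox [CompleteSpace X] (h : IsResolvent A R M)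
    (hd : Dense (A.domain : Set X)) :
    ∃ θ C : ℝ, θ < Real.pi / 2 ∧ SectorialApprox (yosida R) θ C A.domain := by
  have hM := h.nonneg
  -- The angle is the largest one that `HalfPlaneBound.rotate` allows for the constant `1 + M`,
  -- given `|e^{iφ} - 1| ≤ |φ|` and `‖1‖ ≤ 1`. The bound is that of `HalfPlaneBound.norm_exp_le` for
  -- the rotated constant `2 (1 + M)`.
  refine ⟨1 / (2 * (1 + (1 + M))), 1 + 2 * (1 + M) + 6 * (2 * (1 + M)) ^ 2, ?_, ?_⟩
  · have h1 : 1 / (2 * (1 + (1 + M))) ≤ 1 := by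
      rw [div_le_one (by positivity)]; linarith
    linarith [Real.pi_gt_three]
  · have hθ : 0 < 1 / (2 * (1 + (1 + M))) := by positivity
    have hθ1 : 1 / (2 * (1 + (1 + M))) ≤ 1 := by
      rw [div_le_one (by positivity)]; linarith
    refine ⟨hθ, by linarith [Real.pi_gt_three], h.commute_yosida, ?_, hd,
      fun x hx => ⟨_, h.tendsto_yosida hd ⟨x, hx⟩⟩⟩
    intro n z hz
    have hone : ‖(1 : X →L[ℂ] X)‖ ≤ 1 := ContinuousLinearMap.norm_id_le
    rcases hz with rfl | hz
    · rw [zero_smul, NormedSpace.exp_zero]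
      refine hone.trans ?_
      have : 0 ≤ 2 * (1 + M) + 6 * (2 * (1 + M)) ^ 2 := by positivity
      linarith
    obtain ⟨-, hz1, hz2⟩ := hz
    have hrot : HalfPlaneBound (Complex.exp (z.arg * Complex.I) • yosida R n)
        (2 * ‖(1 : X →L[ℂ] X)‖ * (1 + M)) := by
      refine (h.halfPlaneBound_yosida n).rotate ?_
      have h1 : ‖Complex.exp (z.arg * Complex.I) - 1‖ ≤ |z.arg| := by
        have := Real.norm_exp_I_mul_ofReal_sub_one_le (x := z.arg)
        rwa [mul_comm, Real.norm_eq_abs] at this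
      have h2 : |z.arg| ≤ 1 / (2 * (1 + (1 + M))) := (abs_lt.2 ⟨hz1, hz2⟩).le
      calc _ ≤ 1 / (2 * (1 + (1 + M))) * (1 + (1 + M)) := by
            gcongr
            exact h1.trans h2
        _ = 1 / 2 := by field_simp
    have hexp := hrot.norm_exp_le (norm_nonneg z)
    rw [smul_smul, Complex.norm_mul_exp_arg_mul_I] at hexp
    refine hexp.trans ?_
    have : 2 * ‖(1 : X →L[ℂ] X)‖ * (1 + M) ≤ 2 * (1 + M) := by
      have : ‖(1 : X →L[ℂ] X)‖ * (1 + M) ≤ 1 * (1 + M) := by gcongr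
      linarith
    gcongr

end IsResolvent

/-- A densely defined operator whose resolvent satisfies `‖R(z)‖ ≤ M / |z|` in the right half-plane
generates a uniformly bounded analytic semigroup. -/
theorem ResolventBound.generates [CompleteSpace X] {A : X →ₗ.[ℂ] X} {M : ℝ}
    (h : ResolventBound A M) (hM : 0 ≤ M) (hd : Dense (A.domain : Set X)) :
    GeneratesBoundedAnalyticSemigroup A := by
  obtain ⟨R, hR⟩ := h.exists_isResolvent hM
  obtain ⟨θ, C, hθ, hS⟩ := hR.exists_sectorialApprox hd
  refine ⟨θ, SectorialApprox.limit (IsResolvent.yosida R), hθ, hS.isAnalyticSemigroup_limit,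
    ⟨C, fun z hz => hS.norm_limit_le (Set.mem_insert_of_mem _ hz)⟩, fun x y => ⟨?_, ?_⟩⟩
  · intro hxy
    obtain ⟨u, hu, hy⟩ := (LinearPMap.mem_graph_iff A).1 hxy
    simp only at hu hy
    subst hu hy
    exact hS.tendsto_limit_slope (hR.tendsto_yosida hd u)
  · intro hxy
    have h1re : 0 < (1 : ℂ).re := by simp
    -- The generator is no larger than `A`: if the difference quotient at `x` tends to `y`, applying
    -- `R(1)`, which commutes with the semigroup, gives `A R(1) x = R(1) y`. Hence `x = R(1) (x -
    -- y)` lies in the domain and `A x = y`.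
    have hcomm : ∀ t : ℝ, 0 < t → ∀ v, R 1 (SectorialApprox.limit (IsResolvent.yosida R) t v) =
        SectorialApprox.limit (IsResolvent.yosida R) t (R 1 v) := by
      intro t ht v
      have hmem : (t : ℂ) ∈ insert 0 (sector (-θ) θ) := Or.inr (ofReal_mem_sector hS.pos ht)
      refine tendsto_nhds_unique (((R 1).continuous.tendsto _).comp (hS.tendsto_limit hmem v)) ?_
      refine (hS.tendsto_limit hmem (R 1 v)).congr fun n => ?_
      have hc : Commute (R 1) (NormedSpace.exp ((t : ℂ) • IsResolvent.yosida R n)) := by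
        refine Commute.exp_right (Commute.smul_right ?_ _)
        refine Commute.smul_right (Commute.sub_right (Commute.smul_right ?_ _)
          (Commute.one_right _)) _
        exact hR.commute h1re (IsResolvent.re_pos n)
      exact (congrArg (fun L : X →L[ℂ] X => L v) hc.eq).symm
    have hl1 := ((R 1).continuous.tendsto y).comp hxy
    have hl2 := hS.tendsto_limit_slope (hR.tendsto_yosida hd ⟨R 1 x, hR.mem 1 h1re x⟩)
    have hAR : A ⟨R 1 x, hR.mem 1 h1re x⟩ = R 1 y := by
      refine tendsto_nhds_unique hl2 (hl1.congr' ?_)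
      filter_upwards [self_mem_nhdsWithin] with t ht
      simp only [Function.comp_apply, map_smul, map_sub]
      rw [hcomm t ht]
    have hx : R 1 (x - y) = x := by
      have := hR.right 1 h1re x
      rw [hAR, one_smul, ← map_sub] at this
      exact this
    have hxmem : x ∈ A.domain := hx ▸ hR.mem 1 h1re (x - y)
    refine (LinearPMap.mem_graph_iff A).2 ⟨⟨x, hxmem⟩, rfl, ?_⟩
    have := hR.right 1 h1re (x - y)
    simp only [hx, one_smul] at this
    exact sub_right_injective this

end Generation

open MeasureTheory

/-! ### Partial derivatives on the torus -/

section Partial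

theorem integrable_of_continuous {F : Type*} [NormedAddCommGroup F] {φ : Torus → F}
    (h : Continuous φ) : Integrable φ := by
  rw [← integrableOn_univ]
  exact h.continuousOn.integrableOn_compact isCompact_univ

variable {E : Type*} [NormedAddCommGroup E] [NormedSpace ℝ E]

/-- The translate of `x` by `s` in the `i`-th direction. -/
noncomputable def shift (i : Fin 2) (x : Torus) (s : ℝ) : Torus :=
  x + Pi.single i (s : AddCircle (2 * Real.pi))

@[simp]
theorem shift_zero (i : Fin 2) (x : Torus) : shift i x 0 = x := by simp [shift]

theorem shift_shift (i : Fin 2) (x : Torus) (s t : ℝ) : shift i (shift i x s) t = shift i x (s + t) := by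
  simp only [shift, add_assoc, ← Pi.single_add]
  rfl

/-- `φ'` is the classical partial derivative `∂ᵢ φ`. -/
def HasPartial (i : Fin 2) (φ φ' : Torus → E) : Prop :=
  ∀ x, HasDerivAt (fun s : ℝ => φ (shift i x s)) (φ' x) 0

theorem HasPartial.hasDerivAt {i : Fin 2} {φ φ' : Torus → E} (h : HasPartial i φ φ') (x : Torus)
    (s : ℝ) : HasDerivAt (fun s : ℝ => φ (shift i x s)) (φ' (shift i x s)) s := by
  have h1 := h (shift i x s)
  have h2 : HasDerivAt (fun t : ℝ => t - s) 1 s := (hasDerivAt_id s).sub_const s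
  have h3 := HasDerivAt.scomp_of_eq s h1 h2 (sub_self s).symm
  simp only [one_smul] at h3
  refine h3.congr_of_eventuallyEq (Filter.Eventually.of_forall fun t => ?_)
  simp [shift_shift]

/-- By translation invariance the integral of `φ (shift i x s)` does not depend on `s`;
differentiate under the integral at `s = 0`. -/
theorem integral_partial_eq_zero {i : Fin 2} {φ φ' : Torus → E} (h : HasPartial i φ φ')
    (hc : Continuous φ) (hc' : Continuous φ') : ∫ x, φ' x = 0 := by
  obtain ⟨C, hC⟩ := isCompact_univ.exists_bound_of_continuousOn hc'.continuousOn
  have hsc : ∀ s : ℝ, Continuous fun x => shift i x s := fun s => by unfold shift; fun_prop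
  have h1 := (hasDerivAt_integral_of_dominated_loc_of_deriv_le (μ := volume) (𝕜 := ℝ)
    (F := fun s x => φ (shift i x s)) (F' := fun s x => φ' (shift i x s)) (x₀ := 0)
    (s := Set.univ) (bound := fun _ => C) Filter.univ_mem
    (Filter.Eventually.of_forall fun s =>
      (integrable_of_continuous (hc.comp (hsc s))).aestronglyMeasurable)
    (integrable_of_continuous (hc.comp (hsc 0)))
    (integrable_of_continuous (hc'.comp (hsc 0))).aestronglyMeasurable
    (Filter.Eventually.of_forall fun x s _ => hC _ (Set.mem_univ _)) (integrable_const C)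
    (Filter.Eventually.of_forall fun x s _ => h.hasDerivAt x s)).2
  have h2 : (fun s : ℝ => ∫ x, φ (shift i x s)) = fun _ => ∫ x, φ x := by
    funext s
    exact integral_add_right_eq_self φ _
  rw [h2] at h1
  simpa using (h1.unique (hasDerivAt_const _ _))

theorem HasPartial.mul {i : Fin 2} {𝔸 : Type*} [NormedRing 𝔸] [NormedAlgebra ℝ 𝔸]
    {φ φ' ψ ψ' : Torus → 𝔸} (h : HasPartial i φ φ')
    (k : HasPartial i ψ ψ') : HasPartial i (fun x => φ x * ψ x) (fun x => φ' x * ψ x + φ x * ψ' x) :=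
  fun x => ((h x).mul (k x)).congr_deriv (by simp)

theorem HasPartial.add {i : Fin 2} {φ φ' ψ ψ' : Torus → E} (h : HasPartial i φ φ')
    (k : HasPartial i ψ ψ') : HasPartial i (fun x => φ x + ψ x) (fun x => φ' x + ψ' x) :=
  fun x => (h x).add (k x)

theorem integral_mul_partial {𝔸 : Type*} [NormedRing 𝔸] [NormedAlgebra ℝ 𝔸] {i : Fin 2}
    {φ φ' ψ ψ' : Torus → 𝔸} (h : HasPartial i φ φ')
    (k : HasPartial i ψ ψ') (hφ : Continuous φ) (hφ' : Continuous φ') (hψ : Continuous ψ)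
    (hψ' : Continuous ψ') : ∫ x, φ x * ψ' x = -∫ x, φ' x * ψ x := by
  have h1 := integral_partial_eq_zero (h.mul k) (by fun_prop) (by fun_prop)
  rw [integral_add (integrable_of_continuous (by fun_prop))
    (integrable_of_continuous (by fun_prop))] at h1
  exact eq_neg_of_add_eq_zero_right h1

theorem IsSmooth.hasPartial {φ : Torus → E} (h : IsSmooth φ) (i : Fin 2) :
    HasPartial i φ (partialDeriv i φ) := by
  intro x
  obtain ⟨v, rfl⟩ := isOpenQuotientMap_cover.surjective x
  have h1 : ∀ t : ℝ, shift i (cover v) t = cover (v + t • Pi.single i 1) := by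
    intro t
    ext j
    by_cases hj : j = i
    · subst hj; simp [cover, shift]
    · simp [cover, shift, hj]
  have h2 : HasFDerivAt (fun w : Fin 2 → ℝ => φ (cover w))
      (fderiv ℝ (fun w : Fin 2 → ℝ => φ (cover w)) v) v :=
    (ContDiff.differentiable h (by simp)).differentiableAt.hasFDerivAt
  rw [partialDeriv_cover h]
  simp only [h1]
  exact h2.hasLineDerivAt (Pi.single i 1)

end Partial

/-! ### Trigonometric polynomials -/

section Trig

/-- The character `x ↦ e^{i k·x}` of the torus. -/
noncomputable def char (k : Fin 2 → ℤ) : C(Torus, ℂ) where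
  toFun x := ∏ j, fourier (k j) (x j)
  continuous_toFun := by
    refine continuous_finsetProd _ fun j _ => ?_
    exact (ContinuousMap.continuous _).comp (continuous_apply j)

theorem char_apply (k : Fin 2 → ℤ) (x : Torus) : char k x = ∏ j, fourier (k j) (x j) := rfl

theorem char_zero : char 0 = 1 := by
  ext x; simp [char_apply]

theorem char_add (k l : Fin 2 → ℤ) : char (k + l) = char k * char l := by
  ext x; simp [char_apply, Finset.prod_mul_distrib, -Fin.prod_univ_two]

theorem star_char (k : Fin 2 → ℤ) : star (char k) = char (-k) := by
  ext x; simp [char_apply]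

theorem char_shift (k : Fin 2 → ℤ) (i : Fin 2) (x : Torus) (s : ℝ) :
    char k (shift i x s) = Complex.exp (Complex.I * k i * s) * char k x := by
  have hpi : (Real.pi : ℂ) ≠ 0 := by exact_mod_cast Real.pi_ne_zero
  have h1 : ∀ j, fourier (k j) (shift i x s j) =
      fourier (k j) ((Pi.single i (s : AddCircle (2 * Real.pi)) : Torus) j) * fourier (k j) (x j) := by
    intro j
    simp only [shift, fourier_apply, Pi.add_apply, smul_add, AddCircle.toCircle_add,
      Circle.coe_mul]
    ring
  have h2 : ∏ j, fourier (k j) ((Pi.single i (s : AddCircle (2 * Real.pi)) : Torus) j) =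
      fourier (k i) (s : AddCircle (2 * Real.pi)) := by
    rw [Finset.prod_eq_single i]
    · simp
    · intro j _ hj
      simp [hj]
    · simp
  rw [char_apply, char_apply, Finset.prod_congr rfl fun j _ => h1 j, Finset.prod_mul_distrib, h2,
    fourier_coe_apply]
  congr 2
  push_cast
  field_simp

/-- The trigonometric polynomial with given Fourier coefficients. -/
noncomputable def trig : ((Fin 2 → ℤ) →₀ ℂ) →ₗ[ℂ] C(Torus, ℂ) := Finsupp.linearCombination ℂ char

/-- The Fourier multiplier with symbol `m`. -/
noncomputable def mult (m : (Fin 2 → ℤ) → ℂ) : ((Fin 2 → ℤ) →₀ ℂ) →ₗ[ℂ] ((Fin 2 → ℤ) →₀ ℂ) :=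
  Finsupp.linearCombination ℂ fun k => Finsupp.single k (m k)

@[simp]
theorem trig_single (k : Fin 2 → ℤ) (c : ℂ) : trig (Finsupp.single k c) = c • char k := by
  simp [trig]

@[simp]
theorem mult_single (m : (Fin 2 → ℤ) → ℂ) (k : Fin 2 → ℤ) (c : ℂ) :
    mult m (Finsupp.single k c) = Finsupp.single k (m k * c) := by
  simp [mult, mul_comm]

theorem mult_mult (m m' : (Fin 2 → ℤ) → ℂ) (c : (Fin 2 → ℤ) →₀ ℂ) :
    mult m (mult m' c) = mult (fun k => m k * m' k) c := by
  induction c using Finsupp.induction_linear with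
  | zero => simp
  | add f g hf hg => simp only [map_add, hf, hg]
  | single k c => simp only [mult_single, mul_assoc]

theorem mult_add (m m' : (Fin 2 → ℤ) → ℂ) (c : (Fin 2 → ℤ) →₀ ℂ) :
    mult (fun k => m k + m' k) c = mult m c + mult m' c := by
  induction c using Finsupp.induction_linear with
  | zero => simp
  | add f g hf hg => simp only [map_add, hf, hg]; abel
  | single k c => simp [add_mul]

theorem mult_const (a : ℂ) (c : (Fin 2 → ℤ) →₀ ℂ) : mult (fun _ => a) c = a • c := by
  induction c using Finsupp.induction_linear with
  | zero => simp
  | add f g hf hg => simp only [map_add, hf, hg, smul_add]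
  | single k c => simp

/-- The symbol `i kⱼ` of the partial derivative `∂ⱼ`. -/
noncomputable def dsymb (i : Fin 2) (k : Fin 2 → ℤ) : ℂ := Complex.I * k i

theorem hasPartial_trig (i : Fin 2) (c : (Fin 2 → ℤ) →₀ ℂ) :
    HasPartial i (trig c) (trig (mult (dsymb i) c)) := by
  intro x
  induction c using Finsupp.induction_linear with
  | zero => simpa using hasDerivAt_const (0 : ℝ) (0 : ℂ)
  | add f g hf hg =>
    simp only [map_add]
    exact hf.add hg
  | single k c =>
    have h1 : HasDerivAt (fun s : ℝ => Complex.exp (Complex.I * k i * s)) (Complex.I * k i) 0 := by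
      have := ((Complex.ofRealCLM.hasDerivAt (x := (0 : ℝ))).const_mul (Complex.I * k i)).cexp
      simpa using this
    have h2 := (h1.mul_const (char k x)).const_mul c
    simp only [mult_single, trig_single, ContinuousMap.coe_smul, Pi.smul_apply, smul_eq_mul,
      char_shift]
    refine h2.congr_deriv ?_
    rw [dsymb]; ring

/-- The symbol `-|k|²` of the Laplacian. -/
noncomputable def lsymb (k : Fin 2 → ℤ) : ℂ := ∑ i, dsymb i k * dsymb i k

/-- The squared length `|k|²` of a frequency. -/
noncomputable def nsq (k : Fin 2 → ℤ) : ℝ := ∑ i, (k i : ℝ) ^ 2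

theorem lsymb_eq (k : Fin 2 → ℤ) : lsymb k = -(nsq k : ℂ) := by
  simp only [lsymb, dsymb, nsq, Fin.sum_univ_two]
  push_cast
  linear_combination ((k 0 : ℂ) ^ 2 + (k 1 : ℂ) ^ 2) * Complex.I_mul_I

theorem nsq_nonneg (k : Fin 2 → ℤ) : 0 ≤ nsq k := Finset.sum_nonneg fun _ _ => sq_nonneg _

theorem mult_lsymb (c : (Fin 2 → ℤ) →₀ ℂ) :
    mult lsymb c = ∑ i, mult (dsymb i) (mult (dsymb i) c) := by
  simp only [mult_mult, Fin.sum_univ_two, ← mult_add]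
  refine congrArg (fun m => mult m c) (funext fun k => ?_)
  simp [lsymb]

/-- The star algebra of trigonometric polynomials. -/
noncomputable def trigAlgebra : StarSubalgebra ℂ C(Torus, ℂ) where
  carrier := LinearMap.range trig
  mul_mem' := by
    rintro _ _ ⟨f, rfl⟩ ⟨g, rfl⟩
    induction f using Finsupp.induction_linear with
    | zero => simp
    | add f f' hf hf' => rw [map_add, add_mul]; exact Submodule.add_mem _ hf hf'
    | single k a =>
      induction g using Finsupp.induction_linear with
      | zero => simp
      | add f f' hf hf' => rw [map_add, mul_add]; exact Submodule.add_mem _ hf hf'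
      | single l b =>
        refine ⟨Finsupp.single (k + l) (a * b), ?_⟩
        rw [trig_single, trig_single, trig_single, char_add, smul_mul_smul_comm]
  add_mem' := fun ha hb => Submodule.add_mem _ ha hb
  algebraMap_mem' r := ⟨Finsupp.single 0 r, by
    rw [trig_single, char_zero, Algebra.algebraMap_eq_smul_one]⟩
  star_mem' := by
    rintro _ ⟨f, rfl⟩
    induction f using Finsupp.induction_linear with
    | zero => simp
    | add f f' hf hf' => rw [map_add, star_add]; exact Submodule.add_mem _ hf hf'
    | single k a => exact ⟨Finsupp.single (-k) (star a), by
        rw [trig_single, trig_single, star_smul, star_char]⟩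

/-- Stone–Weierstrass: characters of a single coordinate already separate points. -/
theorem denseRange_trig : DenseRange trig := by
  have h : trigAlgebra.topologicalClosure = ⊤ := by
    refine ContinuousMap.starSubalgebra_topologicalClosure_eq_top_of_separatesPoints _ ?_
    intro x y hxy
    obtain ⟨i, hi⟩ := Function.ne_iff.1 hxy
    refine ⟨_, ⟨char (Pi.single i 1), ⟨Finsupp.single (Pi.single i 1) 1, by simp⟩, rfl⟩, ?_⟩
    have e : ∀ z : Torus, char (Pi.single i 1) z = fourier 1 (z i) := by
      intro z
      rw [char_apply, Finset.prod_eq_single i]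
      · simp
      · intro j _ hj
        simp [hj]
      · simp
    simp only [e, fourier_one, ne_eq]
    intro h
    exact hi (AddCircle.injective_toCircle Real.two_pi_pos.ne' (Subtype.ext h))
  intro f
  have hf : f ∈ trigAlgebra.topologicalClosure := by rw [h]; trivial
  have hf' : f ∈ closure (LinearMap.range trig : Set C(Torus, ℂ)) := hf
  rwa [LinearMap.coe_range] at hf'

end Trig

/-! ### Continuous functions in `L^p` -/

section Lp

variable (p : ℝ≥0∞) [Fact (1 ≤ p)]

/-- The class of a trigonometric polynomial in `L^p`. -/
noncomputable def trigLp : ((Fin 2 → ℤ) →₀ ℂ) →ₗ[ℂ] LpT p :=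
  (ContinuousMap.toLp p volume ℂ).toLinearMap ∘ₗ trig

theorem coeFn_trigLp (c : (Fin 2 → ℤ) →₀ ℂ) : trigLp p c =ᵐ[volume] trig c :=
  ContinuousMap.coeFn_toLp volume (trig c)

theorem denseRange_trigLp (hp : p ≠ ⊤) : DenseRange (trigLp p) :=
  (ContinuousMap.toLp_denseRange ℂ volume ℂ hp).comp denseRange_trig
    (ContinuousMap.toLp p volume ℂ).continuous

theorem norm_trigLp_rpow (hp : p ≠ ⊤) (c : (Fin 2 → ℤ) →₀ ℂ) :
    ‖trigLp p c‖ ^ p.toReal = ∫ x, ‖trig c x‖ ^ p.toReal := by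
  have hp1 : (1 : ℝ≥0∞) ≤ p := Fact.out
  have hp0 : p ≠ 0 := (zero_lt_one.trans_le hp1).ne'
  have hpos : 0 < p.toReal := ENNReal.toReal_pos hp0 hp
  rw [Lp.norm_def, (Lp.memLp (trigLp p c)).eLpNorm_eq_integral_rpow_norm hp0 hp,
    ENNReal.toReal_ofReal (by positivity), ← Real.rpow_mul (by positivity),
    inv_mul_cancel₀ hpos.ne', Real.rpow_one]
  refine integral_congr_ae ?_
  filter_upwards [coeFn_trigLp p c] with x hx
  rw [hx]

theorem isWeakPartial_trigLp (i : Fin 2) (c : (Fin 2 → ℤ) →₀ ℂ) :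
    IsWeakPartial i (trigLp p c) (trigLp p (mult (dsymb i) c)) := by
  intro φ hφ
  have h := integral_mul_partial (hasPartial_trig i c) (hφ.hasPartial i) (trig c).continuous
    (trig (mult (dsymb i) c)).continuous hφ.continuous (hφ.continuous_partialDeriv i)
  have e1 : ∫ x, trigLp p c x * partialDeriv i φ x = ∫ x, trig c x * partialDeriv i φ x := by
    refine integral_congr_ae ?_
    filter_upwards [coeFn_trigLp p c] with x hx
    rw [hx]
  have e2 : ∫ x, trigLp p (mult (dsymb i) c) x * φ x = ∫ x, trig (mult (dsymb i) c) x * φ x := by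
    refine integral_congr_ae ?_
    filter_upwards [coeFn_trigLp p (mult (dsymb i) c)] with x hx
    rw [hx]
  rw [e1, e2, h]

variable {p}

/-- Integration against a bounded continuous function on `L^p`. -/
theorem continuous_pairing {φ : Torus → ℂ} (hφ : Continuous φ) :
    Continuous fun f : LpT p => ∫ x, f x * φ x := by
  obtain ⟨C, hC⟩ := isCompact_univ.exists_bound_of_continuousOn hφ.continuousOn
  let L : LpT p →ₗ[ℂ] ℂ :=
    { toFun := fun f => ∫ x, f x * φ x
      map_add' := fun f g => by
        rw [← integral_add (integrable_mul (integrable_LpT f) hφ)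
          (integrable_mul (integrable_LpT g) hφ)]
        refine integral_congr_ae ?_
        filter_upwards [Lp.coeFn_add f g] with x hx
        rw [hx, Pi.add_apply, add_mul]
      map_smul' := fun c f => by
        rw [RingHom.id_apply, smul_eq_mul, ← integral_const_mul]
        refine integral_congr_ae ?_
        filter_upwards [Lp.coeFn_smul c f] with x hx
        rw [hx, Pi.smul_apply, smul_eq_mul, mul_assoc] }
  have hb : ∃ K, ∀ f : LpT p, ∫ x, ‖f x‖ ≤ K * ‖f‖ := by
    refine ⟨(volume (Set.univ : Set Torus) ^ (1 / (1 : ℝ≥0∞).toReal - 1 / p.toReal)).toReal,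
      fun f => ?_⟩
    have h1 := eLpNorm_le_eLpNorm_mul_rpow_measure_univ (p := 1) (q := p) (μ := volume)
      (Fact.out : 1 ≤ p) (Lp.aestronglyMeasurable f)
    have h2 : ∫ x, ‖f x‖ = (eLpNorm f 1 volume).toReal := by
      rw [eLpNorm_one_eq_lintegral_enorm, integral_norm_eq_lintegral_enorm
        (Lp.aestronglyMeasurable f)]
    rw [h2, Lp.norm_def, ← ENNReal.toReal_mul]
    refine ENNReal.toReal_mono (ENNReal.mul_ne_top ?_ (Lp.eLpNorm_ne_top f))
      (h1.trans_eq (mul_comm _ _))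
    refine (ENNReal.rpow_lt_top_of_nonneg ?_ (measure_ne_top _ _)).ne
    have h1p : (1 : ℝ≥0∞) ≤ p := Fact.out
    rcases eq_or_ne p ⊤ with rfl | hp
    · simp
    · have : 1 ≤ p.toReal := by simpa using ENNReal.toReal_mono hp h1p
      simpa using inv_le_one_of_one_le₀ this
  obtain ⟨K, hK⟩ := hb
  have : Continuous (L.mkContinuous (C * K) fun f => ?_) := ContinuousLinearMap.continuous _
  · exact this
  · have hC0 : 0 ≤ C := (norm_nonneg _).trans (hC 0 (Set.mem_univ _))
    calc ‖∫ x, f x * φ x‖ ≤ ∫ x, ‖f x‖ * C := by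
          refine norm_integral_le_of_norm_le ((integrable_LpT f).norm.mul_const C)
            (Filter.Eventually.of_forall fun x => ?_)
          rw [norm_mul]
          exact mul_le_mul_of_nonneg_left (hC x (Set.mem_univ _)) (norm_nonneg _)
      _ = C * ∫ x, ‖f x‖ := by rw [integral_mul_const, mul_comm]
      _ ≤ C * (K * ‖f‖) := mul_le_mul_of_nonneg_left (hK f) hC0
      _ = _ := by ring

end Lp

/-! ### The resolvent estimate for trigonometric polynomials -/

section Resolvent

/-- Taking real parts, `Re z · N` and `Re Q` are nonnegative with sum `Re F`. Taking imaginary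
parts, `|Im z| N ≤ |Im F| + r Re F`. With `r = p/2 - 1` the constant becomes `C_p`. -/
theorem norm_mul_le_of_numerical_range {z Q F : ℂ} {N r : ℝ} (hz : 0 ≤ z.re) (hN : 0 ≤ N)
    (hr : 0 ≤ r) (hQ : |Q.im| ≤ r * Q.re) (hQ0 : 0 ≤ Q.re) (h : z * N + Q = F) :
    ‖z‖ * N ≤ Real.sqrt (1 + (r + 1) ^ 2) * ‖F‖ := by
  have hre : z.re * N + Q.re = F.re := by rw [← h]; simp
  have him : z.im * N + Q.im = F.im := by rw [← h]; simp
  have h1 : (‖z‖ * N) ^ 2 ≤ (1 + (r + 1) ^ 2) * ‖F‖ ^ 2 := by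
    rw [mul_pow, ← Complex.normSq_eq_norm_sq, ← Complex.normSq_eq_norm_sq, Complex.normSq_apply,
      Complex.normSq_apply]
    have ha : 0 ≤ z.re * N := mul_nonneg hz hN
    have hb : |z.im * N| ≤ |F.im| + r * F.re := by
      have : z.im * N = F.im - Q.im := by linarith
      rw [this]
      refine (abs_sub _ _).trans ?_
      nlinarith
    have hb2 : (z.im * N) ^ 2 ≤ (|F.im| + r * F.re) ^ 2 := by
      rw [← sq_abs]; gcongr
    have ha2 : (z.re * N) ^ 2 ≤ F.re ^ 2 := by gcongr; linarith
    have hFr : 0 ≤ F.re := by linarith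
    have e : F.im * F.im = |F.im| ^ 2 := by rw [sq_abs, sq]
    rw [e]
    nlinarith [sq_nonneg (r * |F.im| - F.re), mul_nonneg hr (sq_nonneg F.re),
      mul_nonneg hr (sq_nonneg |F.im|), sq_nonneg |F.im|]
  have h2 := Real.sqrt_le_sqrt h1
  rwa [Real.sqrt_sq (by positivity), Real.sqrt_mul (by positivity),
    Real.sqrt_sq (norm_nonneg _)] at h2

theorem HasPartial.normSq_add {i : Fin 2} {u u' : Torus → ℂ} (h : HasPartial i u u') (ε : ℝ) :
    HasPartial i (fun x => ‖u x‖ ^ 2 + ε) (fun x => 2 * ((starRingEnd ℂ) (u x) * u' x).re) := by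
  intro x
  have h1 := (h x).norm_sq.add_const ε
  refine h1.congr_deriv ?_
  simp [Complex.inner, Complex.mul_re]
  ring

theorem HasPartial.rpow_const {i : Fin 2} {φ φ' : Torus → ℝ} (h : HasPartial i φ φ')
    (h0 : ∀ x, 0 < φ x) (r : ℝ) :
    HasPartial i (fun x => φ x ^ r) (fun x => φ' x * r * φ x ^ (r - 1)) := by
  intro x
  simpa using (h x).rpow_const (p := r) (Or.inl (h0 _).ne')

theorem HasPartial.ofReal {i : Fin 2} {φ φ' : Torus → ℝ} (h : HasPartial i φ φ') :
    HasPartial i (fun x => (φ x : ℂ)) (fun x => (φ' x : ℂ)) :=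
  fun x => (h x).ofReal_comp

theorem HasPartial.conj {i : Fin 2} {φ φ' : Torus → ℂ} (h : HasPartial i φ φ') :
    HasPartial i (fun x => (starRingEnd ℂ) (φ x)) (fun x => (starRingEnd ℂ) (φ' x)) :=
  fun x => (Complex.conjCLE : ℂ →L[ℝ] ℂ).hasFDerivAt.comp_hasDerivAt _ (h x)

/-- The value of `∇u · ∇(|u|² + ε)^r ū`, one direction at a time. -/
theorem numerical_range_pointwise {u u' : ℂ} {ρ r : ℝ} (hr : 0 ≤ r) (hρ : 0 < ρ)
    (hu : ‖u‖ ^ 2 ≤ ρ) :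
    let Q := (((2 * ((starRingEnd ℂ) u * u').re * r * ρ ^ (r - 1) : ℝ) : ℂ) * (starRingEnd ℂ) u +
      ((ρ ^ r : ℝ) : ℂ) * (starRingEnd ℂ) u') * u'
    0 ≤ Q.re ∧ |Q.im| ≤ r * Q.re := by
  intro Q
  -- In terms of `ζ = ū u'`, `Q = 2 r ρ^{r-1} (Re ζ) ζ + ρ^r |u'|²`. The imaginary part is
  -- controlled by `2 |Re ζ · Im ζ| ≤ |ζ|² ≤ ρ |u'|²`, hence by the second, real, term.
  set ζ := (starRingEnd ℂ) u * u' with hζ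
  have hQ : Q = ((2 * ζ.re * r * ρ ^ (r - 1) : ℝ) : ℂ) * ζ + ((ρ ^ r * ‖u'‖ ^ 2 : ℝ) : ℂ) := by
    have : (starRingEnd ℂ) u' * u' = ((‖u'‖ ^ 2 : ℝ) : ℂ) := by
      rw [mul_comm, Complex.mul_conj, Complex.normSq_eq_norm_sq]
    simp only [Q]
    rw [Complex.ofReal_mul (ρ ^ r), ← this, hζ]
    ring
  have hw : 0 < ρ ^ (r - 1) := Real.rpow_pos_of_pos hρ _
  have hw' : ρ ^ r = ρ ^ (r - 1) * ρ := by
    rw [← Real.rpow_add_one hρ.ne']; congr 1; ring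
  have hre : Q.re = 2 * r * ρ ^ (r - 1) * ζ.re ^ 2 + ρ ^ r * ‖u'‖ ^ 2 := by
    rw [hQ, Complex.add_re, Complex.re_ofReal_mul, Complex.ofReal_re]; ring
  have him : Q.im = 2 * r * ρ ^ (r - 1) * (ζ.re * ζ.im) := by
    rw [hQ, Complex.add_im, Complex.im_ofReal_mul, Complex.ofReal_im]; ring
  have hζn : ζ.re ^ 2 + ζ.im ^ 2 ≤ ρ * ‖u'‖ ^ 2 := by
    have : ζ.re ^ 2 + ζ.im ^ 2 = ‖u‖ ^ 2 * ‖u'‖ ^ 2 := by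
      rw [← mul_pow, ← RCLike.norm_conj u, ← norm_mul, ← hζ, ← Complex.normSq_eq_norm_sq,
        Complex.normSq_apply]
      ring
    rw [this]; gcongr
  have hprod : |ζ.re * ζ.im| ≤ (ζ.re ^ 2 + ζ.im ^ 2) / 2 := by
    rw [abs_le]; constructor <;> nlinarith [sq_nonneg (ζ.re + ζ.im), sq_nonneg (ζ.re - ζ.im)]
  have hre0 : 0 ≤ Q.re := by rw [hre]; positivity
  refine ⟨hre0, ?_⟩
  rw [him, abs_mul, abs_of_nonneg (by positivity : 0 ≤ 2 * r * ρ ^ (r - 1))]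
  calc 2 * r * ρ ^ (r - 1) * |ζ.re * ζ.im| ≤ 2 * r * ρ ^ (r - 1) * (ρ * ‖u'‖ ^ 2 / 2) := by
        gcongr; linarith
    _ = r * (ρ ^ r * ‖u'‖ ^ 2) := by rw [hw']; ring
    _ ≤ r * Q.re := by
        gcongr
        rw [hre]
        have : 0 ≤ 2 * r * ρ ^ (r - 1) * ζ.re ^ 2 := by positivity
        linarith

/-- Pair `z u - Δu` with `(|u|² + ε)^r ū` and integrate by parts; `ε > 0` keeps the weight
differentiable at the zeros of `u`. The pointwise sector inequality is stable under integration and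
summation over directions, so `norm_mul_le_of_numerical_range` applies. -/
theorem regularized_resolvent_estimate {u l : Torus → ℂ} {u' u'' : Fin 2 → Torus → ℂ}
    (h : ∀ i, HasPartial i u (u' i)) (h' : ∀ i, HasPartial i (u' i) (u'' i)) (hu : Continuous u)
    (hu' : ∀ i, Continuous (u' i)) (hu'' : ∀ i, Continuous (u'' i)) (hl : ∀ x, l x = ∑ i, u'' i x)
    {z : ℂ} (hz : 0 ≤ z.re) {r ε : ℝ} (hr : 0 ≤ r) (hε : 0 < ε) :
    ‖z‖ * ∫ x, (‖u x‖ ^ 2 + ε) ^ r * ‖u x‖ ^ 2 ≤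
      Real.sqrt (1 + (r + 1) ^ 2) * ∫ x, (‖u x‖ ^ 2 + ε) ^ r * ‖u x‖ * ‖z * u x - l x‖ := by
  have hρ : ∀ x, 0 < ‖u x‖ ^ 2 + ε := fun x => by positivity
  have hρc : Continuous fun x => ‖u x‖ ^ 2 + ε := by fun_prop
  have hwc : ∀ s : ℝ, Continuous fun x => (‖u x‖ ^ 2 + ε) ^ s := fun s =>
    hρc.rpow_const fun x => Or.inl (hρ x).ne'
  have hlc : Continuous l := by
    rw [show l = fun x => ∑ i, u'' i x from funext hl]; fun_prop
  set ψ : Torus → ℂ := fun x => (((‖u x‖ ^ 2 + ε) ^ r : ℝ) : ℂ) * (starRingEnd ℂ) (u x) with hψ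
  set ψ' : Fin 2 → Torus → ℂ := fun i x =>
    ((2 * ((starRingEnd ℂ) (u x) * u' i x).re * r * (‖u x‖ ^ 2 + ε) ^ (r - 1) : ℝ) : ℂ) *
      (starRingEnd ℂ) (u x) + (((‖u x‖ ^ 2 + ε) ^ r : ℝ) : ℂ) * (starRingEnd ℂ) (u' i x) with hψ'
  have hψp : ∀ i, HasPartial i ψ (ψ' i) := fun i =>
    ((((h i).normSq_add ε).rpow_const hρ r).ofReal).mul (h i).conj
  have hcc : Continuous (starRingEnd ℂ) := Complex.continuous_conj
  have hψc : Continuous ψ :=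
    (Complex.continuous_ofReal.comp (hwc r)).mul (hcc.comp hu)
  have hψ'c : ∀ i, Continuous (ψ' i) := fun i => by
    refine Continuous.add (Continuous.mul (Complex.continuous_ofReal.comp ?_) (hcc.comp hu))
      ((Complex.continuous_ofReal.comp (hwc r)).mul (hcc.comp (hu' i)))
    refine Continuous.mul (Continuous.mul (continuous_const.mul ?_) continuous_const) (hwc _)
    exact Complex.continuous_re.comp ((hcc.comp hu).mul (hu' i))
  have hibp : ∀ i, ∫ x, ψ x * u'' i x = -∫ x, ψ' i x * u' i x := fun i =>
    integral_mul_partial (hψp i) (h' i) hψc (hψ'c i) (hu' i) (hu'' i)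
  have hpt : ∀ i x, 0 ≤ (ψ' i x * u' i x).re ∧ |(ψ' i x * u' i x).im| ≤ r * (ψ' i x * u' i x).re :=
    fun i x => numerical_range_pointwise hr (hρ x) (by linarith)
  have hintg : ∀ i, Integrable fun x => ψ' i x * u' i x := fun i =>
    integrable_of_continuous ((hψ'c i).mul (hu' i))
  have hQi : ∀ i, 0 ≤ (∫ x, ψ' i x * u' i x).re ∧
      |(∫ x, ψ' i x * u' i x).im| ≤ r * (∫ x, ψ' i x * u' i x).re := by
    intro i
    have e1 : (∫ x, ψ' i x * u' i x).re = ∫ x, (ψ' i x * u' i x).re := (integral_re (hintg i)).symm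
    have e2 : (∫ x, ψ' i x * u' i x).im = ∫ x, (ψ' i x * u' i x).im := (integral_im (hintg i)).symm
    rw [e1, e2]
    refine ⟨integral_nonneg fun x => (hpt i x).1, ?_⟩
    rw [← integral_const_mul]
    refine (abs_integral_le_integral_abs).trans (integral_mono (hintg i).im.abs
      ((hintg i).re.const_mul r) fun x => (hpt i x).2)
  set Q : ℂ := ∑ i, ∫ x, ψ' i x * u' i x with hQ
  set F : ℂ := ∫ x, ψ x * (z * u x - l x) with hF
  set N : ℝ := ∫ x, (‖u x‖ ^ 2 + ε) ^ r * ‖u x‖ ^ 2 with hN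
  have hNF : z * N + Q = F := by
    have e1 : ∫ x, ψ x * l x = -Q := by
      simp only [hl, Finset.mul_sum]
      rw [integral_finsetSum _ fun i _ => integrable_of_continuous (by fun_prop)]
      simp only [hibp, Finset.sum_neg_distrib, hQ]
    have e2 : ∫ x, ψ x * (z * u x) = z * N := by
      rw [hN, ← integral_complex_ofReal, ← integral_const_mul]
      congr 1
      funext x
      have : (starRingEnd ℂ) (u x) * u x = ((‖u x‖ ^ 2 : ℝ) : ℂ) := by
        rw [mul_comm, Complex.mul_conj, Complex.normSq_eq_norm_sq]
      simp only [hψ]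
      rw [Complex.ofReal_mul, ← this]; ring
    have e3 : F = (∫ x, ψ x * (z * u x)) - ∫ x, ψ x * l x := by
      rw [hF, ← integral_sub (integrable_of_continuous (by fun_prop))
        (integrable_of_continuous (by fun_prop))]
      simp only [mul_sub]
    rw [e3, e1, e2, sub_neg_eq_add]
  have hQ0 : 0 ≤ Q.re := by
    rw [hQ, Complex.re_sum]; exact Finset.sum_nonneg fun i _ => (hQi i).1
  have hQ1 : |Q.im| ≤ r * Q.re := by
    rw [hQ, Complex.re_sum, Complex.im_sum, Finset.mul_sum]
    exact (Finset.abs_sum_le_sum_abs _ _).trans (Finset.sum_le_sum fun i _ => (hQi i).2)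
  have hN0 : 0 ≤ N := integral_nonneg fun x => by have := hρ x; positivity
  refine (norm_mul_le_of_numerical_range hz hN0 hr hQ1 hQ0 hNF).trans ?_
  gcongr
  refine (norm_integral_le_integral_norm _).trans (le_of_eq ?_)
  congr 1
  funext x
  have := hρ x
  rw [norm_mul, hψ, norm_mul, RCLike.norm_conj, Complex.norm_real,
    Real.norm_of_nonneg (by positivity)]

/-- The limit `ε → 0` of the regularized estimate with `r = (P - 2) / 2`, so that `r + 1 = P / 2`.
Writing `|ε|` makes both integrals continuous in ε on the whole line. -/
theorem resolvent_estimate_integral {u l : Torus → ℂ} {u' u'' : Fin 2 → Torus → ℂ}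
    (h : ∀ i, HasPartial i u (u' i)) (h' : ∀ i, HasPartial i (u' i) (u'' i)) (hu : Continuous u)
    (hu' : ∀ i, Continuous (u' i)) (hu'' : ∀ i, Continuous (u'' i)) (hl : ∀ x, l x = ∑ i, u'' i x)
    {z : ℂ} (hz : 0 ≤ z.re) {P : ℝ} (hP : 2 ≤ P) :
    ‖z‖ * ∫ x, ‖u x‖ ^ P ≤
      Real.sqrt (1 + P ^ 2 / 4) * ∫ x, ‖z * u x - l x‖ * ‖u x‖ ^ (P - 1) := by
  set r : ℝ := (P - 2) / 2 with hr
  have hr0 : 0 ≤ r := by rw [hr]; linarith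
  have hlc : Continuous l := by
    rw [show l = fun x => ∑ i, u'' i x from funext hl]; fun_prop
  have hw : Continuous fun q : ℝ × Torus => (‖u q.2‖ ^ 2 + |q.1|) ^ r :=
    Continuous.rpow_const (by fun_prop) fun _ => Or.inr hr0
  have c1 : Continuous fun ε : ℝ => ∫ x, (‖u x‖ ^ 2 + |ε|) ^ r * ‖u x‖ ^ 2 := by
    have : Continuous fun q : ℝ × Torus => (‖u q.2‖ ^ 2 + |q.1|) ^ r * ‖u q.2‖ ^ 2 :=
      hw.mul (by fun_prop)
    simpa using continuous_parametric_integral_of_continuous (μ := (volume : Measure Torus))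
      (f := fun ε x => (‖u x‖ ^ 2 + |ε|) ^ r * ‖u x‖ ^ 2) this isCompact_univ
  have c2 : Continuous fun ε : ℝ => ∫ x, (‖u x‖ ^ 2 + |ε|) ^ r * ‖u x‖ * ‖z * u x - l x‖ := by
    have : Continuous fun q : ℝ × Torus => (‖u q.2‖ ^ 2 + |q.1|) ^ r * ‖u q.2‖ *
        ‖z * u q.2 - l q.2‖ := (hw.mul (by fun_prop)).mul (by fun_prop)
    simpa using continuous_parametric_integral_of_continuous (μ := (volume : Measure Torus))
      (f := fun ε x => (‖u x‖ ^ 2 + |ε|) ^ r * ‖u x‖ * ‖z * u x - l x‖) this isCompact_univ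
  have key : ‖z‖ * ∫ x, (‖u x‖ ^ 2 + |(0 : ℝ)|) ^ r * ‖u x‖ ^ 2 ≤ Real.sqrt (1 + (r + 1) ^ 2) *
      ∫ x, (‖u x‖ ^ 2 + |(0 : ℝ)|) ^ r * ‖u x‖ * ‖z * u x - l x‖ := by
    refine le_of_tendsto_of_tendsto (b := 𝓝[>] (0 : ℝ))
      (((c1.tendsto 0).mono_left nhdsWithin_le_nhds).const_mul _)
      (((c2.tendsto 0).mono_left nhdsWithin_le_nhds).const_mul _) ?_
    filter_upwards [self_mem_nhdsWithin] with ε hε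
    rw [abs_of_pos hε]
    exact regularized_resolvent_estimate h h' hu hu' hu'' hl hz hr0 hε
  have e0 : 1 + (r + 1) ^ 2 = 1 + P ^ 2 / 4 := by rw [hr]; ring
  have hpow : ∀ x, (‖u x‖ ^ 2 + |(0 : ℝ)|) ^ r = ‖u x‖ ^ (P - 2) := fun x => by
    rw [abs_zero, add_zero, ← Real.rpow_natCast, ← Real.rpow_mul (norm_nonneg _)]
    congr 1
    rw [hr]; push_cast; ring
  have e1 : ∀ x, (‖u x‖ ^ 2 + |(0 : ℝ)|) ^ r * ‖u x‖ ^ 2 = ‖u x‖ ^ P := fun x => by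
    rw [hpow, ← Real.rpow_natCast, ← Real.rpow_add_of_nonneg (norm_nonneg _) (by linarith)
      (by norm_num)]
    congr 1; push_cast; ring
  have e2 : ∀ x, (‖u x‖ ^ 2 + |(0 : ℝ)|) ^ r * ‖u x‖ * ‖z * u x - l x‖ =
      ‖z * u x - l x‖ * ‖u x‖ ^ (P - 1) := fun x => by
    have : ‖u x‖ ^ (P - 1) = ‖u x‖ ^ (P - 2) * ‖u x‖ := by
      nth_rw 3 [← Real.rpow_one ‖u x‖]
      rw [← Real.rpow_add_of_nonneg (norm_nonneg _) (by linarith) (by norm_num)]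
      congr 1; ring
    rw [hpow, this]; ring
  rw [e0] at key
  simpa only [e1, e2] using key

/-- Hölder's inequality, in the form `∫ |f| |u|^{p-1} ≤ ‖f‖_p ‖u‖_p^{p-1}`. -/
theorem integral_mul_rpow_le {f u : Torus → ℂ} (hf : Continuous f) (hu : Continuous u) {P : ℝ}
    (hP : 1 < P) : ∫ x, ‖f x‖ * ‖u x‖ ^ (P - 1) ≤
      (∫ x, ‖f x‖ ^ P) ^ (1 / P) * (∫ x, ‖u x‖ ^ P) ^ (1 - 1 / P) := by
  have hc : P.HolderConjugate (P / (P - 1)) := Real.HolderConjugate.conjExponent hP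
  have huc : Continuous fun x => ‖u x‖ ^ (P - 1) :=
    hu.norm.rpow_const fun _ => Or.inr (by linarith)
  have hm : ∀ {g : Torus → ℝ}, Continuous g → ∀ s, MemLp g s volume := fun {g} hg s => by
    obtain ⟨C, hC⟩ := isCompact_univ.exists_bound_of_continuousOn hg.continuousOn
    exact MemLp.of_bound (integrable_of_continuous hg).aestronglyMeasurable C
      (Filter.Eventually.of_forall fun x => hC x (Set.mem_univ _))
  have h := integral_mul_le_Lp_mul_Lq_of_nonneg (μ := (volume : Measure Torus)) hc
    (f := fun x => ‖f x‖) (g := fun x => ‖u x‖ ^ (P - 1))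
    (Filter.Eventually.of_forall fun x => norm_nonneg _)
    (Filter.Eventually.of_forall fun x => by positivity) (hm hf.norm _) (hm huc _)
  have e : ∀ x, (‖u x‖ ^ (P - 1)) ^ (P / (P - 1)) = ‖u x‖ ^ P := fun x => by
    rw [← Real.rpow_mul (norm_nonneg _)]
    congr 1
    have : P - 1 ≠ 0 := by linarith
    field_simp
  have e2 : 1 / (P / (P - 1)) = 1 - 1 / P := by
    have : P ≠ 0 := by linarith
    field_simp
  simpa only [e, e2] using h

/-- Hölder bounds the right-hand integral by `‖z u - Δu‖_p ‖u‖_p^{p-1}`, and `‖u‖_p^{p-1}` is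
divided out when it is nonzero. -/
theorem resolvent_estimate_trig {p : ℝ≥0∞} [Fact (1 ≤ p)] (hp2 : 2 ≤ p) (hp : p ≠ ⊤) {z : ℂ}
    (hz : 0 ≤ z.re) (c : (Fin 2 → ℤ) →₀ ℂ) :
    ‖z‖ * ‖trigLp p c‖ ≤ resolventConst p * ‖trigLp p (z • c - mult lsymb c)‖ := by
  have hP : 2 ≤ p.toReal := by simpa using ENNReal.toReal_mono hp hp2
  set P := p.toReal with hPdef
  set d := z • c - mult lsymb c with hd
  have hdx : ∀ x, trig d x = z * trig c x - trig (mult lsymb c) x := fun x => by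
    rw [hd, map_sub, map_smul]; rfl
  have h1 := resolvent_estimate_integral (u := trig c) (l := trig (mult lsymb c))
    (u' := fun i => trig (mult (dsymb i) c)) (u'' := fun i => trig (mult (dsymb i) (mult (dsymb i) c)))
    (fun i => hasPartial_trig i c) (fun i => hasPartial_trig i _) (trig c).continuous
    (fun i => ContinuousMap.continuous _) (fun i => ContinuousMap.continuous _)
    (fun x => by rw [mult_lsymb, map_sum, ContinuousMap.sum_apply]) hz hP
  simp only [← hdx] at h1
  have h2 := integral_mul_rpow_le (trig d).continuous (trig c).continuous (P := P) (by linarith)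
  rw [← norm_trigLp_rpow p hp, ← norm_trigLp_rpow p hp, ← Real.rpow_mul (norm_nonneg _),
    ← Real.rpow_mul (norm_nonneg _), mul_one_div_cancel (by linarith), Real.rpow_one,
    show P * (1 - 1 / P) = P - 1 by field_simp] at h2
  rw [← norm_trigLp_rpow p hp] at h1
  rcases (norm_nonneg (trigLp p c)).eq_or_lt with h0 | h0
  · rw [← h0, mul_zero]
    exact mul_nonneg (Real.sqrt_nonneg _) (norm_nonneg _)
  have h3 : ‖trigLp p c‖ ^ P = ‖trigLp p c‖ * ‖trigLp p c‖ ^ (P - 1) := by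
    rw [← Real.rpow_one_add' h0.le (by linarith)]; congr 1; ring
  have h4 : ‖z‖ * ‖trigLp p c‖ * ‖trigLp p c‖ ^ (P - 1) ≤
      (resolventConst p * ‖trigLp p d‖) * ‖trigLp p c‖ ^ (P - 1) := by
    calc _ = ‖z‖ * ‖trigLp p c‖ ^ P := by rw [h3]; ring
      _ ≤ _ := h1
      _ ≤ resolventConst p * (‖trigLp p d‖ * ‖trigLp p c‖ ^ (P - 1)) := by
          rw [resolventConst]; gcongr
      _ = _ := by ring
  exact le_of_mul_le_mul_right h4 (Real.rpow_pos_of_pos h0 _)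

end Resolvent

/-! ### Functions of time and space, and the heat operator -/

section Jets

theorem hasDerivAt_integral_of_continuous {E : Type*} [NormedAddCommGroup E] [NormedSpace ℝ E]
    {φ φ' : ℝ → Torus → E} (h : ∀ t x, HasDerivAt (fun s => φ s x) (φ' t x) t)
    (hc : ∀ t, Continuous (φ t)) (hc' : Continuous (Function.uncurry φ')) (t : ℝ) :
    HasDerivAt (fun s => ∫ x, φ s x) (∫ x, φ' t x) t := by
  obtain ⟨C, hC⟩ := ((isCompact_Icc (a := t - 1) (b := t + 1)).prod
    (isCompact_univ (X := Torus))).exists_bound_of_continuousOn hc'.continuousOn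
  have hc't : Continuous (φ' t) := hc'.comp (by fun_prop : Continuous fun x : Torus => (t, x))
  exact (hasDerivAt_integral_of_dominated_loc_of_deriv_le (μ := volume) (𝕜 := ℝ)
    (F := φ) (F' := φ') (s := Set.Icc (t - 1) (t + 1)) (bound := fun _ => C)
    (Icc_mem_nhds (by linarith) (by linarith))
    (Filter.Eventually.of_forall fun s => (integrable_of_continuous (hc s)).aestronglyMeasurable)
    (integrable_of_continuous (hc t)) (integrable_of_continuous hc't).aestronglyMeasurable
    (Filter.Eventually.of_forall fun x s hs => hC (s, x) ⟨hs, Set.mem_univ _⟩)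
    (integrable_const C) (Filter.Eventually.of_forall fun x s _ => h s x)).2

/-- A function of time and space, with its derivatives `∂ₜ`, `∂ᵢ` and `∂ᵢ²`. -/
structure ParabolicJet where
  val : ℝ → Torus → ℝ
  dt : ℝ → Torus → ℝ
  dx : Fin 2 → ℝ → Torus → ℝ
  dxx : Fin 2 → ℝ → Torus → ℝ
  hasDt : ∀ t x, HasDerivAt (fun s => val s x) (dt t x) t
  hasDx : ∀ i t, HasPartial i (val t) (dx i t)
  hasDxx : ∀ i t, HasPartial i (dx i t) (dxx i t)
  cont : Continuous (Function.uncurry val)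
  cont_dt : Continuous (Function.uncurry dt)
  cont_dx : ∀ i, Continuous (Function.uncurry (dx i))
  cont_dxx : ∀ i, Continuous (Function.uncurry (dxx i))

namespace ParabolicJet

/-- The heat operator `∂ₜ - Δ`. -/
def heat (J : ParabolicJet) (t : ℝ) (x : Torus) : ℝ := J.dt t x - ∑ i, J.dxx i t x

/-- The squared length of the gradient. -/
def gradSq (J : ParabolicJet) (t : ℝ) (x : Torus) : ℝ := ∑ i, J.dx i t x ^ 2

/-- The sum of two functions. -/
def add (J K : ParabolicJet) : ParabolicJet where
  val t x := J.val t x + K.val t x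
  dt t x := J.dt t x + K.dt t x
  dx i t x := J.dx i t x + K.dx i t x
  dxx i t x := J.dxx i t x + K.dxx i t x
  hasDt t x := (J.hasDt t x).add (K.hasDt t x)
  hasDx i t := (J.hasDx i t).add (K.hasDx i t)
  hasDxx i t := (J.hasDxx i t).add (K.hasDxx i t)
  cont := J.cont.add K.cont
  cont_dt := J.cont_dt.add K.cont_dt
  cont_dx i := (J.cont_dx i).add (K.cont_dx i)
  cont_dxx i := (J.cont_dxx i).add (K.cont_dxx i)

/-- A multiple of a function. -/
def smul (c : ℝ) (J : ParabolicJet) : ParabolicJet where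
  val t x := c * J.val t x
  dt t x := c * J.dt t x
  dx i t x := c * J.dx i t x
  dxx i t x := c * J.dxx i t x
  hasDt t x := (J.hasDt t x).const_mul c
  hasDx i t x := (J.hasDx i t x).const_mul c
  hasDxx i t x := (J.hasDxx i t x).const_mul c
  cont := continuous_const.mul J.cont
  cont_dt := continuous_const.mul J.cont_dt
  cont_dx i := continuous_const.mul (J.cont_dx i)
  cont_dxx i := continuous_const.mul (J.cont_dxx i)

/-- The product of two functions. -/
def mul (J K : ParabolicJet) : ParabolicJet where
  val t x := J.val t x * K.val t x
  dt t x := J.dt t x * K.val t x + J.val t x * K.dt t x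
  dx i t x := J.dx i t x * K.val t x + J.val t x * K.dx i t x
  dxx i t x := (J.dxx i t x * K.val t x + J.dx i t x * K.dx i t x) +
    (J.dx i t x * K.dx i t x + J.val t x * K.dxx i t x)
  hasDt t x := (J.hasDt t x).mul (K.hasDt t x)
  hasDx i t := (J.hasDx i t).mul (K.hasDx i t)
  hasDxx i t := ((J.hasDxx i t).mul (K.hasDx i t)).add ((J.hasDx i t).mul (K.hasDxx i t))
  cont := J.cont.mul K.cont
  cont_dt := (J.cont_dt.mul K.cont).add (J.cont.mul K.cont_dt)
  cont_dx i := ((J.cont_dx i).mul K.cont).add (J.cont.mul (K.cont_dx i))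
  cont_dxx i := (((J.cont_dxx i).mul K.cont).add ((J.cont_dx i).mul (K.cont_dx i))).add
    (((J.cont_dx i).mul (K.cont_dx i)).add (J.cont.mul (K.cont_dxx i)))

theorem continuous_rpow (J : ParabolicJet) (h : ∀ t x, 0 < J.val t x) (r : ℝ) :
    Continuous (Function.uncurry fun t x => J.val t x ^ r) :=
  J.cont.rpow_const fun q => Or.inl (ne_of_gt (h q.1 q.2))

/-- The power of a positive function. -/
noncomputable def rpow (J : ParabolicJet) (h : ∀ t x, 0 < J.val t x) (r : ℝ) : ParabolicJet where
  val t x := J.val t x ^ r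
  dt t x := J.dt t x * r * J.val t x ^ (r - 1)
  dx i t x := J.dx i t x * r * J.val t x ^ (r - 1)
  dxx i t x := J.dxx i t x * r * J.val t x ^ (r - 1) +
    J.dx i t x * r * (J.dx i t x * (r - 1) * J.val t x ^ (r - 1 - 1))
  hasDt t x := (J.hasDt t x).rpow_const (Or.inl (h t x).ne')
  hasDx i t := (J.hasDx i t).rpow_const (h t) r
  hasDxx i t := HasPartial.mul (fun x => (J.hasDxx i t x).mul_const r)
    ((J.hasDx i t).rpow_const (h t) (r - 1))
  cont := J.continuous_rpow h r
  cont_dt := (J.cont_dt.mul continuous_const).mul (J.continuous_rpow h _)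
  cont_dx i := ((J.cont_dx i).mul continuous_const).mul (J.continuous_rpow h _)
  cont_dxx i := (((J.cont_dxx i).mul continuous_const).mul (J.continuous_rpow h _)).add
    (((J.cont_dx i).mul continuous_const).mul
      (((J.cont_dx i).mul continuous_const).mul (J.continuous_rpow h _)))

theorem heat_add (J K : ParabolicJet) (t : ℝ) (x : Torus) :
    (J.add K).heat t x = J.heat t x + K.heat t x := by
  simp only [heat, add, Fin.sum_univ_two]; ring

theorem heat_smul (c : ℝ) (J : ParabolicJet) (t : ℝ) (x : Torus) :
    (J.smul c).heat t x = c * J.heat t x := by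
  simp only [heat, smul, Fin.sum_univ_two]; ring

theorem heat_mul (J K : ParabolicJet) (t : ℝ) (x : Torus) :
    (J.mul K).heat t x = J.heat t x * K.val t x + J.val t x * K.heat t x -
      2 * ∑ i, J.dx i t x * K.dx i t x := by
  simp only [heat, mul, Fin.sum_univ_two]; ring

theorem heat_rpow (J : ParabolicJet) (h : ∀ t x, 0 < J.val t x) (r : ℝ) (t : ℝ) (x : Torus) :
    (J.rpow h r).heat t x = r * J.val t x ^ (r - 1) * J.heat t x -
      r * (r - 1) * J.val t x ^ (r - 1 - 1) * J.gradSq t x := by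
  simp only [heat, gradSq, rpow, Fin.sum_univ_two]; ring

theorem gradSq_rpow (J : ParabolicJet) (h : ∀ t x, 0 < J.val t x) (r : ℝ) (t : ℝ) (x : Torus) :
    (J.rpow h r).gradSq t x = r ^ 2 * (J.val t x ^ (r - 1)) ^ 2 * J.gradSq t x := by
  simp only [gradSq, rpow, Fin.sum_univ_two]; ring

theorem gradSq_add_le (J K : ParabolicJet) (t : ℝ) (x : Torus) :
    (J.add K).gradSq t x ≤ 2 * (J.gradSq t x + K.gradSq t x) := by
  simp only [gradSq, add, Fin.sum_univ_two]
  nlinarith [sq_nonneg (J.dx 0 t x - K.dx 0 t x), sq_nonneg (J.dx 1 t x - K.dx 1 t x)]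

theorem gradSq_nonneg (J : ParabolicJet) (t : ℝ) (x : Torus) : 0 ≤ J.gradSq t x :=
  Finset.sum_nonneg fun _ _ => sq_nonneg _

theorem continuous_slice (J : ParabolicJet) (t : ℝ) : Continuous (J.val t) :=
  J.cont.comp (by fun_prop : Continuous fun x : Torus => (t, x))

theorem continuous_heat (J : ParabolicJet) (t : ℝ) : Continuous (J.heat t) := by
  have h1 : Continuous (J.dt t) := J.cont_dt.comp (by fun_prop : Continuous fun x : Torus => (t, x))
  have h2 : ∀ i, Continuous (J.dxx i t) := fun i =>
    (J.cont_dxx i).comp (by fun_prop : Continuous fun x : Torus => (t, x))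
  unfold heat
  fun_prop

/-- The total mass changes at the rate given by the heat operator. -/
theorem hasDerivAt_integral (J : ParabolicJet) (t : ℝ) :
    HasDerivAt (fun s => ∫ x, J.val s x) (∫ x, J.heat t x) t := by
  have h := hasDerivAt_integral_of_continuous J.hasDt J.continuous_slice J.cont_dt t
  refine h.congr_deriv ?_
  have h1 : Continuous (J.dt t) := J.cont_dt.comp (by fun_prop : Continuous fun x : Torus => (t, x))
  have h2 : ∀ i, Continuous (J.dxx i t) := fun i =>
    (J.cont_dxx i).comp (by fun_prop : Continuous fun x : Torus => (t, x))
  have h3 : ∀ i, Continuous (J.dx i t) := fun i =>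
    (J.cont_dx i).comp (by fun_prop : Continuous fun x : Torus => (t, x))
  change _ = ∫ x, (J.dt t x - ∑ i, J.dxx i t x)
  rw [integral_sub (integrable_of_continuous h1) (integrable_of_continuous (by fun_prop)),
    integral_finsetSum _ fun i _ => integrable_of_continuous (h2 i)]
  simp only [fun i => integral_partial_eq_zero (J.hasDxx i t) (h3 i) (h2 i)]
  simp

end ParabolicJet

end Jets

/-! ### A Bellman function for the heat flow -/

section Bellman

open ParabolicJet

/-- The function `J` behaves like `|f|² + ε` for a solution `f` of the heat equation with
`|∇f|² = A`. -/
structure IsCaloricSq (J : ParabolicJet) (A : ℝ → Torus → ℝ) : Prop where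
  pos : ∀ t x, 0 < J.val t x
  nonneg : ∀ t x, 0 ≤ A t x
  heat : ∀ t x, J.heat t x = -2 * A t x
  gradSq : ∀ t x, J.gradSq t x ≤ 4 * J.val t x * A t x

theorem rpow_sub_one_mul {a : ℝ} (ha : 0 < a) (r : ℝ) : a ^ (r - 1) * a = a ^ r := by
  rw [← Real.rpow_add_one ha.ne']; congr 1; ring

theorem IsCaloricSq.heat_rpow_ge {J : ParabolicJet} {A : ℝ → Torus → ℝ} (h : IsCaloricSq J A)
    {r : ℝ} (hr : 1 ≤ r) (t : ℝ) (x : Torus) :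
    2 * r * J.val t x ^ (r - 1) * A t x ≤ -(J.rpow h.pos r).heat t x := by
  rw [heat_rpow, h.heat]
  have h1 : 0 ≤ r * (r - 1) * J.val t x ^ (r - 1 - 1) * J.gradSq t x := by
    have := Real.rpow_pos_of_pos (h.pos t x) (r - 1 - 1)
    have := J.gradSq_nonneg t x
    have : 0 ≤ r - 1 := by linarith
    positivity
  linarith

/-- For `r ≤ 1` the gradient term has the wrong sign; the bound on `gradSq` leaves `2 r - 4 r (1 -
r) = 2 r (2 r - 1)`. This is positive for `r = q/2` with `q > 1`. -/
theorem IsCaloricSq.heat_rpow_ge' {J : ParabolicJet} {A : ℝ → Torus → ℝ} (h : IsCaloricSq J A)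
    {r : ℝ} (hr0 : 0 ≤ r) (hr : r ≤ 1) (t : ℝ) (x : Torus) :
    2 * r * (2 * r - 1) * J.val t x ^ (r - 1) * A t x ≤ -(J.rpow h.pos r).heat t x := by
  rw [heat_rpow, h.heat]
  have hp := Real.rpow_pos_of_pos (h.pos t x) (r - 1 - 1)
  have h1 : r * (1 - r) * J.val t x ^ (r - 1 - 1) * J.gradSq t x ≤
      r * (1 - r) * J.val t x ^ (r - 1 - 1) * (4 * J.val t x * A t x) := by
    have : 0 ≤ 1 - r := by linarith
    gcongr
    exact h.gradSq t x
  have h2 := rpow_sub_one_mul (h.pos t x) (r - 1)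
  have h3 : r * (1 - r) * J.val t x ^ (r - 1 - 1) * (4 * J.val t x * A t x) =
      4 * r * (1 - r) * J.val t x ^ (r - 1) * A t x := by rw [← h2]; ring
  nlinarith

theorem IsCaloricSq.gradSq_rpow_le {J : ParabolicJet} {A : ℝ → Torus → ℝ} (h : IsCaloricSq J A)
    (r : ℝ) (t : ℝ) (x : Torus) :
    (J.rpow h.pos r).gradSq t x ≤ 4 * r ^ 2 * J.val t x ^ r * (J.val t x ^ (r - 1) * A t x) := by
  rw [gradSq_rpow]
  calc _ ≤ r ^ 2 * (J.val t x ^ (r - 1)) ^ 2 * (4 * J.val t x * A t x) := by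
        gcongr; exact h.gradSq t x
    _ = _ := by rw [← rpow_sub_one_mul (h.pos t x) r]; ring

/-- The lower bound for `-(∂ₜ - Δ)(a v^γ)`. -/
theorem heat_mul_rpow_ge {a v : ParabolicJet} {A : ℝ → Torus → ℝ} (ha : IsCaloricSq a A)
    (hv : ∀ t x, 0 < v.val t x) (hheat : ∀ t x, v.heat t x ≤ 0) {γ : ℝ} (h0 : 0 ≤ γ) (h1 : γ ≤ 1)
    (t : ℝ) (x : Torus) :
    v.val t x ^ γ * A t x - 5 * (a.val t x * v.val t x ^ (γ - 1 - 1) * v.gradSq t x) ≤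
      -(a.mul (v.rpow hv γ)).heat t x := by
  have hapos := ha.pos t x
  have hvpos := hv t x
  set w := v.val t x ^ (γ - 1 - 1) with hw
  have hwpos : 0 < w := Real.rpow_pos_of_pos hvpos _
  have e1 : v.val t x ^ (γ - 1) = w * v.val t x := (rpow_sub_one_mul hvpos _).symm
  have e2 : v.val t x ^ γ = w * v.val t x ^ 2 := by
    rw [← rpow_sub_one_mul hvpos γ, e1]; ring
  -- Young's inequality for the cross term `∇a · ∇v^γ`. It spends one of the two copies of `v^γ A`
  -- and four units of `a v^{γ-2} |∇v|²`; the fifth unit comes from the concavity of `v^γ`.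
  have hcross : ∀ i, -(2 * γ * w * v.val t x * (a.dx i t x * v.dx i t x)) ≤
      w * v.val t x ^ 2 * (a.dx i t x ^ 2 / (4 * a.val t x)) +
        4 * (a.val t x * w * v.dx i t x ^ 2) := by
    intro i
    have hsq := sq_nonneg (v.val t x * a.dx i t x / (2 * a.val t x) + 2 * γ * v.dx i t x)
    have e3 : a.val t x * w * (v.val t x * a.dx i t x / (2 * a.val t x) + 2 * γ * v.dx i t x) ^ 2 =
        w * v.val t x ^ 2 * (a.dx i t x ^ 2 / (4 * a.val t x)) +
        2 * γ * w * v.val t x * (a.dx i t x * v.dx i t x) +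
        4 * γ ^ 2 * (a.val t x * w * v.dx i t x ^ 2) := by
      field_simp
      ring
    have h2 : 0 ≤ a.val t x * w * (v.val t x * a.dx i t x / (2 * a.val t x) +
      2 * γ * v.dx i t x) ^ 2 := by positivity
    have h3 : 4 * γ ^ 2 * (a.val t x * w * v.dx i t x ^ 2) ≤
        4 * (a.val t x * w * v.dx i t x ^ 2) := by
      have h4 : 0 ≤ a.val t x * w * v.dx i t x ^ 2 := by positivity
      have h5 : γ ^ 2 ≤ 1 := by nlinarith
      nlinarith
    linarith
  have hgrad : w * v.val t x ^ 2 * (a.gradSq t x / (4 * a.val t x)) ≤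
      w * v.val t x ^ 2 * A t x := by
    gcongr
    rw [div_le_iff₀ (by positivity)]
    linarith [ha.gradSq t x]
  have hsum : -(2 * ∑ i, a.dx i t x * (v.dx i t x * γ * (w * v.val t x))) ≤
      w * v.val t x ^ 2 * A t x + 4 * (a.val t x * w * v.gradSq t x) := by
    refine le_trans ?_ (add_le_add_left hgrad _)
    have c0 := hcross 0
    have c1 := hcross 1
    simp only [ParabolicJet.gradSq, Fin.sum_univ_two, add_div]
    nlinarith
  have hdx : ∀ i, (v.rpow hv γ).dx i t x = v.dx i t x * γ * (w * v.val t x) := fun i => by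
    rw [← e1]; rfl
  have hval : (v.rpow hv γ).val t x = w * v.val t x ^ 2 := e2
  rw [heat_mul, ha.heat, heat_rpow]
  simp only [hdx, hval]
  rw [e1, e2, ← hw]
  have h6 : 0 ≤ a.val t x * (γ * (w * v.val t x) * -v.heat t x) := by
    have := hheat t x
    have : 0 ≤ -v.heat t x := by linarith
    positivity
  have h7 : γ * (1 - γ) * (a.val t x * w * v.gradSq t x) ≤ a.val t x * w * v.gradSq t x := by
    have := v.gradSq_nonneg t x
    have h8 : 0 ≤ a.val t x * w * v.gradSq t x := by positivity
    have h9 : γ * (1 - γ) ≤ 1 := by nlinarith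
    nlinarith
  nlinarith

/-- The function `v = a^{p/2} + b^{q/2}` with `q = p / (p - 1)`. -/
noncomputable def bellmanBase (a b : ParabolicJet) (ha : ∀ t x, 0 < a.val t x)
    (hb : ∀ t x, 0 < b.val t x) (P : ℝ) : ParabolicJet :=
  (a.rpow ha (P / 2)).add (b.rpow hb (P / (P - 1) / 2))

theorem bellmanBase_pos {a b : ParabolicJet} (ha : ∀ t x, 0 < a.val t x)
    (hb : ∀ t x, 0 < b.val t x) (P : ℝ) (t : ℝ) (x : Torus) :
    0 < (bellmanBase a b ha hb P).val t x :=
  add_pos (Real.rpow_pos_of_pos (ha t x) _) (Real.rpow_pos_of_pos (hb t x) _)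

/-- The Bellman function `v + δ a v^γ` with `v` as above, `γ = 1 - 2 / p` and `δ = 1 / (20 p)`. -/
noncomputable def bellman (a b : ParabolicJet) (ha : ∀ t x, 0 < a.val t x)
    (hb : ∀ t x, 0 < b.val t x) (P : ℝ) : ParabolicJet :=
  (bellmanBase a b ha hb P).add
    ((a.mul ((bellmanBase a b ha hb P).rpow (bellmanBase_pos ha hb P) (1 - 2 / P))).smul
      (1 / (20 * P)))

/-- From `a^{P/2} ≤ v`, hence `a ≤ v^{2/P} = v^{1-γ}`. It controls both the size of the correction
`a v^γ` and the gradient error in its heat operator. -/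
theorem mul_rpow_le_one {a b : ParabolicJet} (ha : ∀ t x, 0 < a.val t x)
    (hb : ∀ t x, 0 < b.val t x) {P : ℝ} (hP : 2 ≤ P) (t : ℝ) (x : Torus) :
    a.val t x * (bellmanBase a b ha hb P).val t x ^ (1 - 2 / P - 1) ≤ 1 := by
  set v := (bellmanBase a b ha hb P).val t x with hv
  have hv0 : 0 < v := bellmanBase_pos ha hb P t x
  have hX : a.val t x ^ (P / 2) ≤ v :=
    le_add_of_nonneg_right (Real.rpow_pos_of_pos (hb t x) _).le
  have h1 : a.val t x ≤ v ^ (2 / P) := by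
    have := Real.rpow_le_rpow (Real.rpow_nonneg (ha t x).le _) hX (by positivity : 0 ≤ 2 / P)
    rwa [← Real.rpow_mul (ha t x).le, show P / 2 * (2 / P) = 1 by field_simp,
      Real.rpow_one] at this
  calc _ ≤ v ^ (2 / P) * v ^ (1 - 2 / P - 1) := by
        gcongr
    _ = 1 := by
        rw [← Real.rpow_add hv0, show 2 / P + (1 - 2 / P - 1) = 0 by ring, Real.rpow_zero]

theorem bellman_val_le {a b : ParabolicJet} (ha : ∀ t x, 0 < a.val t x)
    (hb : ∀ t x, 0 < b.val t x) {P : ℝ} (hP : 2 ≤ P) (t : ℝ) (x : Torus) :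
    (bellman a b ha hb P).val t x ≤ 2 * (bellmanBase a b ha hb P).val t x := by
  have hv0 := bellmanBase_pos ha hb P t x
  have h1 := mul_rpow_le_one ha hb hP t x
  have e := rpow_sub_one_mul hv0 (1 - 2 / P)
  have h2 : a.val t x * (bellmanBase a b ha hb P).val t x ^ (1 - 2 / P) ≤
      (bellmanBase a b ha hb P).val t x := by
    rw [← e, ← mul_assoc]
    exact mul_le_of_le_one_left hv0.le h1
  have h3 : 1 / (20 * P) ≤ 1 := by
    rw [div_le_one (by positivity)]; linarith
  have h4 : 0 ≤ a.val t x * (bellmanBase a b ha hb P).val t x ^ (1 - 2 / P) := by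
    have := ha t x
    positivity
  change (bellmanBase a b ha hb P).val t x + 1 / (20 * P) *
    (a.val t x * (bellmanBase a b ha hb P).val t x ^ (1 - 2 / P)) ≤ _
  nlinarith

theorem bellman_val_nonneg {a b : ParabolicJet} (ha : ∀ t x, 0 < a.val t x)
    (hb : ∀ t x, 0 < b.val t x) {P : ℝ} (hP : 2 ≤ P) (t : ℝ) (x : Torus) :
    0 ≤ (bellman a b ha hb P).val t x := by
  have hv0 := bellmanBase_pos ha hb P t x
  have := ha t x
  change 0 ≤ (bellmanBase a b ha hb P).val t x + 1 / (20 * P) *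
    (a.val t x * (bellmanBase a b ha hb P).val t x ^ (1 - 2 / P))
  positivity

/-- The constant in the Bellman inequality. -/
noncomputable def bellmanConst (P : ℝ) : ℝ := min (1 / (20 * P)) (P / (2 * (P - 1) ^ 2))

theorem bellmanConst_pos {P : ℝ} (hP : 2 ≤ P) : 0 < bellmanConst P := by
  have : 0 < P - 1 := by linarith
  exact lt_min (by positivity) (by positivity)

/-- The base `v` alone yields `P a^{P/2-1} A` and `q (q - 1) b^{q/2-1} B`. The first is useless
where `a` is small relative to `b`. The correction `a v^γ` supplies `v^γ A ≥ b^{1-q/2} A`, whose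
product with `b^{q/2-1} B` is `A B`, and its errors are absorbed by half of what `v` gives. The
arithmetic–geometric mean inequality concludes. -/
theorem heat_bellman_le {a b : ParabolicJet} {A B : ℝ → Torus → ℝ} (ha : IsCaloricSq a A)
    (hb : IsCaloricSq b B) {P : ℝ} (hP : 2 ≤ P) (t : ℝ) (x : Torus) :
    2 * bellmanConst P * (Real.sqrt (A t x) * Real.sqrt (B t x)) ≤
      -(bellman a b ha.pos hb.pos P).heat t x := by
  have hP1 : 0 < P - 1 := by linarith
  set q := P / (P - 1) with hq
  have hq0 : 0 < q := by positivity
  have hq1 : q ≤ 2 := by rw [hq, div_le_iff₀ hP1]; linarith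
  have hqq : q - 1 = 1 / (P - 1) := by rw [hq]; field_simp; ring
  set V := bellmanBase a b ha.pos hb.pos P with hV
  have hVpos : ∀ t x, 0 < V.val t x := bellmanBase_pos ha.pos hb.pos P
  have hX := fun t x => ha.heat_rpow_ge (r := P / 2) (by linarith) t x
  have hY := fun t x => hb.heat_rpow_ge' (r := q / 2) (by positivity) (by linarith) t x
  have hVheat : ∀ t x, V.heat t x ≤ 0 := by
    intro t x
    rw [hV, bellmanBase, heat_add, ← hq]
    have h1 := hX t x
    have h2 := hY t x
    have h3 := Real.rpow_pos_of_pos (ha.pos t x) (P / 2 - 1)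
    have h4 := Real.rpow_pos_of_pos (hb.pos t x) (q / 2 - 1)
    have h5 := ha.nonneg t x
    have h6 := hb.nonneg t x
    have h7 : 0 ≤ 2 * (q / 2) - 1 := by
      have : 0 < 1 / (P - 1) := by positivity
      linarith
    have h8 : 0 ≤ 2 * (P / 2) * a.val t x ^ (P / 2 - 1) * A t x := by positivity
    have h9 : 0 ≤ 2 * (q / 2) * (2 * (q / 2) - 1) * b.val t x ^ (q / 2 - 1) * B t x := by
      positivity
    linarith
  have hγ0 : 0 ≤ 1 - 2 / P := by
    rw [sub_nonneg, div_le_one (by positivity)]; exact hP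
  have hγ1 : 1 - 2 / P ≤ 1 := by
    have : 0 < 2 / P := by positivity
    linarith
  have hW := heat_mul_rpow_ge ha hVpos hVheat hγ0 hγ1 t x
  set α := a.val t x ^ (P / 2 - 1) * A t x with hα
  set β := b.val t x ^ (q / 2 - 1) with hβ
  have hβpos : 0 < β := Real.rpow_pos_of_pos (hb.pos t x) _
  have hA := ha.nonneg t x
  have hB := hb.nonneg t x
  have hα0 : 0 ≤ α := mul_nonneg (Real.rpow_nonneg (ha.pos t x).le _) hA
  set w := V.val t x ^ (1 - 2 / P - 1 - 1) with hw
  have hwpos : 0 < w := Real.rpow_pos_of_pos (hVpos t x) _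
  have hapos := ha.pos t x
  have haw : a.val t x * w * V.val t x ≤ 1 := by
    have := mul_rpow_le_one ha.pos hb.pos hP t x
    rw [← hV, ← rpow_sub_one_mul (hVpos t x) (1 - 2 / P - 1), ← hw] at this
    linarith
  have hXv : a.val t x ^ (P / 2) ≤ V.val t x :=
    le_add_of_nonneg_right (Real.rpow_pos_of_pos (hb.pos t x) _).le
  have hYv : b.val t x ^ (q / 2) ≤ V.val t x :=
    le_add_of_nonneg_left (Real.rpow_pos_of_pos (ha.pos t x) _).le
  have hgrad : a.val t x * w * V.gradSq t x ≤ 2 * (P ^ 2 * α + q ^ 2 * (β * B t x)) := by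
    have g1 := gradSq_add_le (a.rpow ha.pos (P / 2)) (b.rpow hb.pos (q / 2)) t x
    have g2 : (a.rpow ha.pos (P / 2)).gradSq t x ≤ P ^ 2 * V.val t x * α := by
      refine (ha.gradSq_rpow_le (P / 2) t x).trans ?_
      calc _ = P ^ 2 * a.val t x ^ (P / 2) * α := by rw [hα]; ring
        _ ≤ _ := by gcongr
    have g3 : (b.rpow hb.pos (q / 2)).gradSq t x ≤ q ^ 2 * V.val t x * (β * B t x) := by
      refine (hb.gradSq_rpow_le (q / 2) t x).trans ?_
      calc _ = q ^ 2 * b.val t x ^ (q / 2) * (β * B t x) := by rw [hβ]; ring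
        _ ≤ _ := by gcongr
    have g4 : V.gradSq t x ≤ 2 * V.val t x * (P ^ 2 * α + q ^ 2 * (β * B t x)) := by
      refine g1.trans ?_
      nlinarith
    calc a.val t x * w * V.gradSq t x
        ≤ a.val t x * w * (2 * V.val t x * (P ^ 2 * α + q ^ 2 * (β * B t x))) := by gcongr
      _ = (a.val t x * w * V.val t x) * (2 * (P ^ 2 * α + q ^ 2 * (β * B t x))) := by ring
      _ ≤ 1 * (2 * (P ^ 2 * α + q ^ 2 * (β * B t x))) := by gcongr
      _ = _ := one_mul _
  -- The choice of γ makes the exponents match: `(q/2) (1 - 2/P) = 1 - q/2` for conjugate exponents.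
  have hVγ : β⁻¹ ≤ V.val t x ^ (1 - 2 / P) := by
    have h1 := Real.rpow_le_rpow (Real.rpow_nonneg (hb.pos t x).le _) hYv hγ0
    rw [← Real.rpow_mul (hb.pos t x).le] at h1
    refine le_trans (le_of_eq ?_) h1
    rw [hβ, ← Real.rpow_neg (hb.pos t x).le]
    congr 1
    rw [hq]; field_simp; ring
  have hfinal : bellmanConst P * (β⁻¹ * A t x + β * B t x) ≤
      -(bellman a b ha.pos hb.pos P).heat t x := by
    rw [bellman, heat_add, heat_smul]
    change _ ≤ -(V.heat t x + 1 / (20 * P) * (a.mul (V.rpow hVpos (1 - 2 / P))).heat t x)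
    have hVl : P * α + q * (q - 1) * (β * B t x) ≤ -V.heat t x := by
      rw [hV, bellmanBase, heat_add, ← hq]
      have h1 := hX t x
      have h2 := hY t x
      have e1 : 2 * (P / 2) * a.val t x ^ (P / 2 - 1) * A t x = P * α := by rw [hα]; ring
      have e2 : 2 * (q / 2) * (2 * (q / 2) - 1) * b.val t x ^ (q / 2 - 1) * B t x =
        q * (q - 1) * (β * B t x) := by rw [hβ]; ring
      linarith
    have hc1 : bellmanConst P ≤ 1 / (20 * P) := min_le_left _ _
    have hc2 : bellmanConst P ≤ q * (q - 1) / 2 := by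
      refine (min_le_right _ _).trans (le_of_eq ?_)
      rw [hqq, hq]; field_simp
    have hW' : 1 / (20 * P) * (V.val t x ^ (1 - 2 / P) * A t x) -
        1 / (20 * P) * (10 * (P ^ 2 * α + q ^ 2 * (β * B t x))) ≤
        -(1 / (20 * P) * (a.mul (V.rpow hVpos (1 - 2 / P))).heat t x) := by
      rw [← mul_sub, ← mul_neg]
      gcongr
      linarith
    -- The weight `1 / (20 P)` makes the error exactly half of the gain from `V`, because `q / P = q
    -- - 1`.
    have e3 : 1 / (20 * P) * (10 * (P ^ 2 * α + q ^ 2 * (β * B t x))) =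
        P / 2 * α + q * (q - 1) / 2 * (β * B t x) := by
      rw [hqq, hq]; field_simp; ring
    have h5 : bellmanConst P * (β⁻¹ * A t x) ≤
        1 / (20 * P) * (V.val t x ^ (1 - 2 / P) * A t x) := by
      gcongr
    have h6 : bellmanConst P * (β * B t x) ≤ q * (q - 1) / 2 * (β * B t x) := by
      gcongr
    have h7 : 0 ≤ P / 2 * α := by positivity
    rw [e3] at hW'
    nlinarith
  refine le_trans ?_ hfinal
  have hsq : 2 * (Real.sqrt (A t x) * Real.sqrt (B t x)) ≤ β⁻¹ * A t x + β * B t x := by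
    have h1 := sq_nonneg (Real.sqrt (A t x) - β * Real.sqrt (B t x))
    have h2 : β⁻¹ * A t x + β * B t x - 2 * (Real.sqrt (A t x) * Real.sqrt (B t x)) =
        β⁻¹ * (Real.sqrt (A t x) - β * Real.sqrt (B t x)) ^ 2 := by
      have ea := Real.sq_sqrt hA
      have eb := Real.sq_sqrt hB
      nth_rw 1 [← ea]
      nth_rw 1 [← eb]
      field_simp
      ring
    have h3 : 0 ≤ β⁻¹ * (Real.sqrt (A t x) - β * Real.sqrt (B t x)) ^ 2 := by positivity
    linarith
  calc _ = bellmanConst P * (2 * (Real.sqrt (A t x) * Real.sqrt (B t x))) := by ring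
    _ ≤ _ := by
      have := bellmanConst_pos hP
      gcongr

end Bellman

/-! ### The heat flow of trigonometric polynomials -/

section Flow

theorem mult_comm (m m' : (Fin 2 → ℤ) → ℂ) (c : (Fin 2 → ℤ) →₀ ℂ) :
    mult m (mult m' c) = mult m' (mult m c) := by
  simp only [mult_mult, mul_comm]

/-- The solution at time `t` of the heat equation with initial value `trig c`. -/
noncomputable def flow (c : (Fin 2 → ℤ) →₀ ℂ) (t : ℝ) : C(Torus, ℂ) :=
  trig (mult (fun k => Complex.exp (lsymb k * t)) c)

theorem flow_zero (c : (Fin 2 → ℤ) →₀ ℂ) : flow c 0 = trig c := by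
  simp [flow, mult_const]

theorem flow_zero_left : flow 0 = fun _ => 0 := by
  funext t; simp [flow]

theorem flow_add (c d : (Fin 2 → ℤ) →₀ ℂ) (t : ℝ) : flow (c + d) t = flow c t + flow d t := by
  simp [flow]

theorem flow_single (k : Fin 2 → ℤ) (a : ℂ) (t : ℝ) :
    flow (Finsupp.single k a) t = (Complex.exp (lsymb k * t) * a) • char k := by
  rw [flow, mult_single, trig_single]

theorem hasPartial_flow (i : Fin 2) (c : (Fin 2 → ℤ) →₀ ℂ) (t : ℝ) :
    HasPartial i (flow c t) (flow (mult (dsymb i) c) t) := by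
  unfold flow
  rw [mult_comm]
  exact hasPartial_trig i _

theorem hasDerivAt_flow (c : (Fin 2 → ℤ) →₀ ℂ) (t : ℝ) (x : Torus) :
    HasDerivAt (fun s => flow c s x) (flow (mult lsymb c) t x) t := by
  induction c using Finsupp.induction_linear with
  | zero => simpa [flow] using hasDerivAt_const t (0 : ℂ)
  | add f g hf hg =>
    simp only [map_add, flow_add]
    exact hf.add hg
  | single k c =>
    have h1 := ((Complex.ofRealCLM.hasDerivAt (x := t)).const_mul (lsymb k)).cexp
    have h2 := (h1.mul_const c).mul_const (char k x)
    simp only [mult_single, flow_single, ContinuousMap.coe_smul, Pi.smul_apply, smul_eq_mul]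
    refine h2.congr_deriv ?_
    simp only [Complex.ofRealCLM_apply, Complex.ofReal_one]
    ring

theorem continuous_flow (c : (Fin 2 → ℤ) →₀ ℂ) : Continuous fun q : ℝ × Torus => flow c q.1 q.2 := by
  induction c using Finsupp.induction_linear with
  | zero => simpa [flow] using continuous_const
  | add f g hf hg =>
    simp only [flow_add]
    exact hf.add hg
  | single k c =>
    simp only [flow_single, ContinuousMap.coe_smul, Pi.smul_apply, smul_eq_mul]
    fun_prop

theorem flow_lsymb (c : (Fin 2 → ℤ) →₀ ℂ) (t : ℝ) (x : Torus) :
    flow (mult lsymb c) t x = ∑ i, flow (mult (dsymb i) (mult (dsymb i) c)) t x := by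
  rw [mult_lsymb]
  simp [flow]

theorem tendsto_exp_lsymb {k : Fin 2 → ℤ} (hk : k ≠ 0) :
    Filter.Tendsto (fun t : ℝ => Complex.exp (lsymb k * t)) Filter.atTop (𝓝 0) := by
  have h0 : 0 < nsq k := by
    refine (nsq_nonneg k).lt_of_ne fun h => hk ?_
    have h1 := (Finset.sum_eq_zero_iff_of_nonneg fun i _ => sq_nonneg (k i : ℝ)).1 h.symm
    funext i
    simpa using h1 i (Finset.mem_univ i)
  rw [tendsto_zero_iff_norm_tendsto_zero]
  have h1 : ∀ t : ℝ, ‖Complex.exp (lsymb k * t)‖ = Real.exp (-(nsq k * t)) := fun t => by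
    rw [Complex.norm_exp, lsymb_eq]; simp
  simp only [h1]
  exact Real.tendsto_exp_neg_atTop_nhds_zero.comp (Filter.tendsto_id.const_mul_atTop h0)

theorem exists_tendsto_flow (c : (Fin 2 → ℤ) →₀ ℂ) :
    ∃ l, Filter.Tendsto (flow c) Filter.atTop (𝓝 l) := by
  induction c using Finsupp.induction_linear with
  | zero => exact ⟨0, by rw [flow_zero_left]; exact tendsto_const_nhds⟩
  | add f g hf hg =>
    obtain ⟨l, hl⟩ := hf
    obtain ⟨l', hl'⟩ := hg
    refine ⟨l + l', ?_⟩
    rw [show flow (f + g) = fun t => flow f t + flow g t from funext (flow_add f g)]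
    exact hl.add hl'
  | single k c =>
    rw [show flow (Finsupp.single k c) = fun t : ℝ => (Complex.exp (lsymb k * t) * c) • char k from
      funext (flow_single k c)]
    rcases eq_or_ne k 0 with rfl | hk
    · have : lsymb 0 = 0 := by simp [lsymb_eq, nsq]
      simp only [this, zero_mul]
      exact ⟨_, tendsto_const_nhds⟩
    · exact ⟨_, ((tendsto_exp_lsymb hk).mul_const c).smul_const _⟩

/-- Differentiation removes the frequency 0, the only mode that the heat flow does not damp. -/
theorem tendsto_flow_dsymb (i : Fin 2) (c : (Fin 2 → ℤ) →₀ ℂ) :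
    Filter.Tendsto (flow (mult (dsymb i) c)) Filter.atTop (𝓝 0) := by
  induction c using Finsupp.induction_linear with
  | zero => rw [map_zero, flow_zero_left]; exact tendsto_const_nhds
  | add f g hf hg =>
    rw [map_add, show flow (mult (dsymb i) f + mult (dsymb i) g) =
      fun t => flow (mult (dsymb i) f) t + flow (mult (dsymb i) g) t from funext (flow_add _ _)]
    simpa using hf.add hg
  | single k c =>
    rw [mult_single, show flow (Finsupp.single k (dsymb i k * c)) =
      fun t : ℝ => (Complex.exp (lsymb k * t) * (dsymb i k * c)) • char k from
      funext (flow_single k _)]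
    rcases eq_or_ne k 0 with rfl | hk
    · simp [dsymb]
    · simpa using ((tendsto_exp_lsymb hk).mul_const (dsymb i k * c)).smul_const (char k)

theorem HasPartial.re {i : Fin 2} {φ φ' : Torus → ℂ} (h : HasPartial i φ φ') :
    HasPartial i (fun x => (φ x).re) (fun x => (φ' x).re) :=
  fun x => Complex.reCLM.hasFDerivAt.comp_hasDerivAt _ (h x)

/-- The function `|f_t|² + ε` for the heat flow `f_t` of a trigonometric polynomial. -/
noncomputable def caloricJet (c : (Fin 2 → ℤ) →₀ ℂ) (ε : ℝ) : ParabolicJet where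
  val t x := ‖flow c t x‖ ^ 2 + ε
  dt t x := 2 * ((starRingEnd ℂ) (flow c t x) * flow (mult lsymb c) t x).re
  dx i t x := 2 * ((starRingEnd ℂ) (flow c t x) * flow (mult (dsymb i) c) t x).re
  dxx i t x := 2 * ((starRingEnd ℂ) (flow (mult (dsymb i) c) t x) * flow (mult (dsymb i) c) t x +
    (starRingEnd ℂ) (flow c t x) * flow (mult (dsymb i) (mult (dsymb i) c)) t x).re
  hasDt t x := by
    refine ((hasDerivAt_flow c t x).norm_sq.add_const ε).congr_deriv ?_
    simp [Complex.inner, Complex.mul_re]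
    ring
  hasDx i t := (hasPartial_flow i c t).normSq_add ε
  hasDxx i t x := (((hasPartial_flow i c t).conj.mul (hasPartial_flow i _ t)).re x).const_mul 2
  cont := by
    have := continuous_flow c
    simp only [Function.uncurry_def]
    fun_prop
  cont_dt := by
    have h1 := Complex.continuous_conj.comp (continuous_flow c)
    have h2 := continuous_flow (mult lsymb c)
    exact continuous_const.mul (Complex.continuous_re.comp (h1.mul h2))
  cont_dx i := by
    have h1 := Complex.continuous_conj.comp (continuous_flow c)
    have h2 := continuous_flow (mult (dsymb i) c)
    exact continuous_const.mul (Complex.continuous_re.comp (h1.mul h2))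
  cont_dxx i := by
    have h1 := Complex.continuous_conj.comp (continuous_flow c)
    have h2 := continuous_flow (mult (dsymb i) c)
    have h3 := continuous_flow (mult (dsymb i) (mult (dsymb i) c))
    exact continuous_const.mul (Complex.continuous_re.comp
      (((Complex.continuous_conj.comp h2).mul h2).add (h1.mul h3)))

/-- For a solution of the heat equation the terms with `Δf` cancel in `(∂ₜ - Δ) |f|²`, leaving `-2
|∇f|²`; the gradient bound is `|∂ᵢ|f|²| ≤ 2 |f| |∂ᵢf|`. -/
theorem isCaloricSq_caloricJet (c : (Fin 2 → ℤ) →₀ ℂ) {ε : ℝ} (hε : 0 < ε) :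
    IsCaloricSq (caloricJet c ε) fun t x => ∑ i, ‖flow (mult (dsymb i) c) t x‖ ^ 2 where
  pos t x := by
    change 0 < ‖flow c t x‖ ^ 2 + ε
    positivity
  nonneg t x := by positivity
  heat t x := by
    have h1 : ∀ w : ℂ, ((starRingEnd ℂ) w * w).re = ‖w‖ ^ 2 := fun w => by
      rw [mul_comm, Complex.mul_conj, Complex.normSq_eq_norm_sq, Complex.ofReal_re]
    simp only [ParabolicJet.heat, caloricJet, flow_lsymb, Fin.sum_univ_two, Complex.add_re, h1,
      mul_add]
    ring
  gradSq t x := by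
    have h1 : ∀ w w' : ℂ, (2 * ((starRingEnd ℂ) w * w').re) ^ 2 ≤ 4 * ‖w‖ ^ 2 * ‖w'‖ ^ 2 := by
      intro w w'
      have h2 := Complex.abs_re_le_norm ((starRingEnd ℂ) w * w')
      rw [norm_mul, RCLike.norm_conj] at h2
      have h3 : ((starRingEnd ℂ) w * w').re ^ 2 ≤ (‖w‖ * ‖w'‖) ^ 2 := by
        rw [← sq_abs]; gcongr
      nlinarith
    change ∑ i, (2 * ((starRingEnd ℂ) (flow c t x) * flow (mult (dsymb i) c) t x).re) ^ 2 ≤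
      4 * (‖flow c t x‖ ^ 2 + ε) * ∑ i, ‖flow (mult (dsymb i) c) t x‖ ^ 2
    rw [Finset.mul_sum]
    refine Finset.sum_le_sum fun i _ => (h1 _ _).trans ?_
    gcongr
    linarith

end Flow

/-! ### The bound on second derivatives of trigonometric polynomials -/

section Riesz

/-- Compactness of the torus makes `y ↦ f y` continuous for the uniform norm. The parameter space
may be arbitrary, so it can be `C(Torus, ℂ)`. -/
theorem continuous_integral_of_continuous_uncurry {X E : Type*} [TopologicalSpace X]
    [NormedAddCommGroup E] [NormedSpace ℝ E] {f : X → Torus → E}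
    (h : Continuous (Function.uncurry f)) : Continuous fun y => ∫ x, f y x := by
  let F : X → C(Torus, E) := fun y => ⟨f y, h.comp (by fun_prop : Continuous fun x : Torus => (y, x))⟩
  have hF : Continuous F := ContinuousMap.continuous_of_continuous_uncurry F h
  have hI : LipschitzWith (Real.toNNReal ((volume : Measure Torus).real Set.univ))
      fun u : C(Torus, E) => ∫ x, u x := by
    refine LipschitzWith.of_dist_le_mul fun u v => ?_
    rw [dist_eq_norm, dist_eq_norm, Real.coe_toNNReal _ measureReal_nonneg,
      mul_comm ((volume : Measure Torus).real Set.univ),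
      ← integral_sub (integrable_of_continuous u.continuous) (integrable_of_continuous v.continuous)]
    exact norm_integral_le_of_norm_le_const
      (Filter.Eventually.of_forall fun x => (u - v).norm_coe_le_norm x)
  exact hI.continuous.comp hF

theorem continuous_flow_slice (c : (Fin 2 → ℤ) →₀ ℂ) (t : ℝ) : Continuous (flow c t) :=
  (flow c t).continuous

theorem continuous_conj_flow_slice (c : (Fin 2 → ℤ) →₀ ℂ) (t : ℝ) :
    Continuous fun x => (starRingEnd ℂ) (flow c t x) :=
  Complex.continuous_conj.comp (flow c t).continuous

theorem integral_flow_parts (i : Fin 2) (c d : (Fin 2 → ℤ) →₀ ℂ) (t : ℝ) :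
    ∫ x, flow (mult (dsymb i) c) t x * (starRingEnd ℂ) (flow d t x) =
      -∫ x, flow c t x * (starRingEnd ℂ) (flow (mult (dsymb i) d) t x) := by
  rw [integral_mul_partial (hasPartial_flow i c t) (hasPartial_flow i d t).conj
    (continuous_flow_slice _ t) (continuous_flow_slice _ t) (continuous_conj_flow_slice _ t)
    (continuous_conj_flow_slice _ t), neg_neg]

theorem integral_flow_lsymb (c d : (Fin 2 → ℤ) →₀ ℂ) (t : ℝ) :
    ∫ x, flow c t x * (starRingEnd ℂ) (flow (mult lsymb d) t x) =
      ∫ x, flow (mult lsymb c) t x * (starRingEnd ℂ) (flow d t x) := by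
  have hi : ∀ c d, Integrable fun x => flow c t x * (starRingEnd ℂ) (flow d t x) := fun c d =>
    integrable_of_continuous ((continuous_flow_slice c t).mul (continuous_conj_flow_slice d t))
  simp only [flow_lsymb, map_sum, Finset.mul_sum, Finset.sum_mul]
  rw [integral_finsetSum _ fun i _ => hi _ _, integral_finsetSum _ fun i _ => hi _ _]
  refine Finset.sum_congr rfl fun i _ => ?_
  rw [integral_flow_parts i (mult (dsymb i) c) d, integral_flow_parts i c, neg_neg]

/-- Symmetry of `Δ` makes the two contributions equal, and one integration by parts moves `∂ᵢ` onto
`g`. Only first derivatives of `Δc` and of `g` remain, the quantities that the Bellman function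
controls. -/
theorem hasDerivAt_integral_flow (i j : Fin 2) (c g : (Fin 2 → ℤ) →₀ ℂ) (t : ℝ) :
    HasDerivAt (fun s => ∫ x, flow (mult (dsymb i) (mult (dsymb j) c)) s x *
        (starRingEnd ℂ) (flow g s x))
      (-(2 * ∫ x, flow (mult (dsymb j) (mult lsymb c)) t x *
        (starRingEnd ℂ) (flow (mult (dsymb i) g) t x))) t := by
  set h := mult (dsymb i) (mult (dsymb j) c) with hh
  have h1 : ∀ t x, HasDerivAt (fun s => flow h s x * (starRingEnd ℂ) (flow g s x))
      (flow (mult lsymb h) t x * (starRingEnd ℂ) (flow g t x) +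
        flow h t x * (starRingEnd ℂ) (flow (mult lsymb g) t x)) t := fun t x =>
    (hasDerivAt_flow h t x).mul
      ((Complex.conjCLE : ℂ →L[ℝ] ℂ).hasFDerivAt.comp_hasDerivAt _ (hasDerivAt_flow g t x))
  have hcc : ∀ c d, Continuous fun q : ℝ × Torus => flow c q.1 q.2 *
      (starRingEnd ℂ) (flow d q.1 q.2) := fun c d =>
    (continuous_flow c).mul (Complex.continuous_conj.comp (continuous_flow d))
  have hi : ∀ c d, Integrable fun x => flow c t x * (starRingEnd ℂ) (flow d t x) := fun c d =>
    integrable_of_continuous ((continuous_flow_slice c t).mul (continuous_conj_flow_slice d t))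
  refine (hasDerivAt_integral_of_continuous h1
    (fun t => (continuous_flow_slice h t).mul (continuous_conj_flow_slice g t))
    ((hcc _ _).add (hcc _ _)) t).congr_deriv ?_
  rw [integral_add (hi _ _) (hi _ _), integral_flow_lsymb, ← two_mul, ← mul_neg,
    ← integral_flow_parts, hh, mult_comm lsymb, mult_comm lsymb]

theorem norm_le_sqrt_sum (w : Fin 2 → ℂ) (i : Fin 2) : ‖w i‖ ≤ Real.sqrt (∑ j, ‖w j‖ ^ 2) :=
  Real.le_sqrt_of_sq_le (Finset.single_le_sum (f := fun j => ‖w j‖ ^ 2)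
    (fun _ _ => sq_nonneg _) (Finset.mem_univ i))

/-- The bilinear embedding, regularized. -/
theorem norm_integral_le_regularized (i j : Fin 2) (c g : (Fin 2 → ℤ) →₀ ℂ) {P : ℝ} (hP : 2 ≤ P)
    {ε : ℝ} (hε : 0 < ε) :
    ‖∫ x, trig (mult (dsymb i) (mult (dsymb j) c)) x * (starRingEnd ℂ) (trig g x)‖ ≤
      2 / bellmanConst P * ∫ x, ((‖trig (mult lsymb c) x‖ ^ 2 + ε) ^ (P / 2) +
        (‖trig g x‖ ^ 2 + ε) ^ (P / (P - 1) / 2)) := by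
  set h := mult (dsymb i) (mult (dsymb j) c) with hh
  set f := mult lsymb c with hf
  set Φ : ℝ → ℂ := fun s => ∫ x, flow h s x * (starRingEnd ℂ) (flow g s x) with hΦ
  have ha := isCaloricSq_caloricJet f hε
  have hb := isCaloricSq_caloricJet g hε
  set J := bellman (caloricJet f ε) (caloricJet g ε) ha.pos hb.pos P with hJ
  set ψ : ℝ → ℝ := fun s => ∫ x, J.val s x with hψ
  have hc0 := bellmanConst_pos hP
  have hΦ' := fun t => hasDerivAt_integral_flow i j c g t
  have hbound : ∀ t, ‖-(2 * ∫ x, flow (mult (dsymb j) f) t x *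
      (starRingEnd ℂ) (flow (mult (dsymb i) g) t x))‖ ≤
      1 / bellmanConst P * (0 - ∫ x, J.heat t x) := by
    intro t
    have h1 : ‖∫ x, flow (mult (dsymb j) f) t x *
        (starRingEnd ℂ) (flow (mult (dsymb i) g) t x)‖ ≤
        ∫ x, 1 / (2 * bellmanConst P) * (-J.heat t x) := by
      refine norm_integral_le_of_norm_le
        (integrable_of_continuous (continuous_const.mul (J.continuous_heat t).neg))
        (Filter.Eventually.of_forall fun x => ?_)
      have h2 := heat_bellman_le ha hb hP t x
      rw [norm_mul, RCLike.norm_conj, one_div, ← div_eq_inv_mul, le_div_iff₀ (by positivity)]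
      have h3 := norm_le_sqrt_sum (fun j => flow (mult (dsymb j) f) t x) j
      have h4 := norm_le_sqrt_sum (fun j => flow (mult (dsymb j) g) t x) i
      calc _ ≤ (Real.sqrt (∑ j, ‖flow (mult (dsymb j) f) t x‖ ^ 2) *
            Real.sqrt (∑ j, ‖flow (mult (dsymb j) g) t x‖ ^ 2)) * (2 * bellmanConst P) := by
            gcongr
        _ ≤ _ := by linarith
    rw [integral_const_mul, integral_neg] at h1
    rw [norm_neg, norm_mul, Complex.norm_ofNat]
    calc _ ≤ 2 * (1 / (2 * bellmanConst P) * -∫ x, J.heat t x) := by gcongr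
      _ = _ := by field_simp; ring
  have hψ' := fun t => J.hasDerivAt_integral t
  have hψ0 : ∀ t, 0 ≤ ψ t := fun t =>
    integral_nonneg fun x => bellman_val_nonneg ha.pos hb.pos hP t x
  -- The rate of change of `Φ` is dominated by the rate at which the mass of the Bellman function
  -- decreases. Since `Φ` tends to 0 and the mass stays nonnegative, the initial mass bounds `Φ 0`.
  have hdiff : ∀ T, 0 ≤ T → ‖Φ T - Φ 0‖ ≤ 1 / bellmanConst P * (ψ 0 - ψ T) := by
    intro T hT
    have hd : ∀ t, HasDerivAt (fun s => Φ s - Φ 0) (-(2 * ∫ x, flow (mult (dsymb j) f) t x *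
      (starRingEnd ℂ) (flow (mult (dsymb i) g) t x))) t := fun t => (hΦ' t).sub_const _
    have hB : ∀ t, HasDerivAt (fun s => 1 / bellmanConst P * (ψ 0 - ψ s))
        (1 / bellmanConst P * (0 - ∫ x, J.heat t x)) t := fun t =>
      (((hasDerivAt_const t (ψ 0)).sub (hψ' t)).const_mul _)
    exact image_norm_le_of_norm_deriv_right_le_deriv_boundary (a := 0) (b := T)
      (fun t _ => (hd t).continuousAt.continuousWithinAt)
      (fun t _ => (hd t).hasDerivWithinAt) (by simp) hB (fun t _ => hbound t)
      (Set.right_mem_Icc.2 hT)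
  have hlim : Filter.Tendsto Φ Filter.atTop (𝓝 0) := by
    obtain ⟨l, hl⟩ := exists_tendsto_flow g
    have h1 := ((tendsto_flow_dsymb i (mult (dsymb j) c)).norm.mul hl.norm).mul_const
      ((volume : Measure Torus).real Set.univ)
    rw [norm_zero, zero_mul, zero_mul] at h1
    refine squeeze_zero_norm (fun t => norm_integral_le_of_norm_le_const
      (Filter.Eventually.of_forall fun x => ?_)) h1
    rw [norm_mul, RCLike.norm_conj]
    gcongr <;> exact ContinuousMap.norm_coe_le_norm _ _
  have hΦ0 : ‖Φ 0‖ ≤ 1 / bellmanConst P * ψ 0 := by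
    have h1 : Filter.Tendsto (fun T => ‖Φ T - Φ 0‖) Filter.atTop (𝓝 ‖0 - Φ 0‖) :=
      (hlim.sub_const _).norm
    rw [zero_sub, norm_neg] at h1
    refine le_of_tendsto h1 ?_
    filter_upwards [Filter.eventually_ge_atTop 0] with T hT
    refine (hdiff T hT).trans ?_
    gcongr
    linarith [hψ0 T]
  have hψle : ψ 0 ≤ 2 * ∫ x, ((‖trig f x‖ ^ 2 + ε) ^ (P / 2) +
      (‖trig g x‖ ^ 2 + ε) ^ (P / (P - 1) / 2)) := by
    rw [← integral_const_mul]
    have h1 : ∀ x, (bellmanBase (caloricJet f ε) (caloricJet g ε) ha.pos hb.pos P).val 0 x =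
        (‖trig f x‖ ^ 2 + ε) ^ (P / 2) + (‖trig g x‖ ^ 2 + ε) ^ (P / (P - 1) / 2) := fun x => by
      rw [← flow_zero, ← flow_zero]; rfl
    simp only [← h1]
    exact integral_mono (integrable_of_continuous (J.continuous_slice 0))
      (integrable_of_continuous (continuous_const.mul (ParabolicJet.continuous_slice _ 0)))
      fun x => bellman_val_le ha.pos hb.pos hP 0 x
  simp only [hΦ, flow_zero] at hΦ0
  refine hΦ0.trans ?_
  calc _ ≤ 1 / bellmanConst P * (2 * ∫ x, ((‖trig f x‖ ^ 2 + ε) ^ (P / 2) +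
      (‖trig g x‖ ^ 2 + ε) ^ (P / (P - 1) / 2))) := by gcongr
    _ = _ := by ring

theorem norm_integral_le_trig (i j : Fin 2) (c g : (Fin 2 → ℤ) →₀ ℂ) {P : ℝ} (hP : 2 ≤ P) :
    ‖∫ x, trig (mult (dsymb i) (mult (dsymb j) c)) x * (starRingEnd ℂ) (trig g x)‖ ≤
      2 / bellmanConst P * ∫ x, (‖trig (mult lsymb c) x‖ ^ P + ‖trig g x‖ ^ (P / (P - 1))) := by
  have hP1 : 0 < P - 1 := by linarith
  have hq : 0 ≤ P / (P - 1) / 2 := by positivity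
  have hc : Continuous fun q : ℝ × Torus => (‖trig (mult lsymb c) q.2‖ ^ 2 + |q.1|) ^ (P / 2) +
      (‖trig g q.2‖ ^ 2 + |q.1|) ^ (P / (P - 1) / 2) :=
    (Continuous.rpow_const (by fun_prop) fun _ => Or.inr (by positivity)).add
      (Continuous.rpow_const (by fun_prop) fun _ => Or.inr hq)
  have hi : Continuous fun ε : ℝ => ∫ x, ((‖trig (mult lsymb c) x‖ ^ 2 + |ε|) ^ (P / 2) +
      (‖trig g x‖ ^ 2 + |ε|) ^ (P / (P - 1) / 2)) := continuous_integral_of_continuous_uncurry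
      (f := fun ε x => (‖trig (mult lsymb c) x‖ ^ 2 + |ε|) ^ (P / 2) +
      (‖trig g x‖ ^ 2 + |ε|) ^ (P / (P - 1) / 2)) hc
  have key := ge_of_tendsto (x := 𝓝[>] (0 : ℝ))
    (((hi.tendsto 0).mono_left nhdsWithin_le_nhds).const_mul (2 / bellmanConst P)) (by
      filter_upwards [self_mem_nhdsWithin] with ε hε
      rw [abs_of_pos hε]
      exact norm_integral_le_regularized i j c g hP hε)
  have e : ∀ (w : ℂ) (s : ℝ), (‖w‖ ^ 2 + |(0 : ℝ)|) ^ (s / 2) = ‖w‖ ^ s := fun w s => by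
    rw [abs_zero, add_zero, ← Real.rpow_natCast, ← Real.rpow_mul (norm_nonneg _)]
    congr 1
    push_cast; ring
  simpa only [e] using key

/-- The dual function `|h|^{P-2} h` is continuous but in general not a trigonometric polynomial;
both sides are continuous in `g` for the uniform norm. -/
theorem norm_integral_le_continuous (i j : Fin 2) (c : (Fin 2 → ℤ) →₀ ℂ) (g : C(Torus, ℂ)) {P : ℝ}
    (hP : 2 ≤ P) :
    ‖∫ x, trig (mult (dsymb i) (mult (dsymb j) c)) x * (starRingEnd ℂ) (g x)‖ ≤
      2 / bellmanConst P * ∫ x, (‖trig (mult lsymb c) x‖ ^ P + ‖g x‖ ^ (P / (P - 1))) := by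
  have hP1 : 0 < P - 1 := by linarith
  have c1 : Continuous fun q : C(Torus, ℂ) × Torus =>
      trig (mult (dsymb i) (mult (dsymb j) c)) q.2 * (starRingEnd ℂ) (q.1 q.2) :=
    Continuous.mul (by fun_prop) (Complex.continuous_conj.comp (by fun_prop))
  have c2 : Continuous fun q : C(Torus, ℂ) × Torus =>
      ‖trig (mult lsymb c) q.2‖ ^ P + ‖q.1 q.2‖ ^ (P / (P - 1)) :=
    (Continuous.rpow_const (by fun_prop) fun _ => Or.inr (by positivity)).add
      (Continuous.rpow_const (by fun_prop) fun _ => Or.inr (by positivity))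
  have i1 : Continuous fun g : C(Torus, ℂ) =>
      ∫ x, trig (mult (dsymb i) (mult (dsymb j) c)) x * (starRingEnd ℂ) (g x) := continuous_integral_of_continuous_uncurry
      (f := fun (g : C(Torus, ℂ)) x =>
        trig (mult (dsymb i) (mult (dsymb j) c)) x * (starRingEnd ℂ) (g x)) c1
  have i2 : Continuous fun g : C(Torus, ℂ) =>
      ∫ x, (‖trig (mult lsymb c) x‖ ^ P + ‖g x‖ ^ (P / (P - 1))) := continuous_integral_of_continuous_uncurry
      (f := fun (g : C(Torus, ℂ)) x =>
        ‖trig (mult lsymb c) x‖ ^ P + ‖g x‖ ^ (P / (P - 1))) c2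
  exact denseRange_trig.induction_on (p := fun g : C(Torus, ℂ) =>
    ‖∫ x, trig (mult (dsymb i) (mult (dsymb j) c)) x * (starRingEnd ℂ) (g x)‖ ≤
      2 / bellmanConst P * ∫ x, (‖trig (mult lsymb c) x‖ ^ P + ‖g x‖ ^ (P / (P - 1)))) g
    (isClosed_le i1.norm (continuous_const.mul i2)) fun g => norm_integral_le_trig i j c g hP

/-- The second derivatives of a trigonometric polynomial are bounded by its Laplacian. -/
theorem norm_second_derivative_trig_le {p : ℝ≥0∞} [Fact (1 ≤ p)] (hp2 : 2 ≤ p) (hp : p ≠ ⊤)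
    (i j : Fin 2) (c : (Fin 2 → ℤ) →₀ ℂ) :
    ‖trigLp p (mult (dsymb i) (mult (dsymb j) c))‖ ≤
      4 / bellmanConst p.toReal * ‖trigLp p (mult lsymb c)‖ := by
  have hP : 2 ≤ p.toReal := by simpa using ENNReal.toReal_mono hp hp2
  have hN := norm_trigLp_rpow p hp (mult (dsymb i) (mult (dsymb j) c))
  have hF := norm_trigLp_rpow p hp (mult lsymb c)
  set P := p.toReal with hPdef
  have hP1 : 0 < P - 1 := by linarith
  set h := trig (mult (dsymb i) (mult (dsymb j) c)) with hh
  set f := trig (mult lsymb c) with hf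
  have hc0 := bellmanConst_pos hP
  set K := 2 / bellmanConst P with hK
  have hK0 : 0 < K := by positivity
  -- The embedding is not homogeneous, so the test function is scaled: `μ` solves `K μ^q = μ / 2`,
  -- which lets the `h` term on the right be absorbed. What remains is `N^P ≤ (2 K / μ) F^P = (2 K
  -- F)^P`.
  set μ : ℝ := (1 / (2 * K)) ^ (P - 1) with hμ
  have hμ0 : 0 < μ := by positivity
  have hμq : K * μ ^ (P / (P - 1)) = μ / 2 := by
    have e1 : P / (P - 1) = 1 + 1 / (P - 1) := by field_simp; ring
    rw [e1, Real.rpow_add hμ0, Real.rpow_one, hμ, ← Real.rpow_mul (by positivity),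
      mul_one_div_cancel hP1.ne', Real.rpow_one]
    field_simp
  let g : C(Torus, ℂ) := ⟨fun x => ((μ * ‖h x‖ ^ (P - 2) : ℝ) : ℂ) * h x,
    (Complex.continuous_ofReal.comp (continuous_const.mul
      (h.continuous.norm.rpow_const fun _ => Or.inr (by linarith)))).mul h.continuous⟩
  have key : ‖∫ x, h x * (starRingEnd ℂ) (g x)‖ ≤
      K * ∫ x, (‖f x‖ ^ P + ‖g x‖ ^ (P / (P - 1))) := norm_integral_le_continuous i j c g hP
  have hpow : ∀ x, ‖h x‖ ^ (P - 2) * ‖h x‖ = ‖h x‖ ^ (P - 1) := fun x => by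
    nth_rw 2 [← Real.rpow_one ‖h x‖]
    rw [← Real.rpow_add_of_nonneg (norm_nonneg _) (by linarith) (by norm_num)]
    congr 1; ring
  have hpow2 : ∀ x, ‖h x‖ ^ (P - 1) * ‖h x‖ = ‖h x‖ ^ P := fun x => by
    nth_rw 2 [← Real.rpow_one ‖h x‖]
    rw [← Real.rpow_add_of_nonneg (norm_nonneg _) (by linarith) (by norm_num)]
    congr 1; ring
  have e1 : ∀ x, h x * (starRingEnd ℂ) (g x) = ((μ * ‖h x‖ ^ P : ℝ) : ℂ) := fun x => by
    have : h x * (starRingEnd ℂ) (h x) = ((‖h x‖ * ‖h x‖ : ℝ) : ℂ) := by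
      rw [Complex.mul_conj, Complex.normSq_eq_norm_sq, sq]
    change h x * (starRingEnd ℂ) (((μ * ‖h x‖ ^ (P - 2) : ℝ) : ℂ) * h x) = _
    rw [map_mul, Complex.conj_ofReal, mul_left_comm, this, ← Complex.ofReal_mul, ← hpow2, ← hpow]
    congr 1; ring
  have e2 : ∀ x, ‖g x‖ ^ (P / (P - 1)) = μ ^ (P / (P - 1)) * ‖h x‖ ^ P := fun x => by
    change ‖((μ * ‖h x‖ ^ (P - 2) : ℝ) : ℂ) * h x‖ ^ (P / (P - 1)) = _
    rw [norm_mul, Complex.norm_real, Real.norm_of_nonneg (by positivity), mul_assoc, hpow,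
      Real.mul_rpow hμ0.le (by positivity), ← Real.rpow_mul (norm_nonneg _)]
    congr 2
    field_simp
  have ci : ∀ u : C(Torus, ℂ), Integrable fun x => ‖u x‖ ^ P := fun u =>
    integrable_of_continuous (u.continuous.norm.rpow_const fun _ => Or.inr (by linarith))
  simp only [e1, e2] at key
  rw [integral_complex_ofReal, Complex.norm_real, integral_const_mul,
    integral_add (ci f) ((ci h).const_mul _), integral_const_mul, ← hN, ← hF,
    Real.norm_of_nonneg (by positivity), mul_add, ← mul_assoc K (μ ^ _), hμq] at key
  set N := ‖trigLp p (mult (dsymb i) (mult (dsymb j) c))‖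
  set F := ‖trigLp p (mult lsymb c)‖
  have h1 : N ^ P ≤ (2 * K * F) ^ P := by
    have e3 : (2 * K) ^ P * μ = 2 * K := by
      rw [hμ, one_div, Real.inv_rpow (by positivity), ← Real.rpow_neg (by positivity),
        ← Real.rpow_add (by positivity), show P + -(P - 1) = 1 by ring, Real.rpow_one]
    rw [Real.mul_rpow (by positivity) (norm_nonneg _)]
    refine le_of_mul_le_mul_left (a := μ) ?_ hμ0
    calc μ * N ^ P ≤ 2 * K * F ^ P := by linarith
      _ = (2 * K) ^ P * μ * F ^ P := by rw [e3]
      _ = _ := by ring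
  have h2 := (Real.rpow_le_rpow_iff (norm_nonneg _) (by positivity) (by linarith)).1 h1
  refine h2.trans (le_of_eq ?_)
  rw [hK]; ring

end Riesz

/-! ### First derivatives of trigonometric polynomials -/

section Translation

theorem trig_translate (i : Fin 2) (s : ℝ) (c : (Fin 2 → ℤ) →₀ ℂ) (x : Torus) :
    trig (mult (fun k => Complex.exp (Complex.I * k i * s)) c) x = trig c (shift i x s) := by
  induction c using Finsupp.induction_linear with
  | zero => simp
  | add f g hf hg => simp only [map_add, ContinuousMap.add_apply, hf, hg]
  | single k c =>
    simp only [mult_single, trig_single, ContinuousMap.coe_smul, Pi.smul_apply, smul_eq_mul,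
      char_shift]
    ring

variable {p : ℝ≥0∞} [Fact (1 ≤ p)]

theorem norm_trigLp_translate (hp : p ≠ ⊤) (i : Fin 2) (s : ℝ) (c : (Fin 2 → ℤ) →₀ ℂ) :
    ‖trigLp p (mult (fun k => Complex.exp (Complex.I * k i * s)) c)‖ = ‖trigLp p c‖ := by
  have hp1 : (1 : ℝ≥0∞) ≤ p := Fact.out
  have hpos : 0 < p.toReal := ENNReal.toReal_pos (zero_lt_one.trans_le hp1).ne' hp
  refine (Real.rpow_left_inj (norm_nonneg _) (norm_nonneg _) hpos.ne').1 ?_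
  rw [norm_trigLp_rpow p hp, norm_trigLp_rpow p hp]
  simp only [trig_translate]
  exact integral_add_right_eq_self (fun x => ‖trig c x‖ ^ p.toReal) _

theorem hasDerivAt_trigLp_translate (i : Fin 2) (c : (Fin 2 → ℤ) →₀ ℂ) (s : ℝ) :
    HasDerivAt (fun s : ℝ => trigLp p (mult (fun k => Complex.exp (Complex.I * k i * s)) c))
      (trigLp p (mult (fun k => Complex.exp (Complex.I * k i * s)) (mult (dsymb i) c))) s := by
  induction c using Finsupp.induction_linear with
  | zero => simpa using hasDerivAt_const s (0 : LpT p)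
  | add f g hf hg =>
    simp only [map_add]
    exact hf.add hg
  | single k c =>
    have h1 := ((Complex.ofRealCLM.hasDerivAt (x := s)).const_mul (Complex.I * k i)).cexp
    have h2 := h1.smul_const (c • trigLp p (Finsupp.single k 1))
    have e : ∀ a : ℂ, trigLp p (Finsupp.single k a) = a • trigLp p (Finsupp.single k 1) := fun a => by
      rw [← map_smul, Finsupp.smul_single_one]
    simp only [mult_single]
    simp only [e (_ * _), mul_smul] at h2 ⊢
    refine h2.congr_deriv ?_
    simp only [smul_smul, dsymb, Complex.ofRealCLM_apply, Complex.ofReal_one]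
    congr 1
    ring

/-- First-order Taylor expansion of the translation group over unit time. Translations are
isometries of `L^p`, so the increment costs `2 ‖u‖` and the remainder at most `‖∂ᵢ²u‖`. -/
theorem norm_first_derivative_trig_le (hp : p ≠ ⊤) (i : Fin 2) (c : (Fin 2 → ℤ) →₀ ℂ) :
    ‖trigLp p (mult (dsymb i) c)‖ ≤
      2 * ‖trigLp p c‖ + ‖trigLp p (mult (dsymb i) (mult (dsymb i) c))‖ := by
  let τ : ((Fin 2 → ℤ) →₀ ℂ) → ℝ → LpT p := fun c s =>
    trigLp p (mult (fun k => Complex.exp (Complex.I * k i * s)) c)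
  have hτ : ∀ c s, HasDerivAt (τ c) (τ (mult (dsymb i) c) s) s := fun c s =>
    hasDerivAt_trigLp_translate i c s
  have hn : ∀ c s, ‖τ c s‖ = ‖trigLp p c‖ := fun c s => norm_trigLp_translate hp i s c
  have h0 : ∀ c, τ c 0 = trigLp p c := fun c => by simp [τ, mult_const]
  have h1 : ∀ s ∈ Set.Icc (0 : ℝ) 1, ‖τ (mult (dsymb i) c) s - τ (mult (dsymb i) c) 0‖ ≤
      ‖trigLp p (mult (dsymb i) (mult (dsymb i) c))‖ := by
    intro s hs
    have := norm_image_sub_le_of_norm_deriv_le_segment' (f := τ (mult (dsymb i) c)) (a := 0) (b := 1)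
      (fun t _ => (hτ _ t).hasDerivWithinAt) (fun t _ => (hn _ t).le) s hs
    refine this.trans (mul_le_of_le_one_right (norm_nonneg _) ?_)
    linarith [hs.2]
  have h2 := norm_image_sub_le_of_norm_deriv_le_segment_01'
    (f := fun s : ℝ => τ c s - s • τ (mult (dsymb i) c) 0)
    (f' := fun s => τ (mult (dsymb i) c) s - (1 : ℝ) • τ (mult (dsymb i) c) 0)
    (fun t _ => ((hτ c t).sub ((hasDerivAt_id t).smul_const _)).hasDerivWithinAt)
    (fun t ht => by rw [one_smul]; exact h1 t ⟨ht.1, ht.2.le⟩)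
  simp only [one_smul, zero_smul, sub_zero] at h2
  have h3 : τ (mult (dsymb i) c) 0 = τ c 1 - τ c 0 -
      (τ c 1 - τ (mult (dsymb i) c) 0 - τ c 0) := by abel
  rw [← h0 (mult (dsymb i) c), h3]
  refine (norm_sub_le _ _).trans ?_
  refine add_le_add ((norm_sub_le _ _).trans ?_) h2
  rw [hn, hn]
  linarith

end Translation

/-! ### Solving `z u - Δ u = f` in `W^{2,p}` -/

section Solve

variable {p : ℝ≥0∞} [Fact (1 ≤ p)]

theorem IsWeakPartial.of_tendsto {i : Fin 2} {f g : ℕ → LpT p} {f' g' : LpT p}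
    (h : ∀ n, IsWeakPartial i (f n) (g n)) (hf : Filter.Tendsto f Filter.atTop (𝓝 f'))
    (hg : Filter.Tendsto g Filter.atTop (𝓝 g')) : IsWeakPartial i f' g' := by
  intro φ hφ
  have h1 := ((continuous_pairing (p := p) (hφ.continuous_partialDeriv i)).tendsto f').comp hf
  have h2 := (((continuous_pairing (p := p) hφ.continuous).tendsto g').comp hg).neg
  refine tendsto_nhds_unique h1 (h2.congr fun n => ?_)
  exact (h n φ hφ).symm

theorem exists_tendsto_of_norm_le {T : ((Fin 2 → ℤ) →₀ ℂ) →ₗ[ℂ] LpT p} {C : ℝ}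
    (hT : ∀ c, ‖T c‖ ≤ C * ‖trigLp p c‖) {c : ℕ → (Fin 2 → ℤ) →₀ ℂ}
    (hc : CauchySeq fun n => trigLp p (c n)) :
    ∃ l, Filter.Tendsto (fun n => T (c n)) Filter.atTop (𝓝 l) := by
  refine cauchySeq_tendsto_of_complete ?_
  rw [cauchySeq_iff_tendsto_dist_atTop_0] at hc ⊢
  refine squeeze_zero (fun _ => dist_nonneg) (fun n => ?_) (by simpa using hc.const_mul C)
  rw [dist_eq_norm, dist_eq_norm, ← map_sub, ← map_sub]
  exact hT _

/-! ### Fourier coefficients of weak derivatives, and uniqueness. -/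

theorem isSmooth_char (k : Fin 2 → ℤ) : IsSmooth (E := ℂ) (char k) := by
  have : (fun v : Fin 2 → ℝ => char k (cover v)) =
      fun v => ∏ j, Complex.exp (Complex.I * k j * v j) := by
    funext v
    rw [char_apply]
    refine Finset.prod_congr rfl fun j _ => ?_
    have hpi : (Real.pi : ℂ) ≠ 0 := by exact_mod_cast Real.pi_ne_zero
    rw [cover, fourier_coe_apply]
    congr 1
    push_cast
    field_simp
  change ContDiff ℝ ∞ (fun v : Fin 2 → ℝ => char k (cover v))
  rw [this]
  exact contDiff_prod fun j _ =>
    (contDiff_const.mul (Complex.ofRealCLM.contDiff.comp (contDiff_apply ℝ ℝ j))).cexp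

theorem partialDeriv_char (i : Fin 2) (k : Fin 2 → ℤ) (x : Torus) :
    partialDeriv i (char k) x = dsymb i k * char k x := by
  have h := (hasPartial_trig i (Finsupp.single k 1) x).deriv
  simp only [trig_single, mult_single, one_smul, mul_one, ContinuousMap.coe_smul, Pi.smul_apply,
    smul_eq_mul] at h
  exact h

theorem IsWeakPartial.integral_char {p : ℝ≥0∞} {i : Fin 2} {f g : LpT p} (h : IsWeakPartial i f g)
    (k : Fin 2 → ℤ) : ∫ x, g x * char k x = -(dsymb i k * ∫ x, f x * char k x) := by
  have h1 := h (char k) (isSmooth_char k)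
  rw [← integral_const_mul, ← neg_eq_iff_eq_neg, ← h1]
  congr 1
  funext x
  rw [partialDeriv_char]; ring

theorem eq_zero_of_integral_char {w : LpT p} (h : ∀ k, ∫ x, w x * char k x = 0) : w = 0 := by
  have hw := integrable_LpT w
  have h1 : ∀ c : (Fin 2 → ℤ) →₀ ℂ, ∫ x, w x * trig c x = 0 := by
    intro c
    induction c using Finsupp.induction_linear with
    | zero => simp
    | add f g hf hg =>
      simp only [map_add, ContinuousMap.add_apply, mul_add]
      rw [integral_add (integrable_mul hw (trig f).continuous)
        (integrable_mul hw (trig g).continuous), hf, hg, add_zero]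
    | single k c =>
      have e : ∀ x, w x * trig (Finsupp.single k c) x = c * (w x * char k x) := fun x => by
        simp; ring
      simp only [e]
      rw [integral_const_mul, h, mul_zero]
  have hcont : Continuous fun φ : C(Torus, ℂ) => ∫ x, w x * φ x := by
    refine LipschitzWith.continuous (K := Real.toNNReal (∫ x, ‖w x‖))
      (LipschitzWith.of_dist_le_mul fun u v => ?_)
    rw [dist_eq_norm, dist_eq_norm, Real.coe_toNNReal _ (integral_nonneg fun _ => norm_nonneg _),
      ← integral_sub (integrable_mul hw u.continuous) (integrable_mul hw v.continuous),
      ← integral_mul_const]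
    refine norm_integral_le_of_norm_le (hw.norm.mul_const _)
      (Filter.Eventually.of_forall fun x => ?_)
    rw [← mul_sub, norm_mul]
    exact mul_le_mul_of_nonneg_left ((u - v).norm_coe_le_norm x) (norm_nonneg _)
  have h2 : ∀ φ : C(Torus, ℂ), ∫ x, w x * φ x = 0 := fun φ =>
    denseRange_trig.induction_on (p := fun φ : C(Torus, ℂ) => ∫ x, w x * φ x = 0) φ
      (isClosed_eq hcont continuous_const) h1
  have h3 := ae_zero_of_forall_smooth hw fun φ hφ => h2 ⟨φ, hφ.continuous⟩
  exact (Lp.eq_zero_iff_ae_eq_zero).2 h3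

theorem integral_laplacian_char (u : W2 p) (k : Fin 2 → ℤ) :
    ∫ x, (∑ i, secondDeriv p i i u : LpT p) x * char k x = lsymb k * ∫ x, (u : LpT p) x * char k x := by
  obtain ⟨G, hG1, hG2⟩ := hessian_spec u
  have e1 : ∀ i, ∫ x, secondDeriv p i i u x * char k x =
      dsymb i k * dsymb i k * ∫ x, (u : LpT p) x * char k x := fun i => by
    have h1 := (hG2 i i).integral_char k
    rw [(hG1 i).integral_char k] at h1
    exact h1.trans (by ring)
  have e2 : ∫ x, (∑ i, secondDeriv p i i u : LpT p) x * char k x =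
      ∑ i, ∫ x, secondDeriv p i i u x * char k x := by
    rw [← integral_finsetSum _ fun i _ => integrable_mul (integrable_LpT _) (char k).continuous]
    refine integral_congr_ae ?_
    rw [Fin.sum_univ_two]
    filter_upwards [Lp.coeFn_add (secondDeriv p 0 0 u) (secondDeriv p 1 1 u)] with x hx
    rw [hx, Pi.add_apply, Fin.sum_univ_two, add_mul]
  rw [e2, lsymb, Finset.sum_mul]
  exact Finset.sum_congr rfl fun i _ => e1 i

/-- Every Fourier coefficient of `u` is multiplied by `z + |k|²`, which has positive real part. -/
theorem eq_zero_of_sub_laplacian {u : W2 p} {z : ℂ} (hz : 0 < z.re)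
    (h : z • (u : LpT p) - ∑ i, secondDeriv p i i u = 0) : u = 0 := by
  refine Subtype.ext (eq_zero_of_integral_char fun k => ?_)
  have h1 := integral_laplacian_char u k
  rw [← sub_eq_zero.1 h] at h1
  have h2 : ∫ x, (z • (u : LpT p) : LpT p) x * char k x = z * ∫ x, (u : LpT p) x * char k x := by
    rw [← integral_const_mul]
    refine integral_congr_ae ?_
    filter_upwards [Lp.coeFn_smul z (u : LpT p)] with x hx
    rw [hx, Pi.smul_apply, smul_eq_mul, mul_assoc]
  rw [h2, ← sub_eq_zero, ← sub_mul] at h1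
  refine (mul_eq_zero.1 h1).resolve_left fun h3 => ?_
  have h4 := congrArg Complex.re h3
  rw [lsymb_eq] at h4
  simp at h4
  linarith [nsq_nonneg k]

/-- `u` and its second derivatives are the limits of trigonometric polynomials and of their second
derivatives. -/
def IsTrigLimit (d : ℕ → (Fin 2 → ℤ) →₀ ℂ) (u : W2 p) : Prop :=
  Filter.Tendsto (fun n => trigLp p (d n)) Filter.atTop (𝓝 (u : LpT p)) ∧
    ∀ i j, Filter.Tendsto (fun n => trigLp p (mult (dsymb j) (mult (dsymb i) (d n)))) Filter.atTop
      (𝓝 (secondDeriv p i j u))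

theorem IsTrigLimit.tendsto_laplacian {d : ℕ → (Fin 2 → ℤ) →₀ ℂ} {u : W2 p} (h : IsTrigLimit d u) :
    Filter.Tendsto (fun n => trigLp p (mult lsymb (d n))) Filter.atTop
      (𝓝 (∑ i, secondDeriv p i i u)) := by
  simp only [mult_lsymb, map_sum]
  exact tendsto_finsetSum _ fun i _ => h.2 i i

theorem IsTrigLimit.tendsto_resolvent {d : ℕ → (Fin 2 → ℤ) →₀ ℂ} {u : W2 p} (h : IsTrigLimit d u)
    (z : ℂ) : Filter.Tendsto (fun n => trigLp p (z • d n - mult lsymb (d n))) Filter.atTop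
      (𝓝 (z • (u : LpT p) - ∑ i, secondDeriv p i i u)) := by
  simp only [map_sub, map_smul]
  exact (h.1.const_smul z).sub h.tendsto_laplacian

/-- For trigonometric data the solution is the multiplier `(z + |k|²)⁻¹`. The bounds on `u`, its
first and its second derivatives make all of these Cauchy along approximating data, and weak
derivatives pass to `L^p` limits. -/
theorem exists_isTrigLimit_solution (hp2 : 2 ≤ p) (hp : p ≠ ⊤) {z : ℂ} (hz : 0 < z.re) (f : LpT p) :
    ∃ (d : ℕ → (Fin 2 → ℤ) →₀ ℂ) (u : W2 p), IsTrigLimit d u ∧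
      z • (u : LpT p) - ∑ i, secondDeriv p i i u = f := by
  have hz0 : 0 < ‖z‖ := norm_pos_iff.2 fun h => by simp [h] at hz
  obtain ⟨c, hc, hlim⟩ := mem_closure_iff_seq_limit.1 (denseRange_trigLp p hp f)
  choose b hb using hc
  have hcb : c = fun n => trigLp p (b n) := funext fun n => (hb n).symm
  rw [hcb] at hlim
  let m : (Fin 2 → ℤ) → ℂ := fun k => (z - lsymb k)⁻¹
  have hm : ∀ k, z - lsymb k ≠ 0 := fun k h => by
    have := congrArg Complex.re h
    rw [lsymb_eq] at this
    simp at this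
    linarith [nsq_nonneg k]
  have hinv : ∀ c, z • mult m c - mult lsymb (mult m c) = c := by
    intro c
    induction c using Finsupp.induction_linear with
    | zero => simp
    | add f g hf hg =>
      nth_rewrite 3 [← hf, ← hg]
      simp only [map_add, smul_add]
      abel
    | single k a =>
      simp only [mult_single, Finsupp.smul_single, smul_eq_mul, ← Finsupp.single_sub]
      congr 1
      have := hm k
      simp only [m]
      field_simp
  set C := resolventConst p with hC
  have hC0 : 0 ≤ C := Real.sqrt_nonneg _
  have b0 : ∀ c, ‖trigLp p (mult m c)‖ ≤ C / ‖z‖ * ‖trigLp p c‖ := fun c => by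
    have := resolvent_estimate_trig hp2 hp hz.le (mult m c)
    rw [hinv, mul_comm] at this
    rw [div_mul_eq_mul_div, le_div_iff₀ hz0]
    exact this
  have bl : ∀ c, ‖trigLp p (mult lsymb (mult m c))‖ ≤ (C + 1) * ‖trigLp p c‖ := fun c => by
    have e : mult lsymb (mult m c) = z • mult m c - c := by
      nth_rewrite 3 [← hinv c]; abel
    rw [e, map_sub, map_smul]
    refine (norm_sub_le _ _).trans ?_
    rw [norm_smul, add_mul, one_mul]
    have := b0 c
    rw [div_mul_eq_mul_div, le_div_iff₀ hz0] at this
    linarith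
  set K := 4 / bellmanConst p.toReal with hK
  have hP : 2 ≤ p.toReal := by simpa using ENNReal.toReal_mono hp hp2
  have hK0 : 0 ≤ K := by have := bellmanConst_pos hP; positivity
  have b2 : ∀ i j c, ‖trigLp p (mult (dsymb j) (mult (dsymb i) (mult m c)))‖ ≤
      K * (C + 1) * ‖trigLp p c‖ := fun i j c => by
    refine (norm_second_derivative_trig_le hp2 hp j i _).trans ?_
    rw [mul_assoc]
    gcongr
    exact bl c
  have b1 : ∀ i c, ‖trigLp p (mult (dsymb i) (mult m c))‖ ≤
      (2 * (C / ‖z‖) + K * (C + 1)) * ‖trigLp p c‖ := fun i c => by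
    refine (norm_first_derivative_trig_le hp i _).trans ?_
    linarith [b0 c, b2 i i c]
  have hcau := hlim.cauchySeq
  obtain ⟨u, hu⟩ := exists_tendsto_of_norm_le (T := trigLp p ∘ₗ mult m) b0 hcau
  choose G hG using fun i => exists_tendsto_of_norm_le
    (T := trigLp p ∘ₗ mult (dsymb i) ∘ₗ mult m) (b1 i) hcau
  choose H hH using fun i j => exists_tendsto_of_norm_le
    (T := trigLp p ∘ₗ mult (dsymb j) ∘ₗ mult (dsymb i) ∘ₗ mult m) (b2 i j) hcau
  have hw : HasWeakDerivs u G H :=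
    ⟨fun i => IsWeakPartial.of_tendsto (fun n => isWeakPartial_trigLp p i _) hu (hG i),
      fun i j => IsWeakPartial.of_tendsto (fun n => isWeakPartial_trigLp p j _) (hG i) (hH i j)⟩
  let U : W2 p := ⟨u, G, H, hw⟩
  have hU : hessian U = H := hessian_eq (f := U) hw
  have hlimit : IsTrigLimit (fun n => mult m (b n)) U := by
    refine ⟨hu, fun i j => ?_⟩
    change Filter.Tendsto _ _ (𝓝 (hessian U i j))
    rw [hU]
    exact hH i j
  refine ⟨_, U, hlimit, ?_⟩
  refine tendsto_nhds_unique (hlimit.tendsto_resolvent z) ?_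
  simpa only [hinv] using hlim

/-- Solve `v - Δv = u - Δu` by a trigonometric limit; uniqueness gives `v = u`. The sequence does
not depend on `z`, so the resolvent estimate also reaches `Re z = 0`. -/
theorem exists_isTrigLimit (hp2 : 2 ≤ p) (hp : p ≠ ⊤) (u : W2 p) :
    ∃ d : ℕ → (Fin 2 → ℤ) →₀ ℂ, IsTrigLimit d u := by
  obtain ⟨d, v, hd, hv⟩ := exists_isTrigLimit_solution hp2 hp (z := 1) (by simp)
    ((1 : ℂ) • (u : LpT p) - ∑ i, secondDeriv p i i u)
  have h : v - u = 0 := by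
    refine eq_zero_of_sub_laplacian (z := 1) (by simp) ?_
    simp only [map_sub, Finset.sum_sub_distrib, Submodule.coe_sub, smul_sub]
    rw [← sub_eq_zero.2 hv]
    abel
  rw [sub_eq_zero.1 h] at hd
  exact ⟨d, hd⟩

/-- The resolvent estimate for the Laplacian on `W^{2,p}`. -/
theorem resolvent_estimate (hp2 : 2 ≤ p) (hp : p ≠ ⊤) {z : ℂ} (hz : 0 ≤ z.re) (u : W2 p) :
    ‖z‖ * ‖(u : LpT p)‖ ≤
      resolventConst p * ‖z • (u : LpT p) - ∑ i, secondDeriv p i i u‖ := by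
  obtain ⟨d, hd⟩ := exists_isTrigLimit hp2 hp u
  exact le_of_tendsto_of_tendsto' (hd.1.norm.const_mul _)
    ((hd.tendsto_resolvent z).norm.const_mul _) fun n => resolvent_estimate_trig hp2 hp hz (d n)

theorem norm_secondDeriv_le (hp2 : 2 ≤ p) (hp : p ≠ ⊤) (i j : Fin 2) (u : W2 p) :
    ‖secondDeriv p i j u‖ ≤
      4 / bellmanConst p.toReal * ‖(∑ i, secondDeriv p i i u : LpT p)‖ := by
  obtain ⟨d, hd⟩ := exists_isTrigLimit hp2 hp u
  exact le_of_tendsto_of_tendsto' (hd.2 i j).norm (hd.tendsto_laplacian.norm.const_mul _)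
    fun n => norm_second_derivative_trig_le hp2 hp j i (d n)

end Solve

/-! ### The operators on `L^p` -/

section Operators

variable {p : ℝ≥0∞} [Fact (1 ≤ p)]

theorem laplaceOp_apply (ν : ℝ) (u : W2 p) :
    laplaceOp ν p u = (ν : ℂ) • ∑ i, secondDeriv p i i u := by
  change ((ν : ℂ) • ∑ i, secondDeriv p i i) u = _
  rw [LinearMap.smul_apply, LinearMap.sum_apply]

theorem dense_W2 (hp : p ≠ ⊤) : Dense (W2 p : Set (LpT p)) := by
  refine (denseRange_trigLp p hp).mono ?_
  rintro _ ⟨c, rfl⟩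
  exact ⟨fun i => trigLp p (mult (dsymb i) c), fun i j => trigLp p (mult (dsymb j) (mult (dsymb i) c)),
    fun i => isWeakPartial_trigLp p i c, fun i j => isWeakPartial_trigLp p j _⟩

/-- Writing `z - νΔ = ν (z/ν - Δ)` shows that the constant does not depend on ν. -/
theorem resolventBound_laplaceOp (hp2 : 2 ≤ p) (hp : p ≠ ⊤) {ν : ℝ} (hν : 0 < ν) :
    ResolventBound (laplaceOp ν p) (resolventConst p) := by
  intro z hz
  have hν' : (ν : ℂ) ≠ 0 := by exact_mod_cast hν.ne'
  have hre : 0 < (z / ν).re := by rw [Complex.div_ofReal_re]; positivity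
  have e : ∀ u : W2 p, z • (u : LpT p) - laplaceOp ν p u =
      (ν : ℂ) • ((z / ν) • (u : LpT p) - ∑ i, secondDeriv p i i u) := fun u => by
    rw [laplaceOp_apply, smul_sub, smul_smul, mul_div_cancel₀ _ hν']
  constructor
  · intro u
    have h := resolvent_estimate hp2 hp hre.le u
    rw [e u, norm_smul, Complex.norm_real, Real.norm_of_nonneg hν.le]
    rw [norm_div, Complex.norm_real, Real.norm_of_nonneg hν.le, div_mul_eq_mul_div,
      div_le_iff₀ hν] at h
    linarith
  · intro y
    obtain ⟨_, u, _, hu⟩ := exists_isTrigLimit_solution hp2 hp hre ((ν : ℂ)⁻¹ • y)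
    refine ⟨u, ?_⟩
    rw [e u, hu, smul_inv_smul₀ hν']

theorem generates_laplaceOp_add (hp2 : 2 ≤ p) (hp : p ≠ ⊤) {ν : ℝ} (hν : 0 < ν)
    (B : LpT p →ₗ.[ℂ] LpT p) (hB : W2 p ≤ B.domain) {a : ℝ} (ha : 0 ≤ a) (haδ : a ≤ threshold p)
    (hBa : ∀ f : W2 p, ‖B ⟨f, hB f.2⟩‖ ≤ a * ‖laplaceOp ν p f‖) :
    GeneratesBoundedAnalyticSemigroup (laplaceOp ν p + B) := by
  have hC : 0 ≤ resolventConst p := Real.sqrt_nonneg _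
  have h1 : a * (1 + resolventConst p) ≤ 1 / 2 := by
    calc a * (1 + resolventConst p) ≤ threshold p * (1 + resolventConst p) := by gcongr
      _ = 1 / 2 := by rw [threshold]; field_simp
  have h2 := ResolventBound.add (resolventBound_laplaceOp hp2 hp hν) hC hB ha h1 hBa
  refine h2.generates (by positivity) ?_
  have h3 : (laplaceOp ν p + B).domain = W2 p := inf_eq_left.2 hB
  rw [h3]
  exact dense_W2 hp

theorem norm_mulOp_le {p : ℝ≥0∞} (a : C(Torus, ℝ)) (f : LpT p) : ‖mulOp p a f‖ ≤ ‖a‖ * ‖f‖ := by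
  have hle : ∀ x, ‖(a x : ℂ) * f x‖ ≤ ‖a‖ * ‖f x‖ := fun x => by
    rw [norm_mul, Complex.norm_real]
    exact mul_le_mul_of_nonneg_right (a.norm_coe_le_norm x) (norm_nonneg _)
  have hm : MemLp (fun x => (a x : ℂ) * f x) p volume :=
    MemLp.of_le_mul (c := ‖a‖) (Lp.memLp f)
      ((Complex.continuous_ofReal.comp a.continuous).aestronglyMeasurable.mul
        (Lp.aestronglyMeasurable f)) (Filter.Eventually.of_forall hle)
  have h : mulOp p a f =ᵐ[volume] fun x => (a x : ℂ) * f x := hm.coeFn_toLp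
  refine Lp.norm_le_mul_norm_of_ae_le_mul ?_
  filter_upwards [h] with x hx
  rw [hx]
  exact hle x

theorem NoiseFamily.norm_covariance_le (S : NoiseFamily) (i j : Fin 2) :
    ‖S.covariance i j‖ ≤ S.size :=
  (le_ciSup (f := fun j => ‖S.covariance i j‖) (Set.finite_range _).bddAbove j).trans
    (le_ciSup (f := fun i => ⨆ j, ‖S.covariance i j‖) (Set.finite_range _).bddAbove i)

theorem NoiseFamily.size_nonneg (S : NoiseFamily) : 0 ≤ S.size :=
  (norm_nonneg _).trans (S.norm_covariance_le 0 0)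

theorem NoiseFamily.noiseOp_apply (S : NoiseFamily) (u : W2 p) :
    S.noiseOp p u = (1 / 2 : ℂ) • ∑ i, ∑ j, mulOp p (S.covariance i j) (secondDeriv p i j u) := by
  change ((1 / 2 : ℂ) • ∑ i, ∑ j, mulOp p (S.covariance i j) ∘ₗ secondDeriv p i j) u = _
  simp only [LinearMap.smul_apply, LinearMap.sum_apply, LinearMap.comp_apply]

/-- Each of the four entries contributes at most `size · K/4`; the prefactor `1/2` leaves a factor 2
to spare. -/
theorem NoiseFamily.norm_noiseOp_le (S : NoiseFamily) {ν K : ℝ} (hK : HessianBound ν p K)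
    (hK0 : 0 ≤ K) (u : W2 p) : ‖S.noiseOp p u‖ ≤ K * S.size * ‖laplaceOp ν p u‖ := by
  have h1 : ∀ i j, ‖mulOp p (S.covariance i j) (secondDeriv p i j u)‖ ≤
      S.size * (K / 4 * ‖laplaceOp ν p u‖) := fun i j => by
    refine (norm_mulOp_le _ _).trans ?_
    have := S.size_nonneg
    gcongr
    · exact S.norm_covariance_le i j
    · exact hK u i j
  have h2 : ‖∑ i, ∑ j, mulOp p (S.covariance i j) (secondDeriv p i j u)‖ ≤
      ∑ _i : Fin 2, ∑ _j : Fin 2, S.size * (K / 4 * ‖laplaceOp ν p u‖) :=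
    norm_sum_le_of_le _ fun i _ => norm_sum_le_of_le _ fun j _ => h1 i j
  have h3 : 0 ≤ K * S.size * ‖laplaceOp ν p u‖ := by
    have := S.size_nonneg
    positivity
  rw [S.noiseOp_apply, norm_smul]
  simp only [Fin.sum_univ_two] at h2 ⊢
  norm_num
  nlinarith

end Operators
end TorusSemigroup

/-! ### Assembly of the four statements. -/

theorem mainTheorem9 (ν : ℝ) (hν : 0 < ν) (p : ENNReal) [Fact (1 ≤ p)] (hp2 : 2 ≤ p)
    (hp : p ≠ ⊤) :
    -- the `L^p` resolvent bound for the Laplacian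
    (∀ (z : ℂ), 0 ≤ z.re → ∀ u : W2 p,
      ‖z‖ * ‖(u : LpT p)‖ ≤ resolventConst p * ‖z • (u : LpT p) - laplaceOp 1 p u‖) ∧
    -- the explicit threshold for relatively bounded perturbations of `νΔ`
    (∀ (B : LpT p →ₗ.[ℂ] LpT p) (hB : W2 p ≤ B.domain) (a : ℝ), 0 ≤ a → a ≤ threshold p →
      (∀ f : W2 p, ‖B ⟨f, hB f.2⟩‖ ≤ a * ‖laplaceOp ν p f‖) →
      GeneratesBoundedAnalyticSemigroup (laplaceOp ν p + B)) ∧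
    -- the second derivatives are bounded relatively to `νΔ`, with a constant `K = K(ν, p)`
    (∃ K : ℝ, 0 < K ∧ HessianBound ν p K) ∧
    -- for small noise, `A` is a small perturbation of `νΔ` and generates an analytic semigroup
    (∀ K : ℝ, 0 < K → HessianBound ν p K → ∀ S : NoiseFamily, S.size < threshold p / K →
      (K * S.size < threshold p ∧
        ∀ f : W2 p, ‖S.noiseOp p f‖ ≤ K * S.size * ‖laplaceOp ν p f‖) ∧
      GeneratesBoundedAnalyticSemigroup (laplaceOp ν p + S.noiseOp p)) := by
  refine ⟨fun z hz u => ?_, fun B hB a ha haδ h => generates_laplaceOp_add hp2 hp hν B hB ha haδ h,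
    ?_, fun K hK hH S hS => ?_⟩
  · rw [laplaceOp_apply, Complex.ofReal_one, one_smul]
    exact resolvent_estimate hp2 hp hz u
  · have hP : 2 ≤ p.toReal := by simpa using ENNReal.toReal_mono hp hp2
    have hc := bellmanConst_pos hP
    -- The Hessian bound has constant `4 / bellmanConst` relative to `Δ`; the normalizations `K/4`
    -- and `νΔ` turn it into this `K`.
    refine ⟨16 / (bellmanConst p.toReal * ν), by positivity, fun f i j => ?_⟩
    refine (norm_secondDeriv_le hp2 hp i j f).trans (le_of_eq ?_)
    rw [laplaceOp_apply, norm_smul, Complex.norm_real, Real.norm_of_nonneg hν.le]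
    field_simp
    ring
  · have h1 : K * S.size < threshold p := by
      rw [lt_div_iff₀ hK] at hS
      linarith
    have h2 := fun f => S.norm_noiseOp_le hH hK.le f
    exact ⟨⟨h1, h2⟩, generates_laplaceOp_add hp2 hp hν (S.noiseOp p) le_rfl
      (mul_nonneg hK.le S.size_nonneg) h1.le h2⟩
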